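/- **Conventions.** Work over $k=\mathbf F_2$. For a pointed set $S$ with base point $0$, $k[S]$ is the vector space with basis $S\setminus\{0\}$. A *differential graded pointed set* is a pointed set $S$ with pointed subsets $S_g$ ($g\in\mathbf Z$), covering $S$ and meeting pairwise in $\{0\}$, and a linear endomorphism $d$ of $k[S]$ with $d^2=0$ and $d(S_g)\subset k[S_{g+1}]$, which is bounded (there is $N$ such that $d(s)$ involves fewer than $N$ elements of $S$, for all $s\in S$). A *differential graded pointed category* has differential graded pointed sets of morphisms, with pointed composition that adds degrees and satisfies the Leibniz rule, and identities of degree $0$. Bimodules over such a category and their tensor products $\wedge$ are defined in the usual way (the tensor product is the coequalizer of the two actions). **The category $\mathcal U^\bullet$.** For $n\ge 0$, $H_n^\bullet$ is the monoid with zero generated by $T_1,\dots,T_{n-1}$ with relations $T_i^2=0$, $T_iT_j=T_jT_i$ if $|i-j|>1$, and $T_iT_{i+1}T_i=T_{i+1}T_iT_{i+1}$. It is graded with $T_i$ in degree $-1$, with the differential given by $d(T_i)=1$ and the Leibniz rule; $H_n=k[H_n^\bullet]$. Let $f_1:H_r^\bullet\to H_s^\bullet$ ($r<s$) be $T_i\mapsto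 T_{i+1}$. The category $\mathcal U^\bullet$ has objects $e^n$, $n\ge 0$, with $\mathrm{End}(e^n)=H_n^\bullet$ and $\mathrm{Hom}(e^m,e^n)=0$ for $m\ne n$. Let $F_1=R^-(-,-,e)$ be the $(\mathcal U^\bullet,\mathcal U^\bullet)$-bimodule with $R^-(e^s,e^r,e)=H_s^\bullet$ if $s=r+1$ and $0$ otherwise, where $H_s^\bullet$ acts on the left by multiplication and $h\in H_r^\bullet$ acts on the right by multiplication by $f_1(h)$. Let $E_2=L^+(-,-,e)$ be the bimodule with $L^+(e^r,e^s,e)=H_s^\bullet$ if $s=r+1$ and $0$ otherwise, where $h\in H_r^\bullet$ acts on the left by multiplication by its image under $T_i\mapsto T_i$ and $H_s^\bullet$ acts on the right by multiplication. Let $\tau_1$ be the endomorphism of $F_1^2$ given by $a\wedge b\mapsto a f_1(b)T_1\wedge 1$, let $\tau_2$ be the endomorphism of $E_2^2$ given on $E_2^2(e^{s-2},e^s)$ by $u\wedge v\mapsto 1\wedge T_{s-1}uv$, and let $\lambda:F_1E_2\to E_2F_1$, $\lambda(a\wedge b)=a\wedge f_1(b)$. **The diagonal category.** Let $T_{\mathcal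 V}(M)$ be the tensor category of a $(\mathcal V,\mathcal V)$-bimodule $M$: it has the objects of $\mathcal V$ and pointed sets of morphisms $\bigvee_{i\ge 0}M^i$. The category $\Delta'_\lambda(\mathcal U^\bullet)$ is the quotient of $T_{\mathcal U^\bullet}(F_1E_2)$ by the congruence (equivalence relation compatible with composition) generated by $$(F_1\lambda E_2)\circ(\tau_1E_2^2)(f)\sim(F_1\lambda E_2)\circ(F_1^2\tau_2)(f)\qquad\text{for } f\in F_1^2E_2^2,$$ with the induced gradings and differentials. **The category $\mathcal H^+$.** For $n\ge 1$, let $\hat{\mathfrak S}_n$ be the group of permutations $\sigma$ of $\mathbf Z$ with $\sigma(r+n)=\sigma(r)+n$ for all $r$. It is generated by $c:r\mapsto r+1$ and, if $n\ge 2$, the simple reflections $s_a$, $a\in\mathbf Z/n$ (exchanging $r$ and $r+1$ for $r\in a$). Let $\ell(\sigma)$ be the smallest $l$ such that $\sigma=s_{a_1}\cdots s_{a_l}c^e$ for some $a_1,\dots,a_l$ and $e\in\mathbf Z$; if $\sigma=s_{a_1}\cdots s_{a_l}c^e$ with $l=\ell(\sigma)$, then $\sigma'\le\sigma$ if and only if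 $\sigma'=wc^e$ with $w$ the product of a subexpression of $s_{a_1}\cdots s_{a_l}$. Let $\hat{\mathfrak S}_n^+=\{\sigma\in\hat{\mathfrak S}_n\mid\sigma(\mathbf Z_{>0})\subset\mathbf Z_{>0}\}$, and $\hat{\mathfrak S}_0=\hat{\mathfrak S}_0^+=1$. The positive affine nil Hecke monoid is $\hat{\mathfrak S}_n^{+,\mathrm{nil}}=\{0\}\cup\{T_\sigma\}_{\sigma\in\hat{\mathfrak S}_n^+}$, with $T_\sigma T_{\sigma'}=T_{\sigma\sigma'}$ if $\ell(\sigma\sigma')=\ell(\sigma)+\ell(\sigma')$ and $T_\sigma T_{\sigma'}=0$ otherwise, with $T_\sigma$ in degree $-\ell(\sigma)$ and with $d(T_\sigma)=\sum_{\sigma'<\sigma,\ \ell(\sigma')=\ell(\sigma)-1}T_{\sigma'}$. Put $\hat H_n^+=k[\hat{\mathfrak S}_n^{+,\mathrm{nil}}]$. The category $\mathcal H^+$ has objects the integers $n\ge 0$, with $\mathrm{End}(n)=\hat{\mathfrak S}_n^{+,\mathrm{nil}}$ and $\mathrm{Hom}(m,n)=0$ for $m\neq n$. **Local form.** For $s\ge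 1$ let $M_s=H_s\otimes_{H_{s-1}}H_s$, where $h\in H_{s-1}$ acts on the right on the first factor by $f_1(h)$ and on the left on the second factor by its image under $T_i\mapsto T_i$; this is a differential graded $(H_s,H_s)$-bimodule. Put $M_0=0$. Let $\kappa=(1\otimes 1)\otimes(1\otimes T_{s-1})-(T_1\otimes 1)\otimes(1\otimes 1)\in M_s\otimes_{H_s}M_s$ if $s\ge 2$, and $\kappa=0$ if $s\le 1$. **Theorem.** The categories $\Delta'_\lambda(\mathcal U^\bullet)$ and $\mathcal H^+$ are differential graded pointed categories. For every $s\ge 0$ the differentials of $H_s$ and $M_s$ extend to a derivation of $T_{H_s}(M_s)/(\kappa)$, and there is an isomorphism of differential graded algebras $$\varphi_s: T_{H_s}(M_s)/(\kappa)\xrightarrow{\ \sim\ }\hat H_s^+,\qquad T_i\mapsto T_{s_i}\ (1\le i<s),\qquad a\otimes b\mapsto a\,c\,b\ \ (a,b\in H_s)$$ (where $a$, $c$, $b$ on the right denote $\varphi_s(a)$, $T_c$ and $\varphi_s(b)$). These isomorphisms induce an isomorphism of differential graded pointed categories $$\Theta:\Delta'_\lambda(\mathcal U^\bullet)\xrightarrow{\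 \sim\ }\mathcal H^+,$$ which is $e^s\mapsto s$ on objects, and which sends the endomorphism of $e^s$ given by $a\in H_s^\bullet$ to $\varphi_s(a)$ and the one given by $a\wedge b\in F_1E_2(e^s,e^s)$, $a,b\in H_s^\bullet$, to $\varphi_s(a\otimes b)$. -/

import Mathlib

section
open scoped Classical
noncomputable section
namespace NilGlue

/-! ## Differential graded pointed sets -/

/-- The `𝔽₂`-vector space `𝔽₂[S]` of a pointed set `S`: it has the non-zero elements of `S`
as a basis. -/
abbrev F2 (S : Type) [Zero S] : Type := {s : S // s ≠ 0} →₀ ZMod 2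

namespace F2

variable {S T U : Type} [Zero S] [Zero T] [Zero U]

/-- The canonical pointed map `S → 𝔽₂[S]`. -/
def of (s : S) : F2 S := if h : s = 0 then 0 else Finsupp.single ⟨s, h⟩ 1

/-- Linear extension of a pointed map from `S` to a vector space. -/
def lift {N : Type} [AddCommGroup N] [Module (ZMod 2) N] (f : S → N) : F2 S →ₗ[ZMod 2] N :=
  Finsupp.linearCombination (ZMod 2) (fun s : {s : S // s ≠ 0} => f s.1)

/-- The linear map `𝔽₂[f] : 𝔽₂[S] → 𝔽₂[T]` of a pointed map `f : S → T`. -/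
def map (f : S → T) : F2 S →ₗ[ZMod 2] F2 T := lift (fun s => of (f s))

@[simp] theorem of_zero : of (0 : S) = 0 := by simp [of]

theorem of_coe (s : {s : S // s ≠ 0}) : of s.1 = Finsupp.single s 1 := by
  simp [of, s.2]

theorem lift_of {N : Type} [AddCommGroup N] [Module (ZMod 2) N] (f : S → N) (h : f 0 = 0)
    (s : S) : lift f (of s) = f s := by
  by_cases hs : s = 0
  · subst hs; simp [h]
  · simp [lift, of, hs]

theorem map_of (f : S → T) (h : f 0 = 0) (s : S) : map f (of s) = of (f s) :=
  lift_of _ (by simp [h]) s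

theorem hom_ext {N : Type} [AddCommGroup N] [Module (ZMod 2) N] {φ ψ : F2 S →ₗ[ZMod 2] N}
    (h : ∀ s, φ (of s) = ψ (of s)) : φ = ψ := by
  refine Finsupp.lhom_ext' fun s => LinearMap.ext_ring ?_
  have := h s.1
  rw [of_coe] at this
  simpa using this

/-- Two linear maps that agree on basis elements agree. -/
theorem hom_ext_apply {N : Type} [AddCommGroup N] [Module (ZMod 2) N]
    {φ ψ : F2 S →ₗ[ZMod 2] N} (h : ∀ s, φ (of s) = ψ (of s)) (x : F2 S) : φ x = ψ x := by
  rw [hom_ext h]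

theorem map_map (f : S → T) (g : T → U) (hf : f 0 = 0) (hg : g 0 = 0) (x : F2 S) :
    map g (map f x) = map (fun s => g (f s)) x := by
  refine hom_ext_apply (φ := (map g).comp (map f)) (fun s => ?_) x
  simp [map_of _ hf, map_of _ hg, map_of (fun s => g (f s)) (by simp [hf, hg])]

theorem map_id (x : F2 S) : map (fun s : S => s) x = x := by
  refine hom_ext_apply (φ := map _) (ψ := LinearMap.id) (fun s => ?_) x
  simp [map_of]

theorem map_zero_fun (f : S → T) (h : ∀ s, f s = 0) (x : F2 S) : map f x = 0 := by
  refine hom_ext_apply (φ := map f) (ψ := 0) (fun s => ?_) x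
  simp [map_of _ (h 0), h]

theorem lift_add_fun {N : Type} [AddCommGroup N] [Module (ZMod 2) N] (f g : S → N) (x : F2 S) :
    lift (fun s => f s + g s) x = lift f x + lift g x := by
  simp [lift, Finsupp.linearCombination_apply, Finsupp.sum_add, smul_add]

theorem lift_congr {N : Type} [AddCommGroup N] [Module (ZMod 2) N] {f g : S → N}
    (h : ∀ s, f s = g s) (x : F2 S) : lift f x = lift g x := by
  rw [funext h]

theorem bilin_comm (f : S → T → U) (h0 : ∀ t, f 0 t = 0) (a : F2 S)
    (b : F2 T) : lift (fun s => map (f s) b) a = lift (fun t => map (fun s => f s t) a) b := by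
  induction a using Finsupp.induction_linear with
  | zero => simp [lift, Finsupp.linearCombination_apply]
  | add x y hx hy => simp only [map_add, lift_add_fun, hx, hy]
  | single s r =>
    rw [← mul_one r, ← smul_eq_mul, ← Finsupp.smul_single, ← of_coe, map_smul,
      lift_of (fun s => map (f s) b) (map_zero_fun _ h0 _)]
    have : ∀ t, map (fun s => f s t) (r • of s.1) = r • of (f s.1 t) := fun t => by
      rw [map_smul, map_of _ (h0 t)]
    rw [lift_congr this]
    simp [map, lift, Finsupp.linearCombination_apply, Finsupp.smul_sum, smul_comm r]

/-- The subspace of `𝔽₂[S]` spanned by a subset of `S`. -/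
def on (A : Set S) : Submodule (ZMod 2) (F2 S) :=
  Finsupp.supported (ZMod 2) (ZMod 2) {t : {s : S // s ≠ 0} | t.1 ∈ A}

theorem of_mem_on {A : Set S} {s : S} (h : s ∈ A) : of s ∈ on A := by
  by_cases hs : s = 0
  · subst hs; simp
  · simp only [of, hs, dite_false, on]
    exact Finsupp.single_mem_supported _ _ h

theorem on_induction {A : Set S} {N : Type} [AddCommGroup N] [Module (ZMod 2) N]
    (φ : F2 S →ₗ[ZMod 2] N) (P : Submodule (ZMod 2) N) (h : ∀ s ∈ A, φ (of s) ∈ P)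
    {x : F2 S} (hx : x ∈ on A) : φ x ∈ P := by
  have hle : on A ≤ P.comap φ := by
    rw [on, Finsupp.supported_eq_span_single, Submodule.span_le]
    rintro _ ⟨t, ht, rfl⟩
    have := h t.1 ht
    rwa [of_coe] at this
  exact hle hx

theorem map_mem_on {A : Set S} {B : Set T} (f : S → T) (h0 : f 0 = 0)
    (h : ∀ s ∈ A, f s ∈ B) {x : F2 S} (hx : x ∈ on A) : map f x ∈ on B :=
  on_induction (map f) (on B) (fun s hs => by rw [map_of f h0]; exact of_mem_on (h s hs)) hx

theorem add_self (x : F2 S) : x + x = 0 := by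
  ext t; simpa using CharTwo.add_self_eq_zero (x t)

end F2

/-- The data of a pointed set `S` with a family of subsets `S_g` (`g ∈ ℤ`) and a linear
endomorphism `d` of `𝔽₂[S]`. -/
class DGP (S : Type) extends Zero S where
  /-- the subset `S_g` of elements of degree `g` -/
  gr : ℤ → Set S
  /-- the differential -/
  d : F2 S →ₗ[ZMod 2] F2 S

/-- The axioms of a differential graded pointed set: the pointed subsets `S_g` cover `S` and meet
pairwise in the base point, `d² = 0`, and `d(S_g) ⊆ 𝔽₂[S_{g+1}]`.
(Boundedness of `d` is the separate condition `DGP.Bounded`.) -/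
class LawfulDGP (S : Type) [DGP S] : Prop where
  zero_mem : ∀ g, (0 : S) ∈ DGP.gr g
  exhaust : ∀ s : S, ∃ g, s ∈ DGP.gr g
  separated : ∀ {g h : ℤ} {s : S}, s ∈ DGP.gr g → s ∈ DGP.gr h → g ≠ h → s = 0
  d_sq : ∀ x : F2 S, DGP.d (DGP.d x) = 0
  d_gr : ∀ {g : ℤ} {s : S}, s ∈ DGP.gr g → DGP.d (F2.of s) ∈ F2.on (DGP.gr (S := S) (g + 1))

theorem LawfulDGP.deg_unique {S : Type} [DGP S] [LawfulDGP S] {g h : ℤ} {s : S} (hs : s ≠ 0)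
    (hg : s ∈ DGP.gr g) (hh : s ∈ DGP.gr h) : g = h := by
  by_contra hne
  exact hs (LawfulDGP.separated hg hh hne)

/-- The differential is bounded: there is `N` such that `d s` involves less than `N` elements of `S`, for
all `s ∈ S`. -/
def DGP.Bounded (S : Type) [DGP S] : Prop :=
  ∃ N : ℕ, ∀ s : S, (DGP.d (F2.of s)).support.card < N

open DGP F2

/-! ## Differential graded pointed categories -/

/-- The data underlying a differential graded pointed category with set of objects `O`.
Here `mor x y` is the pointed set `Hom(y, x)` of maps **from `y` to `x`**, so that
`comp f g` is the composite `f ∘ g`, for `g : z → y` and `f : y → x`. -/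
structure DPCat (O : Type) where
  mor : O → O → Type
  [dgp : ∀ x y, DGP (mor x y)]
  one : ∀ x, mor x x
  comp : ∀ {x y z}, mor x y → mor y z → mor x z

attribute [instance] DPCat.dgp

/-- The axioms of a differential graded pointed category, except the boundedness of the differentials. -/
class DPCat.Lawful {O : Type} (C : DPCat O) : Prop where
  lawful : ∀ x y, LawfulDGP (C.mor x y)
  zero_comp : ∀ {x y z} (g : C.mor y z), C.comp (0 : C.mor x y) g = 0
  comp_zero : ∀ {x y z} (f : C.mor x y), C.comp f (0 : C.mor y z) = 0
  one_comp : ∀ {x y} (f : C.mor x y), C.comp (C.one x) f = f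
  comp_one : ∀ {x y} (f : C.mor x y), C.comp f (C.one y) = f
  assoc : ∀ {x y z w} (f : C.mor x y) (g : C.mor y z) (h : C.mor z w),
    C.comp (C.comp f g) h = C.comp f (C.comp g h)
  one_gr : ∀ x, C.one x ∈ gr (S := C.mor x x) 0
  comp_gr : ∀ {x y z} {p q : ℤ} {f : C.mor x y} {g : C.mor y z}, f ∈ gr p → g ∈ gr q →
    C.comp f g ∈ gr (S := C.mor x z) (p + q)
  leibniz : ∀ {x y z} (f : C.mor x y) (g : C.mor y z),
    d (of (C.comp f g)) = map (fun f' => C.comp f' g) (d (of f)) + map (fun g' => C.comp f g') (d (of g))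

/-- `C` is a differential graded pointed category. -/
def DPCat.IsDGPointedCategory {O : Type} (C : DPCat O) : Prop :=
  C.Lawful ∧ ∀ x y, Bounded (C.mor x y)

/-- An isomorphism of differential graded pointed categories that is the identity on objects. -/
structure DPCat.Iso {O : Type} (C D : DPCat O) where
  toEquiv : ∀ x y, C.mor x y ≃ D.mor x y
  map_zero : ∀ x y, toEquiv x y 0 = 0
  map_one : ∀ x, toEquiv x x (C.one x) = D.one x
  map_comp : ∀ {x y z} (f : C.mor x y) (g : C.mor y z),
    toEquiv x z (C.comp f g) = D.comp (toEquiv x y f) (toEquiv y z g)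
  map_gr : ∀ {x y} (g : ℤ) (f : C.mor x y), toEquiv x y f ∈ gr (S := D.mor x y) g ↔ f ∈ gr (S := C.mor x y) g
  map_d : ∀ {x y} (f : C.mor x y), d (of (toEquiv x y f)) = map (toEquiv x y) (d (of f))

/-! ## Modules, bimodules and their tensor products -/

/-- A left module over `V`: a differential graded pointed functor from `V` to differential graded pointed sets
(`V.mor x y` acts from `N y` to `N x`). -/
structure LMod {O : Type} (V : DPCat O) where
  car : O → Type
  [dgp : ∀ x, DGP (car x)]
  lawful : ∀ x, LawfulDGP (car x)
  act : ∀ {x y}, V.mor x y → car y → car x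
  zero_act : ∀ {x y} (n : car y), act (0 : V.mor x y) n = 0
  act_zero : ∀ {x y} (f : V.mor x y), act f (0 : car y) = 0
  one_act : ∀ {x} (n : car x), act (V.one x) n = n
  act_act : ∀ {x y z} (f : V.mor x y) (g : V.mor y z) (n : car z),
    act f (act g n) = act (V.comp f g) n
  act_gr : ∀ {x y} {p q : ℤ} {f : V.mor x y} {n : car y}, f ∈ gr p → n ∈ gr q →
    act f n ∈ gr (S := car x) (p + q)
  leibniz : ∀ {x y} (f : V.mor x y) (n : car y),
    d (of (act f n)) = map (fun f' => act f' n) (d (of f)) + map (fun n' => act f n') (d (of n))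

attribute [instance] LMod.dgp LMod.lawful

/-- A differential graded pointed `(V, V)`-bimodule. -/
structure Bimod {O : Type} (V : DPCat O) where
  car : O → O → Type
  [dgp : ∀ x y, DGP (car x y)]
  lawful : ∀ x y, LawfulDGP (car x y)
  lact : ∀ {x y z}, V.mor x y → car y z → car x z
  ract : ∀ {x y z}, car x y → V.mor y z → car x z
  zero_lact : ∀ {x y z} (m : car y z), lact (0 : V.mor x y) m = 0
  lact_zero : ∀ {x y z} (f : V.mor x y), lact f (0 : car y z) = 0
  zero_ract : ∀ {x y z} (f : V.mor y z), ract (0 : car x y) f = 0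
  ract_zero : ∀ {x y z} (m : car x y), ract m (0 : V.mor y z) = 0
  one_lact : ∀ {x y} (m : car x y), lact (V.one x) m = m
  ract_one : ∀ {x y} (m : car x y), ract m (V.one y) = m
  lact_lact : ∀ {x y z w} (f : V.mor x y) (g : V.mor y z) (m : car z w),
    lact f (lact g m) = lact (V.comp f g) m
  ract_ract : ∀ {x y z w} (m : car x y) (f : V.mor y z) (g : V.mor z w),
    ract (ract m f) g = ract m (V.comp f g)
  lact_ract : ∀ {x y z w} (f : V.mor x y) (m : car y z) (g : V.mor z w),
    lact f (ract m g) = ract (lact f m) g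
  lact_gr : ∀ {x y z} {p q : ℤ} {f : V.mor x y} {m : car y z}, f ∈ gr p → m ∈ gr q →
    lact f m ∈ gr (S := car x z) (p + q)
  ract_gr : ∀ {x y z} {p q : ℤ} {m : car x y} {f : V.mor y z}, m ∈ gr p → f ∈ gr q →
    ract m f ∈ gr (S := car x z) (p + q)
  lleibniz : ∀ {x y z} (f : V.mor x y) (m : car y z),
    d (of (lact f m)) = map (fun f' => lact f' m) (d (of f)) + map (fun m' => lact f m') (d (of m))
  rleibniz : ∀ {x y z} (m : car x y) (f : V.mor y z),
    d (of (ract m f)) = map (fun m' => ract m' f) (d (of m)) + map (fun f' => ract m f') (d (of f))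

attribute [instance] Bimod.dgp Bimod.lawful

variable {O : Type} {V : DPCat O}

/-- The left module `M(-, z)`. -/
abbrev Bimod.left (M : Bimod V) (z : O) : LMod V where
  car x := M.car x z
  lawful x := M.lawful x z
  act f m := M.lact f m
  zero_act := M.zero_lact
  act_zero := M.lact_zero
  one_act := M.one_lact
  act_act := M.lact_lact
  act_gr := M.lact_gr
  leibniz := M.lleibniz

/-- The left module `Hom(z, -)` represented by `z`. -/
abbrev repr (V : DPCat O) [hV : V.Lawful] (z : O) : LMod V where
  car x := V.mor x z
  lawful x := hV.lawful x z
  act f g := V.comp f g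
  zero_act := hV.zero_comp
  act_zero := hV.comp_zero
  one_act := hV.one_comp
  act_act f g n := (hV.assoc f g n).symm
  act_gr := hV.comp_gr
  leibniz := hV.leibniz

/-- The relation defining `M ∧_V N` on `⋁_y M(x, y) × N(y)` (`none` is the base point). -/
inductive WedgeRel (M : Bimod V) (N : LMod V) (x : O) :
    Option (Σ y, M.car x y × N.car y) → Option (Σ y, M.car x y × N.car y) → Prop
  | move {y z : O} (m : M.car x y) (f : V.mor y z) (n : N.car z) :
      WedgeRel M N x (some ⟨z, M.ract m f, n⟩) (some ⟨y, m, N.act f n⟩)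
  | zero_left (y : O) (n : N.car y) : WedgeRel M N x (some ⟨y, 0, n⟩) none
  | zero_right (y : O) (m : M.car x y) : WedgeRel M N x (some ⟨y, m, 0⟩) none

/-- The tensor product `M ∧_V N`, evaluated at `x`: the coequalizer of the two actions of `V`. -/
def Wedge (M : Bimod V) (N : LMod V) (x : O) : Type := Quot (WedgeRel M N x)

namespace Wedge

variable {M : Bimod V} {N : LMod V} {x : O}

instance : Zero (Wedge M N x) := ⟨Quot.mk _ none⟩

/-- The element `m ∧ n`. -/
def mk {y : O} (m : M.car x y) (n : N.car y) : Wedge M N x := Quot.mk _ (some ⟨y, m, n⟩)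

theorem mk_move {y z : O} (m : M.car x y) (f : V.mor y z) (n : N.car z) :
    mk (M.ract m f) n = mk m (N.act f n) := Quot.sound (.move m f n)

@[simp] theorem zero_mk {y : O} (n : N.car y) : (mk (0 : M.car x y) n : Wedge M N x) = 0 :=
  Quot.sound (.zero_left y n)

@[simp] theorem mk_zero {y : O} (m : M.car x y) : (mk m (0 : N.car y) : Wedge M N x) = 0 :=
  Quot.sound (.zero_right y m)

theorem ind {P : Wedge M N x → Prop} (h0 : P 0)
    (h : ∀ (y : O) (m : M.car x y) (n : N.car y), P (mk m n)) (w : Wedge M N x) : P w := by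
  induction w using Quot.ind with
  | mk a => match a with
    | none => exact h0
    | some ⟨y, m, n⟩ => exact h y m n

/-- A balanced pointed function on pairs `(m, n)` induces a map on `M ∧_V N`. -/
def lift {X : Type} (z : X) (f : ∀ y, M.car x y → N.car y → X)
    (h0 : ∀ y n, f y 0 n = z) (h1 : ∀ y m, f y m 0 = z)
    (hm : ∀ {y y'} (m : M.car x y) (g : V.mor y y') (n : N.car y'),
      f y' (M.ract m g) n = f y m (N.act g n)) : Wedge M N x → X :=
  Quot.lift (fun a => match a with
    | none => z
    | some ⟨y, m, n⟩ => f y m n) (by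
      rintro _ _ (⟨m, g, n⟩ | ⟨y, n⟩ | ⟨y, m⟩)
      · exact hm m g n
      · exact h0 y n
      · exact h1 y m)

/-- `d(m ∧ n) = d(m) ∧ n + m ∧ d(n)`. -/
def dfun : Wedge M N x → F2 (Wedge M N x) :=
  lift 0 (fun _ m n => map (fun m' => mk m' n) (d (of m)) + map (fun n' => mk m n') (d (of n)))
    (fun y n => by simp [map_zero_fun])
    (fun y m => by simp [map_zero_fun])
    (fun {y y'} m g n => by
      rw [M.rleibniz, N.leibniz, map_add, map_add,
        map_map _ _ (M.zero_ract g) (by simp), map_map _ _ (M.ract_zero m) (by simp),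
        map_map _ _ (N.zero_act n) (by simp), map_map _ _ (N.act_zero g) (by simp)]
      simp only [mk_move]
      abel)

instance : DGP (Wedge M N x) where
  gr g := {w | w = 0 ∨ ∃ (p q : ℤ) (y : O) (m : M.car x y) (n : N.car y),
    p + q = g ∧ m ∈ gr p ∧ n ∈ gr q ∧ w = mk m n}
  d := F2.lift dfun

theorem d_mk {y : O} (m : M.car x y) (n : N.car y) :
    d (of (mk m n : Wedge M N x)) =
      map (fun m' => mk m' n) (d (of m)) + map (fun n' => mk m n') (d (of n)) :=
  F2.lift_of _ rfl _

theorem d_map_left {y : O} (a : F2 (M.car x y)) (n : N.car y) :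
    d (map (fun m' => (mk m' n : Wedge M N x)) a) = map (fun m' => mk m' n) (d a) +
      F2.lift (fun m' => map (fun n' => (mk m' n' : Wedge M N x)) (d (of n))) a := by
  refine hom_ext_apply (φ := (d (S := Wedge M N x)).comp (map fun m' => mk m' n))
    (ψ := (map fun m' => mk m' n).comp d + F2.lift _) (fun m => ?_) a
  simp only [LinearMap.comp_apply, LinearMap.add_apply]
  rw [map_of _ (by simp), d_mk, F2.lift_of
    (fun m' => map (fun n' => (mk m' n' : Wedge M N x)) (d (of n))) (map_zero_fun _ (by simp) _)]

theorem d_map_right {y : O} (m : M.car x y) (b : F2 (N.car y)) :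
    d (map (fun n' => (mk m n' : Wedge M N x)) b) = map (fun n' => mk m n') (d b) +
      F2.lift (fun n' => map (fun m' => (mk m' n' : Wedge M N x)) (d (of m))) b := by
  refine hom_ext_apply (φ := (d (S := Wedge M N x)).comp (map fun n' => mk m n'))
    (ψ := (map fun n' => mk m n').comp d + F2.lift _) (fun n => ?_) b
  simp only [LinearMap.comp_apply, LinearMap.add_apply]
  rw [map_of _ (by simp), d_mk, F2.lift_of
    (fun n' => map (fun m' => (mk m' n' : Wedge M N x)) (d (of m))) (map_zero_fun _ (by simp) _),
    add_comm]

theorem d_sq (w : Wedge M N x) : d (d (of w)) = 0 := by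
  induction w using ind with
  | h0 => simp
  | h y m n =>
    rw [d_mk, map_add, d_map_left, d_map_right, (M.lawful x y).d_sq, (N.lawful y).d_sq,
      bilin_comm (fun m' n' => (mk m' n' : Wedge M N x)) (by simp)]
    simp only [map_zero, zero_add]
    exact F2.add_self _

/-- The class of `a` in `M ∧_V N`. -/
def cls (a : Option (Σ y, M.car x y × N.car y)) : Wedge M N x := Quot.mk _ a

/-- `a` is represented by a pair of elements of degrees adding up to `g`. -/
def HasDeg (g : ℤ) (a : Option (Σ y, M.car x y × N.car y)) : Prop :=
  ∃ (p q : ℤ) (y : O) (m : M.car x y) (n : N.car y),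
    p + q = g ∧ m ∈ gr p ∧ n ∈ gr q ∧ a = some ⟨y, m, n⟩

theorem hasDeg_iff {g p q : ℤ} {y : O} {m : M.car x y} {n : N.car y} (hm : m ∈ gr p)
    (hn : n ∈ gr q) (hm0 : m ≠ 0) (hn0 : n ≠ 0) :
    HasDeg g (some ⟨y, m, n⟩ : Option (Σ y, M.car x y × N.car y)) ↔ p + q = g := by
  constructor
  · rintro ⟨p', q', y', m', n', h, hm', hn', e⟩
    obtain ⟨rfl, e⟩ := Sigma.mk.inj (Option.some.inj e)
    obtain ⟨rfl, rfl⟩ := Prod.mk.inj (eq_of_heq e)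
    rw [LawfulDGP.deg_unique hm0 hm hm', LawfulDGP.deg_unique hn0 hn hn', h]
  · intro h
    exact ⟨p, q, y, m, n, h, hm, hn, rfl⟩

theorem hasDeg_eqv (hV : V.Lawful) {a b : Option (Σ y, M.car x y × N.car y)}
    (h : Relation.EqvGen (WedgeRel M N x) a b) :
    (cls a : Wedge M N x) = 0 ∨ ∀ g, HasDeg g a ↔ HasDeg g b := by
  induction h with
  | refl a => exact Or.inr fun g => Iff.rfl
  | symm a b h ih =>
    have : (cls a : Wedge M N x) = cls b := Quot.eqvGen_sound h
    rw [← this]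
    exact ih.imp_right fun h g => (h g).symm
  | trans a b c h1 h2 ih1 ih2 =>
    have : (cls a : Wedge M N x) = cls b := Quot.eqvGen_sound h1
    rcases ih1 with h | h
    · exact Or.inl h
    rcases ih2 with h' | h'
    · exact Or.inl (this.trans h')
    · exact Or.inr fun g => (h g).trans (h' g)
  | rel a b h =>
    have hab : (cls a : Wedge M N x) = cls b := Quot.sound h
    rcases h with ⟨m, f, n⟩ | ⟨y, n⟩ | ⟨y, m⟩
    · rename_i y z
      rw [or_iff_not_imp_left]
      intro h0
      have hmf : M.ract m f ≠ 0 := fun h => h0 (by rw [h]; exact zero_mk n)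
      have hfn : N.act f n ≠ 0 := fun h => h0 (by rw [hab, h]; exact mk_zero m)
      have hm : m ≠ 0 := fun h => hmf (by rw [h, M.zero_ract])
      have hn : n ≠ 0 := fun h => hfn (by rw [h, N.act_zero])
      obtain ⟨p, hp⟩ := (M.lawful x y).exhaust m
      obtain ⟨q, hq⟩ := (N.lawful z).exhaust n
      obtain ⟨r, hr⟩ := hV.lawful y z |>.exhaust f
      intro g
      rw [hasDeg_iff (M.ract_gr hp hr) hq hmf hn, hasDeg_iff hp (N.act_gr hr hq) hm hfn, add_assoc]
    · exact Or.inl (zero_mk n)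
    · exact Or.inl (mk_zero m)

instance lawful [hV : V.Lawful] : LawfulDGP (Wedge M N x) where
  zero_mem g := Or.inl rfl
  exhaust w := by
    induction w using ind with
    | h0 => exact ⟨0, Or.inl rfl⟩
    | h y m n =>
      obtain ⟨p, hp⟩ := (M.lawful x y).exhaust m
      obtain ⟨q, hq⟩ := (N.lawful y).exhaust n
      exact ⟨p + q, Or.inr ⟨p, q, y, m, n, rfl, hp, hq, rfl⟩⟩
  separated := by
    rintro g h w (rfl | ⟨p, q, y, m, n, hg, hm, hn, rfl⟩) (h2 | ⟨p', q', y', m', n', hh, hm', hn', e⟩) hgh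
    · rfl
    · rfl
    · exact h2
    · by_contra h0
      have hm0 : m' ≠ 0 := fun h => h0 (by rw [e, h, zero_mk])
      have hn0 : n' ≠ 0 := fun h => h0 (by rw [e, h, mk_zero])
      have := (hasDeg_eqv hV (Quot.eqvGen_exact e)).resolve_left h0 g
      have h3 := this.1 ⟨p, q, y, m, n, hg, hm, hn, rfl⟩
      rw [hasDeg_iff hm' hn' hm0 hn0] at h3
      exact hgh (h3.symm.trans hh)
  d_sq x := by
    refine hom_ext_apply (φ := d.comp d) (ψ := 0) (fun w => ?_) x
    exact d_sq w
  d_gr := by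
    rintro g w (rfl | ⟨p, q, y, m, n, hg, hm, hn, rfl⟩)
    · simp
    · rw [d_mk]
      refine Submodule.add_mem _ ?_ ?_
      · refine map_mem_on (A := gr (p + 1)) _ (by simp) (fun m' hm' => ?_) ((M.lawful x y).d_gr hm)
        exact Or.inr ⟨p + 1, q, y, m', n, by omega, hm', hn, rfl⟩
      · refine map_mem_on (A := gr (q + 1)) _ (by simp) (fun n' hn' => ?_) ((N.lawful y).d_gr hn)
        exact Or.inr ⟨p, q + 1, y, m, n', by omega, hm, hn', rfl⟩

/-- The action of `V` on `M ∧_V N`: `f(m ∧ n) = (fm) ∧ n`. -/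
def act {x' : O} (f : V.mor x' x) : Wedge M N x → Wedge M N x' :=
  lift 0 (fun _ m n => mk (M.lact f m) n) (fun y n => by simp [M.lact_zero]) (fun y m => by simp)
    (fun m g n => by rw [M.lact_ract, mk_move])

theorem act_mk {x' y : O} (f : V.mor x' x) (m : M.car x y) (n : N.car y) :
    act f (mk m n : Wedge M N x) = mk (M.lact f m) n := rfl

@[simp] theorem act_zero {x' : O} (f : V.mor x' x) : act f (0 : Wedge M N x) = 0 := rfl

theorem zero_act {x' : O} (w : Wedge M N x) : act (0 : V.mor x' x) w = 0 := by
  induction w using ind with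
  | h0 => rfl
  | h y m n => rw [act_mk, M.zero_lact, zero_mk]

end Wedge

/-- The tensor product `M ∧_V N` of a bimodule and a left module, as a left module. -/
def wedgeL [V.Lawful] (M : Bimod V) (N : LMod V) : LMod V where
  car x := Wedge M N x
  lawful x := Wedge.lawful
  act f w := Wedge.act f w
  zero_act := Wedge.zero_act
  act_zero := Wedge.act_zero
  one_act w := by
    induction w using Wedge.ind with
    | h0 => rfl
    | h y m n => rw [Wedge.act_mk, M.one_lact]
  act_act f g w := by
    induction w using Wedge.ind with
    | h0 => rfl
    | h y m n => rw [Wedge.act_mk, Wedge.act_mk, Wedge.act_mk, M.lact_lact]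
  act_gr := by
    rintro x y p q f w hf (rfl | ⟨p', q', y, m, n, hg, hm, hn, rfl⟩)
    · exact Or.inl rfl
    · exact Or.inr ⟨p + p', q', y, _, n, by omega, M.lact_gr hf hm, hn, rfl⟩
  leibniz f w := by
    induction w using Wedge.ind with
    | h0 => simp [map_zero_fun]
    | h y m n =>
      rw [Wedge.act_mk, Wedge.d_mk, Wedge.d_mk, M.lleibniz, map_add, map_add,
        map_map _ _ (M.zero_lact m) (by simp), map_map _ _ (M.lact_zero f) (by simp),
        map_map _ _ (by simp) (by simp), map_map _ _ (by simp) (by simp)]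
      simp only [Wedge.act_mk]
      abel

section

variable (M N : Bimod V)

/-- The right action of `V` on `M ∧_V N`: `(m ∧ n)f = m ∧ (nf)`. -/
def Wedge.actR {x z z' : O} (w : Wedge M (N.left z) x) (f : V.mor z z') : Wedge M (N.left z') x :=
  Wedge.lift 0 (fun _ m n => Wedge.mk m (N.ract n f)) (fun y n => by simp)
    (fun y m => by rw [N.zero_ract]; exact Wedge.mk_zero m)
    (fun m g n => by rw [Wedge.mk_move]; exact congrArg _ (N.lact_ract _ _ _)) w

theorem Wedge.actR_mk {x y z z' : O} (m : M.car x y) (n : N.car y z) (f : V.mor z z') :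
    Wedge.actR M N (Wedge.mk (N := N.left z) m n) f = Wedge.mk m (N.ract n f) := rfl

@[simp] theorem Wedge.zero_actR {x z z' : O} (f : V.mor z z') :
    Wedge.actR M N (0 : Wedge M (N.left z) x) f = 0 := rfl

theorem Wedge.actR_zero {x z z' : O} (w : Wedge M (N.left z) x) :
    Wedge.actR M N w (0 : V.mor z z') = 0 := by
  induction w using Wedge.ind with
  | h0 => rfl
  | h y m n => rw [Wedge.actR_mk, N.ract_zero]; exact Wedge.mk_zero m

/-- The tensor product `M ∧_V N` of two bimodules. -/
def wedge [V.Lawful] : Bimod V where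
  car x z := Wedge M (N.left z) x
  lawful x z := Wedge.lawful
  lact f w := Wedge.act f w
  ract w f := Wedge.actR M N w f
  zero_lact := Wedge.zero_act
  lact_zero := Wedge.act_zero
  zero_ract f := rfl
  ract_zero := Wedge.actR_zero M N
  one_lact := (wedgeL M (N.left _)).one_act
  ract_one w := by
    induction w using Wedge.ind with
    | h0 => rfl
    | h y m n => rw [Wedge.actR_mk, N.ract_one]
  lact_lact := (wedgeL M (N.left _)).act_act
  ract_ract w f g := by
    induction w using Wedge.ind with
    | h0 => rfl
    | h y m n => rw [Wedge.actR_mk, Wedge.actR_mk, Wedge.actR_mk, N.ract_ract]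
  lact_ract f w g := by
    induction w using Wedge.ind with
    | h0 => rfl
    | h y m n => rfl
  lact_gr := (wedgeL M (N.left _)).act_gr
  ract_gr := by
    rintro x y z p q w f (rfl | ⟨p', q', y, m, n, hg, hm, hn, rfl⟩) hf
    · exact Or.inl rfl
    · exact Or.inr ⟨p', q' + q, y, m, _, by omega, hm, N.ract_gr hn hf, rfl⟩
  lleibniz := (wedgeL M (N.left _)).leibniz
  rleibniz := fun {x z z'} w f => by
    induction w using Wedge.ind with
    | h0 => simp [map_zero_fun]
    | h y m n =>
      have e1 : ∀ {z : O} (m' : M.car x y), (Wedge.mk m' (0 : N.car y z) : Wedge M (N.left z) x) = 0 :=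
        fun m' => Wedge.mk_zero m'
      rw [Wedge.actR_mk, Wedge.d_mk, Wedge.d_mk, N.rleibniz, map_add, map_add,
        map_map _ _ (N.zero_ract f) (e1 _), map_map _ _ (N.ract_zero n) (e1 _),
        map_map _ _ (by simp) (by simp), map_map _ _ (e1 _) (by simp)]
      simp only [Wedge.actR_mk]
      abel

end

/-- A morphism of left modules: a pointed map that is compatible with the action (and is not required to commute with
the differential or to preserve degrees). -/
structure LHom (N P : LMod V) where
  toFun : ∀ {x}, N.car x → P.car x
  map_zero : ∀ {x}, toFun (0 : N.car x) = 0
  map_act : ∀ {x y} (f : V.mor x y) (n : N.car y), toFun (N.act f n) = P.act f (toFun n)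

/-- A morphism of bimodules: a pointed map that is compatible with both actions (and is not required to commute with
the differential or to preserve degrees). -/
structure BHom (M N : Bimod V) where
  toFun : ∀ {x y}, M.car x y → N.car x y
  map_zero : ∀ {x y}, toFun (0 : M.car x y) = 0
  map_lact : ∀ {x y z} (f : V.mor x y) (m : M.car y z), toFun (M.lact f m) = N.lact f (toFun m)
  map_ract : ∀ {x y z} (m : M.car x y) (f : V.mor y z), toFun (M.ract m f) = N.ract (toFun m) f

/-! ## The tensor category of a bimodule -/

/-- The wedge sum `⋁_i S_i` of a sequence of pointed sets (`none` is the base point). -/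
def Vee (S : ℕ → Type) [∀ i, DGP (S i)] : Type := Option (Σ i, {s : S i // s ≠ 0})

namespace Vee

variable {S : ℕ → Type} [∀ i, DGP (S i)]

instance : Zero (Vee S) := ⟨none⟩

/-- The inclusion of `S_i` in `⋁_i S_i`. -/
def inj (i : ℕ) (s : S i) : Vee S := if h : s = 0 then (0 : Vee S) else some ⟨i, s, h⟩

theorem inj_ne (i : ℕ) (s : S i) (h : s ≠ 0) : (inj i s : Vee S) = some ⟨i, s, h⟩ := dif_neg h

@[simp] theorem inj_zero (i : ℕ) : inj i (0 : S i) = 0 := by simp [inj]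

theorem ind {P : Vee S → Prop} (h : ∀ i s, P (inj i s)) (v : Vee S) : P v := by
  match v with
  | none => have := h 0 0; rwa [inj_zero] at this
  | some ⟨i, s, hs⟩ => have := h i s; rwa [inj_ne i s hs] at this

/-- A family of pointed maps `S_i → X` induces a map on `⋁_i S_i`. -/
def lift {X : Type} (z : X) (f : ∀ i, S i → X) : Vee S → X
  | none => z
  | some ⟨i, s⟩ => f i s.1

theorem lift_inj {X : Type} (z : X) (f : ∀ i, S i → X) (h : ∀ i, f i 0 = z) (i : ℕ) (s : S i) :
    lift z f (inj i s) = f i s := by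
  by_cases hs : s = 0
  · subst hs; rw [inj_zero, h]; rfl
  · rw [inj_ne i s hs]; rfl

theorem inj_eq {i j : ℕ} {s : S i} {t : S j} (h : inj i s = inj j t) :
    inj i s = 0 ∨ ∃ e : i = j, e ▸ s = t := by
  by_cases hs : s = 0
  · left; rw [hs, inj_zero]
  by_cases ht : t = 0
  · left; rw [h, ht, inj_zero]
  right
  rw [inj_ne i s hs, inj_ne j t ht] at h
  obtain ⟨rfl, h⟩ := Sigma.mk.inj (Option.some.inj h)
  exact ⟨rfl, congrArg Subtype.val (eq_of_heq h)⟩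

instance : DGP (Vee S) where
  gr g := {v | ∃ i s, s ∈ gr (S := S i) g ∧ v = inj i s}
  d := F2.lift (lift 0 fun i s => map (inj i) (d (of s)))

theorem d_inj (i : ℕ) (s : S i) : d (of (inj i s)) = map (inj i) (d (of s)) := by
  refine (F2.lift_of _ rfl _).trans (lift_inj _ _ (by simp) i s)

theorem d_map (i : ℕ) (a : F2 (S i)) : d (map (inj i) a) = map (inj i) (d a) := by
  refine hom_ext_apply (φ := (d (S := Vee S)).comp (map (inj i)))
    (ψ := (map (inj i)).comp d) (fun s => ?_) a
  simp only [LinearMap.comp_apply]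
  rw [map_of _ (by simp), d_inj]

instance lawful [∀ i, LawfulDGP (S i)] : LawfulDGP (Vee S) where
  zero_mem g := ⟨0, 0, LawfulDGP.zero_mem g, (inj_zero 0).symm⟩
  exhaust v := by
    induction v using ind with
    | h i s =>
      obtain ⟨g, hg⟩ := LawfulDGP.exhaust s
      exact ⟨g, i, s, hg, rfl⟩
  separated := by
    rintro g h v ⟨i, s, hs, rfl⟩ ⟨j, t, ht, e⟩ hgh
    rcases inj_eq e with h0 | ⟨rfl, h0⟩
    · exact h0
    · subst h0
      rw [LawfulDGP.separated hs ht hgh, inj_zero]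
  d_sq x := by
    refine hom_ext_apply (φ := d.comp d) (ψ := 0) (fun v => ?_) x
    induction v using ind with
    | h i s => simp [d_inj, d_map, LawfulDGP.d_sq]
  d_gr := by
    rintro g v ⟨i, s, hs, rfl⟩
    rw [d_inj]
    exact map_mem_on (B := gr (S := Vee S) (g + 1)) _ (by simp) (fun t ht => ⟨i, t, ht, rfl⟩)
      (LawfulDGP.d_gr hs)

end Vee

/-- The action of `V` on the wedge sum of a sequence of left modules. -/
def veeAct (N : ℕ → LMod V) {x y : O} (f : V.mor x y) (v : Vee fun i => (N i).car y) :
    Vee fun i => (N i).car x :=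
  Vee.lift 0 (fun i n => Vee.inj i ((N i).act f n)) v

theorem veeAct_inj (N : ℕ → LMod V) {x y : O} (f : V.mor x y) (i : ℕ) (n : (N i).car y) :
    veeAct N f (Vee.inj i n) = Vee.inj i ((N i).act f n) :=
  Vee.lift_inj (S := fun i => (N i).car y) 0 (fun i n => Vee.inj i ((N i).act f n))
    (fun i => by rw [(N i).act_zero, Vee.inj_zero]) i n

/-- The wedge sum of a sequence of left modules. -/
def veeL (N : ℕ → LMod V) : LMod V where
  car x := Vee fun i => (N i).car x
  lawful x := Vee.lawful
  act f v := veeAct N f v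
  zero_act v := by
    induction v using Vee.ind with
    | h i s => rw [veeAct_inj, (N i).zero_act, Vee.inj_zero]
  act_zero f := rfl
  one_act v := by
    induction v using Vee.ind with
    | h i s => rw [veeAct_inj, (N i).one_act]
  act_act f g v := by
    induction v using Vee.ind with
    | h i s => rw [veeAct_inj, veeAct_inj, veeAct_inj, (N i).act_act]
  act_gr := by
    rintro x y p q f v hf ⟨i, s, hs, rfl⟩
    rw [veeAct_inj]
    exact ⟨i, _, (N i).act_gr hf hs, rfl⟩
  leibniz := fun {x y} f v => by
    induction v using Vee.ind with
    | h i s =>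
      rw [veeAct_inj, Vee.d_inj, Vee.d_inj, (N i).leibniz, map_add,
        map_map _ _ ((N i).zero_act s) (by simp), map_map _ _ ((N i).act_zero f) (by simp),
        map_map _ (fun v => veeAct N f v) (by simp) rfl]
      simp only [veeAct_inj]

section Tensor

variable [V.Lawful] (M : Bimod V)

/-- The tensor powers `M^i(-, z)` of a bimodule: `M^0(-, z) = Hom(z, -)` and `M^{i+1} = M ∧ M^i`. -/
def pow (z : O) : ℕ → LMod V
  | 0 => repr V z
  | i + 1 => wedgeL M (pow z i)

/-- The maps with source `z` in the tensor category of `M`: `⋁_i M^i(-, z)`. -/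
def tensL (z : O) : LMod V := veeL (pow M z)

/-- The inclusion of `M^i` in `⋁_i M^i`. -/
def incl {x z : O} (i : ℕ) (w : ((pow M z) i).car x) : (tensL M z).car x := Vee.inj i w

/-- `m ∧ -`, from `M^i` to `M^{i+1}`. -/
def powCons {x y z : O} (m : M.car x y) (i : ℕ) (w : (pow M z i).car y) : (pow M z (i + 1)).car x :=
  Wedge.mk (N := pow M z i) m w

/-- `m ∧ -`, from `⋁_i M^i` to itself. -/
def cons {x y z : O} (m : M.car x y) : (tensL M z).car y → (tensL M z).car x :=
  Vee.lift 0 fun i w => incl M (i + 1) (powCons M m i w)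

theorem powCons_zero {x y z : O} (m : M.car x y) (i : ℕ) :
    powCons M m i (0 : (pow M z i).car y) = 0 := Wedge.mk_zero (N := pow M z i) m

theorem zero_powCons {x y z : O} (i : ℕ) (w : (pow M z i).car y) :
    powCons M (0 : M.car x y) i w = 0 := Wedge.zero_mk w

theorem incl_zero {x z : O} (i : ℕ) : incl M i (0 : ((pow M z) i).car x) = 0 := Vee.inj_zero _

theorem tens_ind {x z : O} {P : (tensL M z).car x → Prop} (h : ∀ i w, P (incl M i w))
    (t : (tensL M z).car x) : P t := Vee.ind h t

theorem cons_incl {x y z : O} (m : M.car x y) (i : ℕ) (w : ((pow M z) i).car y) :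
    cons M m (incl M i w) = incl M (i + 1) (powCons M m i w) :=
  Vee.lift_inj (S := fun i => (pow M z i).car y) 0 (fun i w => incl M (i + 1) (powCons M m i w))
    (fun i => by rw [powCons_zero, incl_zero]) i w

theorem cons_zero {x y z : O} (m : M.car x y) : cons M m (0 : (tensL M z).car y) = 0 := rfl

theorem zero_cons {x y z : O} (t : (tensL M z).car y) : cons M (0 : M.car x y) t = 0 := by
  induction t using tens_ind with
  | h i w => rw [cons_incl, zero_powCons, incl_zero]

theorem tens_act_incl {x y z : O} (f : V.mor x y) (i : ℕ) (w : ((pow M z) i).car y) :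
    (tensL M z).act f (incl M i w) = incl M i ((pow M z i).act f w) := veeAct_inj _ f i w

theorem cons_ract {x y y' z : O} (m : M.car x y) (f : V.mor y y') (t : (tensL M z).car y') :
    cons M (M.ract m f) t = cons M m ((tensL M z).act f t) := by
  induction t using tens_ind with
  | h i w =>
    rw [cons_incl, tens_act_incl, cons_incl]
    exact congrArg _ (Wedge.mk_move (N := pow M z i) m f w)

theorem cons_lact {x x' y z : O} (f : V.mor x' x) (m : M.car x y) (t : (tensL M z).car y) :
    cons M (M.lact f m) t = (tensL M z).act f (cons M m t) := by
  induction t using tens_ind with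
  | h i w => rw [cons_incl, cons_incl, tens_act_incl]; rfl

theorem d_incl {x z : O} (i : ℕ) (w : ((pow M z) i).car x) :
    d (of (incl M i w)) = map (incl M i) (d (of w)) :=
  Vee.d_inj (S := fun i => (pow M z i).car x) i w

theorem d_powCons {x y z : O} (m : M.car x y) (i : ℕ) (w : (pow M z i).car y) :
    d (of (powCons M m i w)) = map (fun m' => powCons M m' i w) (d (of m)) +
      map (powCons M m i) (d (of w)) := Wedge.d_mk m w

theorem d_cons {x y z : O} (m : M.car x y) (t : (tensL M z).car y) :
    d (of (cons M m t)) = map (fun m' => cons M m' t) (d (of m)) + map (cons M m) (d (of t)) := by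
  induction t using tens_ind with
  | h i w =>
    rw [cons_incl, d_incl, d_incl, d_powCons, map_add, map_map _ _ (zero_powCons M i w) (incl_zero M _),
      map_map _ _ (powCons_zero M m i) (incl_zero M _), map_map _ _ (incl_zero M _) (cons_zero M m)]
    simp only [cons_incl]

/-- `(m ∧ n) ↦ m ∧ φ(n)`. -/
def consHom {N : LMod V} {z : O} (φ : LHom N (tensL M z)) : LHom (wedgeL M N) (tensL M z) where
  toFun w := Wedge.lift 0 (fun _ m n => cons M m (φ.toFun n)) (fun y n => zero_cons M _)
    (fun y m => by rw [φ.map_zero, cons_zero]) (fun m f n => by rw [φ.map_act, cons_ract]) w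
  map_zero := rfl
  map_act f w := by
    induction w using Wedge.ind with
    | h0 => exact ((tensL M z).act_zero f).symm
    | h y m n => exact cons_lact M f m _

/-- Right multiplication by `t` on `M^i`: `(m_1 ∧ ⋯ ∧ m_i ∧ f) t = m_1 ∧ ⋯ ∧ m_i ∧ (f t)`. -/
def rmul {y z : O} (t : (tensL M z).car y) : ∀ i, LHom (pow M y i) (tensL M z)
  | 0 =>
    { toFun := fun f => (tensL M z).act f t
      map_zero := (tensL M z).zero_act t
      map_act := fun f g => ((tensL M z).act_act f g t).symm }
  | i + 1 => consHom M (rmul t i)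

/-- The composition of the tensor category: `M^i ∧ M^j → M^{i+j}`. -/
def tmul {x y z : O} (s : (tensL M y).car x) (t : (tensL M z).car y) : (tensL M z).car x :=
  Vee.lift 0 (fun i w => (rmul M t i).toFun w) s

theorem tmul_incl {x y z : O} (i : ℕ) (w : (pow M y i).car x) (t : (tensL M z).car y) :
    tmul M (incl M i w) t = (rmul M t i).toFun w :=
  Vee.lift_inj _ _ (fun i => (rmul M t i).map_zero) i w

theorem pow_succ_ind {x z : O} {i : ℕ} {P : (pow M z (i + 1)).car x → Prop} (h0 : P 0)
    (h : ∀ y (m : M.car x y) (w : (pow M z i).car y), P (powCons M m i w))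
    (w : (pow M z (i + 1)).car x) : P w := Wedge.ind h0 h w

theorem rmul_powCons {x y' y z : O} (t : (tensL M z).car y) (m : M.car x y') (i : ℕ)
    (w : (pow M y i).car y') :
    (rmul M t (i + 1)).toFun (powCons M m i w) = cons M m ((rmul M t i).toFun w) := rfl

theorem rmul_zero {x y z : O} (i : ℕ) (w : (pow M y i).car x) :
    (rmul M (0 : (tensL M z).car y) i).toFun w = 0 := by
  induction i generalizing x with
  | zero => exact (tensL M z).act_zero w
  | succ i ih =>
    induction w using pow_succ_ind with
    | h0 => exact (rmul M _ (i + 1)).map_zero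
    | h y m n => rw [rmul_powCons, ih, cons_zero]

theorem d_rmul {x y z : O} (t : (tensL M z).car y) (i : ℕ) (w : (pow M y i).car x) :
    d (of ((rmul M t i).toFun w)) = map (fun w' => (rmul M t i).toFun w') (d (of w)) +
      map (fun t' => (rmul M t' i).toFun w) (d (of t)) := by
  induction i generalizing x with
  | zero => exact (tensL M z).leibniz w t
  | succ i ih =>
    induction w using pow_succ_ind with
    | h0 =>
      rw [(rmul M t (i + 1)).map_zero, map_zero_fun (fun t' => (rmul M t' (i + 1)).toFun _)
        (fun t' => (rmul M t' (i + 1)).map_zero)]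
      simp
    | h y' m n =>
      rw [rmul_powCons, d_cons, ih, d_powCons, map_add, map_add,
        map_map _ _ (rmul M t i).map_zero (cons_zero M m),
        map_map _ _ (rmul_zero M i n) (cons_zero M m),
        map_map _ _ (zero_powCons M i n) (rmul M t (i + 1)).map_zero,
        map_map _ _ (powCons_zero M m i) (rmul M t (i + 1)).map_zero, ← add_assoc]
      rfl

theorem d_tmul {x y z : O} (s : (tensL M y).car x) (t : (tensL M z).car y) :
    d (of (tmul M s t)) = map (fun s' => tmul M s' t) (d (of s)) +
      map (fun t' => tmul M s t') (d (of t)) := by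
  induction s using tens_ind with
  | h i w =>
    rw [tmul_incl, d_rmul, d_incl, map_map _ _ (incl_zero M i) rfl]
    simp only [tmul_incl]

theorem tmul_zero {x y z : O} (s : (tensL M y).car x) : tmul M s (0 : (tensL M z).car y) = 0 := by
  induction s using tens_ind with
  | h i w => rw [tmul_incl, rmul_zero]

/-- The identity of `z`, as an element of `M^0(z, z)`. -/
def powOne (z : O) : (pow M z 0).car z := V.one z

/-- The tensor category `T_V(M)`, with `Hom(y, x) = ⋁_i M^i(x, y)`. -/
def tensCat : DPCat O where
  mor x y := (tensL M y).car x
  one x := incl M 0 (powOne M x)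
  comp s t := tmul M s t

end Tensor

section WedgeBimodule

variable [V.Lawful] {M N : Bimod V}

/-- The element `m ∧ n` of the tensor product of two bimodules. -/
def wmk {x y z : O} (m : M.car x y) (n : N.car y z) : (wedge M N).car x z :=
  Wedge.mk (N := N.left z) m n

theorem wmk_move {x y y' z : O} (m : M.car x y) (f : V.mor y y') (n : N.car y' z) :
    wmk (M.ract m f) n = wmk m (N.lact f n) := Wedge.mk_move (N := N.left z) m f n

theorem zero_wmk {x y z : O} (n : N.car y z) : wmk (0 : M.car x y) n = 0 :=
  Wedge.zero_mk (N := N.left z) n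

theorem wmk_zero {x y z : O} (m : M.car x y) : wmk m (0 : N.car y z) = 0 :=
  Wedge.mk_zero (N := N.left z) m

theorem wedge_ind {x z : O} {P : (wedge M N).car x z → Prop} (h0 : P 0)
    (h : ∀ (y : O) (m : M.car x y) (n : N.car y z), P (wmk m n)) (w : (wedge M N).car x z) : P w :=
  Wedge.ind (N := N.left z) h0 h w

theorem lact_wmk {x' x y z : O} (f : V.mor x' x) (m : M.car x y) (n : N.car y z) :
    (wedge M N).lact f (wmk m n) = wmk (M.lact f m) n := rfl

theorem wmk_ract {x y z z' : O} (m : M.car x y) (n : N.car y z) (f : V.mor z z') :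
    (wedge M N).ract (wmk m n) f = wmk m (N.ract n f) := rfl

theorem d_wmk {x y z : O} (m : M.car x y) (n : N.car y z) :
    d (of (wmk m n)) = map (fun m' => wmk m' n) (d (of m)) + map (fun n' => wmk m n') (d (of n)) :=
  Wedge.d_mk (N := N.left z) m n

theorem wedge_gr {x z : O} {g : ℤ} {w : (wedge M N).car x z} : w ∈ gr g ↔ w = 0 ∨
    ∃ (p q : ℤ) (y : O) (m : M.car x y) (n : N.car y z), p + q = g ∧ m ∈ gr p ∧ n ∈ gr q ∧ w = wmk m n :=
  Iff.rfl

/-- A balanced pointed function on pairs `(m, n)` induces a map on `M ∧_V N`. -/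
def wlift {X : Type} [Zero X] {x z : O} (f : ∀ y, M.car x y → N.car y z → X)
    (h0 : ∀ y n, f y 0 n = 0) (h1 : ∀ y m, f y m 0 = 0)
    (hm : ∀ {y y'} (m : M.car x y) (g : V.mor y y') (n : N.car y' z),
      f y' (M.ract m g) n = f y m (N.lact g n)) (w : (wedge M N).car x z) : X :=
  Wedge.lift (N := N.left z) 0 f h0 h1 hm w

theorem wlift_wmk {X : Type} [Zero X] {x z : O} (f : ∀ y, M.car x y → N.car y z → X)
    (h0 : ∀ y n, f y 0 n = 0) (h1 : ∀ y m, f y m 0 = 0)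
    (hm : ∀ {y y'} (m : M.car x y) (g : V.mor y y') (n : N.car y' z),
      f y' (M.ract m g) n = f y m (N.lact g n)) {y : O} (m : M.car x y) (n : N.car y z) :
    wlift f h0 h1 hm (wmk m n) = f y m n := rfl

end WedgeBimodule

/-! ## Quotients of differential graded pointed categories -/

/-- The relation that generates the smallest congruence (equivalence relation compatible with composition)
containing `R`. -/
inductive Cong (C : DPCat O) (R : ∀ x y, C.mor x y → C.mor x y → Prop) :
    ∀ x y, C.mor x y → C.mor x y → Prop
  | rel {x y} {a b : C.mor x y} : R x y a b → Cong C R x y a b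
  | left {x y z} (f : C.mor x y) {a b : C.mor y z} : Cong C R y z a b →
    Cong C R x z (C.comp f a) (C.comp f b)
  | right {x y z} {a b : C.mor x y} (g : C.mor y z) : Cong C R x y a b →
    Cong C R x z (C.comp a g) (C.comp b g)

section Quotient

variable (C : DPCat O) (R : ∀ x y, C.mor x y → C.mor x y → Prop)

/-- The set of maps from `y` to `x` in the quotient of `C` by the congruence generated by `R`. -/
def QMor (x y : O) : Type := Quot (Cong C R x y)

instance (x y : O) : Zero (QMor C R x y) := ⟨Quot.mk _ 0⟩

/-- The quotient map. -/
def qmk {x y : O} (a : C.mor x y) : QMor C R x y := Quot.mk _ a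

/-- The composition in the quotient. -/
def qcomp {x y z : O} : QMor C R x y → QMor C R y z → QMor C R x z :=
  Quot.map₂ C.comp (fun f _ _ r => .left f r) (fun _ _ g r => .right g r)

theorem qmk_comp {x y z : O} (f : C.mor x y) (g : C.mor y z) :
    qmk C R (C.comp f g) = qcomp C R (qmk C R f) (qmk C R g) := rfl

/-- The differential of `C` is compatible with the congruence generated by `R` if it is compatible with `R`. -/
theorem cong_d (hz : ∀ {x y z} (g : C.mor y z), C.comp (0 : C.mor x y) g = 0)
    (hz' : ∀ {x y z} (f : C.mor x y), C.comp f (0 : C.mor y z) = 0)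
    (hl : ∀ {x y z} (f : C.mor x y) (g : C.mor y z), d (of (C.comp f g)) =
      map (fun f' => C.comp f' g) (d (of f)) + map (fun g' => C.comp f g') (d (of g)))
    (hR : ∀ {x y} (a b : C.mor x y), R x y a b →
      map (qmk C R) (d (of a)) = map (qmk C R) (d (of b)))
    {x y : O} {a b : C.mor x y} (h : Cong C R x y a b) :
    map (qmk C R) (d (of a)) = map (qmk C R) (d (of b)) := by
  have key : ∀ {x y z : O} (f : C.mor x y) (g : C.mor y z), map (qmk C R) (d (of (C.comp f g))) =
      map (fun f' => qcomp C R f' (qmk C R g)) (map (qmk C R) (d (of f))) +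
      map (fun g' => qcomp C R (qmk C R f) g') (map (qmk C R) (d (of g))) := by
    intro x y z f g
    rw [hl, map_add, map_map _ _ (hz g) rfl, map_map _ _ (hz' f) rfl,
      map_map (qmk C R) _ rfl (congrArg (qmk C R) (hz g)),
      map_map (qmk C R) _ rfl (congrArg (qmk C R) (hz' f))]
    rfl
  induction h with
  | rel h => exact hR _ _ h
  | left f h ih =>
    have e := Quot.sound h
    rw [key, key, ih]
    unfold qmk
    rw [e]
  | right g h ih =>
    have e := Quot.sound h
    rw [key, key, ih]
    unfold qmk
    rw [e]

/-- The quotient of `C` by the congruence generated by `R`, when the differential is compatible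
with that congruence. -/
def quotCat (h : ∀ {x y} {a b : C.mor x y}, Cong C R x y a b →
    map (qmk C R) (d (of a)) = map (qmk C R) (d (of b))) : DPCat O where
  mor := QMor C R
  dgp x y :=
    { gr := fun g => qmk C R '' gr (S := C.mor x y) g
      d := F2.lift (Quot.lift (fun a => map (qmk C R) (d (of a))) fun _ _ r => h r) }
  one x := qmk C R (C.one x)
  comp := qcomp C R

end Quotient

/-! ## The diagonal category -/

/-- Two bimodules `F`, `E` with endomorphisms `τ₁` of `F²` and `τ₂` of `E²` of degree `-1` such that
`d(τ₁) = 1` and `d(τ₂) = 1` (where `d(τ) = d τ + τ d`), and a closed morphism of degree `0` of bimodules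
`λ : F E → E F`. This is the part of the structure (of two bimodule `2`-representations with a gluing morphism) that the
construction of the diagonal category uses; the braid relations for `τ₁`, `τ₂` and their compatibility with `λ` play no role in
the construction. -/
structure GlueDatum (V : DPCat O) [V.Lawful] where
  F : Bimod V
  E : Bimod V
  tau₁ : BHom (wedge F F) (wedge F F)
  tau₁_gr : ∀ {x y} {g : ℤ} {p : (wedge F F).car x y}, p ∈ gr g →
    tau₁.toFun p ∈ gr (S := (wedge F F).car x y) (g - 1)
  d_tau₁ : ∀ {x y} (p : (wedge F F).car x y), d (of (tau₁.toFun p)) = of p + map tau₁.toFun (d (of p))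
  tau₂ : BHom (wedge E E) (wedge E E)
  tau₂_gr : ∀ {x y} {g : ℤ} {p : (wedge E E).car x y}, p ∈ gr g →
    tau₂.toFun p ∈ gr (S := (wedge E E).car x y) (g - 1)
  d_tau₂ : ∀ {x y} (p : (wedge E E).car x y), d (of (tau₂.toFun p)) = of p + map tau₂.toFun (d (of p))
  lam : BHom (wedge F E) (wedge E F)
  lam_gr : ∀ {x y} {g : ℤ} {p : (wedge F E).car x y}, p ∈ gr g →
    lam.toFun p ∈ gr (S := (wedge E F).car x y) g
  d_lam : ∀ {x y} (p : (wedge F E).car x y), d (of (lam.toFun p)) = map lam.toFun (d (of p))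

theorem d_one [hV : V.Lawful] (x : O) : d (of (V.one x)) = 0 := by
  have h := hV.leibniz (V.one x) (V.one x)
  rw [hV.one_comp] at h
  simp only [hV.one_comp, hV.comp_one, map_id] at h
  simpa using h

namespace GlueDatum

variable [hV : V.Lawful] (G : GlueDatum V)

/-- The element `m ∧ n` of the tensor square `M² = M ∧ (M ∧ Hom(z, -))`. -/
def sq (M : Bimod V) {x y z : O} (m : M.car x y) (n : M.car y z) : (pow M z 2).car x :=
  powCons M m 1 (powCons M n 0 (powOne M z))

theorem zero_sq (M : Bimod V) {x y z : O} (n : M.car y z) : sq M (0 : M.car x y) n = 0 :=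
  zero_powCons _ _ _

theorem sq_zero (M : Bimod V) {x y z : O} (m : M.car x y) : sq M m (0 : M.car y z) = 0 :=
  (congrArg _ (zero_powCons _ _ _)).trans (powCons_zero _ _ _)

theorem sq_move (M : Bimod V) {x y y' z : O} (m : M.car x y) (f : V.mor y y') (n : M.car y' z) :
    sq M (M.ract m f) n = sq M m (M.lact f n) :=
  Wedge.mk_move (N := pow M z 1) m f (powCons M n 0 (powOne M z))

theorem d_sq (M : Bimod V) {x y z : O} (m : M.car x y) (n : M.car y z) :
    d (of (sq M m n)) = map (fun m' => sq M m' n) (d (of m)) + map (fun n' => sq M m n') (d (of n)) := by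
  have e1 : d (of (powOne M z)) = 0 := d_one (V := V) z
  rw [sq, d_powCons, d_powCons, e1, map_zero, add_zero,
    map_map (fun n' => powCons M n' 0 (powOne M z)) _ (zero_powCons M _ _) (powCons_zero M _ _)]
  rfl

/-- The canonical isomorphism `F (E F) E = (F E)²`: the element `(a ∧ e) ∧ (g ∧ v)` attached to `a`, `e ∧ g`
and `v`. -/
def regroup {x y y' z : O} (a : G.F.car x y) (w : (wedge G.E G.F).car y y') (v : G.E.car y' z) :
    (pow (wedge G.F G.E) z 2).car x :=
  wlift (fun _ e g => sq (wedge G.F G.E) (wmk a e) (wmk g v))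
    (fun y n => by rw [wmk_zero, zero_sq]) (fun y m => by rw [zero_wmk, sq_zero])
    (fun m f n => by rw [← wmk_ract, sq_move, lact_wmk]) w

theorem regroup_wmk {x y t y' z : O} (a : G.F.car x y) (e : G.E.car y t) (g : G.F.car t y')
    (v : G.E.car y' z) :
    G.regroup a (wmk e g) v = sq (wedge G.F G.E) (wmk a e) (wmk g v) := rfl

theorem regroup_zero {x y y' z : O} (a : G.F.car x y) (v : G.E.car y' z) :
    G.regroup a (0 : (wedge G.E G.F).car y y') v = 0 := rfl

theorem zero_regroup {x y y' z : O} (w : (wedge G.E G.F).car y y') (v : G.E.car y' z) :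
    G.regroup (0 : G.F.car x y) w v = 0 := by
  induction w using wedge_ind with
  | h0 => rfl
  | h t e g => rw [regroup_wmk, zero_wmk, zero_sq]

theorem regroup_zero' {x y y' z : O} (a : G.F.car x y) (w : (wedge G.E G.F).car y y') :
    G.regroup a w (0 : G.E.car y' z) = 0 := by
  induction w using wedge_ind with
  | h0 => rfl
  | h t e g => rw [regroup_wmk, wmk_zero, sq_zero]

theorem regroup_lact {x y₀ y y' z : O} (a : G.F.car x y₀) (f : V.mor y₀ y) (w : (wedge G.E G.F).car y y')
    (v : G.E.car y' z) : G.regroup (G.F.ract a f) w v = G.regroup a ((wedge G.E G.F).lact f w) v := by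
  induction w using wedge_ind with
  | h0 => rw [(wedge G.E G.F).lact_zero, regroup_zero, regroup_zero]
  | h t e g => rw [lact_wmk, regroup_wmk, regroup_wmk, wmk_move]

theorem regroup_ract {x y y' y₁ z : O} (a : G.F.car x y) (w : (wedge G.E G.F).car y y') (f : V.mor y' y₁)
    (v : G.E.car y₁ z) : G.regroup a ((wedge G.E G.F).ract w f) v = G.regroup a w (G.E.lact f v) := by
  induction w using wedge_ind with
  | h0 => rw [(wedge G.E G.F).zero_ract, regroup_zero, regroup_zero]
  | h t e g => rw [wmk_ract, regroup_wmk, regroup_wmk, wmk_move]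

theorem d_regroup {x y y' z : O} (a : G.F.car x y) (w : (wedge G.E G.F).car y y') (v : G.E.car y' z) :
    d (of (G.regroup a w v)) = map (fun a' => G.regroup a' w v) (d (of a)) +
      map (fun w' => G.regroup a w' v) (d (of w)) + map (fun v' => G.regroup a w v') (d (of v)) := by
  induction w using wedge_ind with
  | h0 => simp [regroup_zero, map_zero_fun]
  | h t e g =>
    rw [regroup_wmk, d_sq, d_wmk, d_wmk, d_wmk, map_add, map_add, map_add,
      map_map (fun a' => wmk a' e) (fun m => sq (wedge G.F G.E) m _) (zero_wmk e) (zero_sq _ _),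
      map_map (fun e' => wmk a e') (fun m => sq (wedge G.F G.E) m _) (wmk_zero a) (zero_sq _ _),
      map_map (fun g' => wmk g' v) (fun m => sq (wedge G.F G.E) _ m) (zero_wmk v) (sq_zero _ _),
      map_map (fun v' => wmk g v') (fun m => sq (wedge G.F G.E) _ m) (wmk_zero g) (sq_zero _ _),
      map_map (fun e' => wmk e' g) (fun w => G.regroup a w v) (zero_wmk g) (G.regroup_zero a v),
      map_map (fun g' => wmk e g') (fun w => G.regroup a w v) (wmk_zero e) (G.regroup_zero a v)]
    simp only [regroup_wmk]
    abel

/-- The map `u ∧ v ↦ a ∧ λ(b ∧ u) ∧ v`. -/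
def psiAux {x y₀ y z : O} (a : G.F.car x y₀) (b : G.F.car y₀ y) (w : (wedge G.E G.E).car y z) :
    (pow (wedge G.F G.E) z 2).car x :=
  wlift (fun _ u v => G.regroup a (G.lam.toFun (wmk b u)) v)
    (fun _ v => by rw [wmk_zero, G.lam.map_zero, regroup_zero]) (fun _ u => G.regroup_zero' _ _)
    (fun u f v => by rw [← wmk_ract, G.lam.map_ract, regroup_ract]) w

theorem psiAux_wmk {x y₀ y t z : O} (a : G.F.car x y₀) (b : G.F.car y₀ y) (u : G.E.car y t)
    (v : G.E.car t z) : G.psiAux a b (wmk u v) = G.regroup a (G.lam.toFun (wmk b u)) v := rfl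

theorem psiAux_zero {x y₀ y z : O} (a : G.F.car x y₀) (b : G.F.car y₀ y) :
    G.psiAux a b (0 : (wedge G.E G.E).car y z) = 0 := rfl

/-- The map `F λ E : F² E² → (F E)²`, `(a ∧ b, u ∧ v) ↦ a ∧ λ(b ∧ u) ∧ v`. -/
def psi {x y z : O} (p : (wedge G.F G.F).car x y) (w : (wedge G.E G.E).car y z) :
    (pow (wedge G.F G.E) z 2).car x :=
  wlift (fun _ a b => G.psiAux a b w)
    (fun _ b => by
      induction w using wedge_ind with
      | h0 => rfl
      | h t u v => rw [psiAux_wmk, zero_regroup])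
    (fun _ a => by
      induction w using wedge_ind with
      | h0 => rfl
      | h t u v => rw [psiAux_wmk, zero_wmk, G.lam.map_zero, regroup_zero])
    (fun a f b => by
      induction w using wedge_ind with
      | h0 => rfl
      | h t u v => rw [psiAux_wmk, psiAux_wmk, regroup_lact, ← G.lam.map_lact, lact_wmk]) p

theorem psi_wmk {x y₀ y t z : O} (a : G.F.car x y₀) (b : G.F.car y₀ y) (u : G.E.car y t)
    (v : G.E.car t z) : G.psi (wmk a b) (wmk u v) = G.regroup a (G.lam.toFun (wmk b u)) v := rfl

theorem zero_psi {x y z : O} (w : (wedge G.E G.E).car y z) :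
    G.psi (0 : (wedge G.F G.F).car x y) w = 0 := rfl

theorem psi_zero {x y z : O} (p : (wedge G.F G.F).car x y) :
    G.psi p (0 : (wedge G.E G.E).car y z) = 0 := by
  induction p using wedge_ind with
  | h0 => rfl
  | h t a b => rfl

theorem d_psi {x y z : O} (p : (wedge G.F G.F).car x y) (w : (wedge G.E G.E).car y z) :
    d (of (G.psi p w)) = map (fun p' => G.psi p' w) (d (of p)) + map (fun w' => G.psi p w') (d (of w)) := by
  induction p using wedge_ind with
  | h0 => simp [zero_psi, map_zero_fun]
  | h y₀ a b =>
    induction w using wedge_ind with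
    | h0 => simp [psi_zero, map_zero_fun]
    | h t u v =>
      have e : G.regroup a (G.lam.toFun (0 : (wedge G.F G.E).car y₀ t)) v = 0 := by
        rw [G.lam.map_zero, regroup_zero]
      rw [psi_wmk, d_regroup, G.d_lam, d_wmk, d_wmk, d_wmk, map_add, map_add, map_add, map_add,
        map_map (fun a' => wmk a' b) (fun p => G.psi p _) (zero_wmk b) (G.zero_psi _),
        map_map (fun b' => wmk a b') (fun p => G.psi p _) (wmk_zero a) (G.zero_psi _),
        map_map (fun u' => wmk u' v) (fun p => G.psi _ p) (zero_wmk v) (G.psi_zero _),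
        map_map (fun v' => wmk u v') (fun p => G.psi _ p) (wmk_zero u) (G.psi_zero _),
        map_map G.lam.toFun (fun w => G.regroup a w v) G.lam.map_zero (G.regroup_zero a v),
        map_map G.lam.toFun (fun w => G.regroup a w v) G.lam.map_zero (G.regroup_zero a v),
        map_map (fun b' => wmk b' u) _ (zero_wmk u) e, map_map (fun u' => wmk b u') _ (wmk_zero b) e]
      simp only [psi_wmk]
      abel

/-- The relations `(F λ E)(τ₁ E²)(f) ∼ (F λ E)(F² τ₂)(f)` for `f = p ∧ w ∈ F² E²`, between maps of the tensor
category of `F E`. -/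
inductive Rel : ∀ x y, (tensCat (wedge G.F G.E)).mor x y → (tensCat (wedge G.F G.E)).mor x y → Prop
  | intro {x y z : O} (p : (wedge G.F G.F).car x y) (w : (wedge G.E G.E).car y z) :
    Rel x z (incl (wedge G.F G.E) 2 (G.psi (G.tau₁.toFun p) w))
      (incl (wedge G.F G.E) 2 (G.psi p (G.tau₂.toFun w)))

theorem rel_d {x z : O} {a b : (tensCat (wedge G.F G.E)).mor x z} (h : G.Rel x z a b) :
    map (qmk _ G.Rel) (d (of a)) = map (qmk _ G.Rel) (d (of b)) := by
  obtain ⟨p, w⟩ := h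
  rename_i y
  let ρ : (pow (wedge G.F G.E) z 2).car x → QMor (tensCat (wedge G.F G.E)) G.Rel x z :=
    fun t => qmk _ G.Rel (incl (wedge G.F G.E) 2 t)
  have ρ0 : ρ 0 = 0 := congrArg (qmk _ G.Rel) (incl_zero _ _)
  have hρ : ∀ (p : (wedge G.F G.F).car x y) (w : (wedge G.E G.E).car y z),
      ρ (G.psi (G.tau₁.toFun p) w) = ρ (G.psi p (G.tau₂.toFun w)) := fun p w =>
    Quot.sound (Cong.rel (Rel.intro p w))
  have e : ∀ t : (pow (wedge G.F G.E) z 2).car x,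
      map (qmk _ G.Rel) (d (of (incl (wedge G.F G.E) 2 t : (tensCat (wedge G.F G.E)).mor x z))) =
        map ρ (d (of t)) := fun t => by
    rw [← map_map (incl (wedge G.F G.E) 2) (qmk _ G.Rel) (incl_zero _ _) rfl, ← d_incl]; rfl
  have e0 : ρ (G.psi p (0 : (wedge G.E G.E).car y z)) = 0 := by rw [psi_zero, ρ0]
  have e0' : ρ (G.psi (0 : (wedge G.F G.F).car x y) w) = 0 := ρ0
  rw [e, e, d_psi, d_psi, G.d_tau₁, G.d_tau₂]
  simp only [map_add]
  rw [map_map (fun p => G.psi p _) ρ (G.zero_psi _) ρ0,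
    map_map (fun p => G.psi p _) ρ (G.zero_psi _) ρ0,
    map_map (fun p => G.psi p _) ρ (G.zero_psi _) ρ0,
    map_map (fun w => G.psi _ w) ρ (G.psi_zero _) ρ0,
    map_map (fun w => G.psi _ w) ρ (G.psi_zero _) ρ0,
    map_map (fun w => G.psi _ w) ρ (G.psi_zero _) ρ0,
    map_map G.tau₁.toFun _ G.tau₁.map_zero e0', map_map G.tau₂.toFun _ G.tau₂.map_zero e0,
    map_of (fun p => ρ (G.psi p w)) e0', map_of (fun w => ρ (G.psi p w)) e0]
  simp only [hρ]
  abel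

/-- The diagonal category `Δ'_λ(V)`: the quotient of the tensor category of `F E` by the congruence
generated by `(F λ E)(τ₁ E²)(f) ∼ (F λ E)(F² τ₂)(f)`, for `f ∈ F² E²`. -/
def diagonal : DPCat O :=
  quotCat (tensCat (wedge G.F G.E)) G.Rel
    (cong_d _ _ (fun _ => rfl) (tmul_zero _) (d_tmul _) (fun _ _ h => G.rel_d h))

end GlueDatum

/-! ## Nil Hecke monoids of symmetric groups -/

/-- The indices of the generators `T_1, …, T_{n-1}`, shifted by `1`: the index `i` stands for `T_{i+1}`. -/
abbrev Idx (n : ℕ) : Type := {i : ℕ // i + 1 < n}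

/-- The free pointed monoid on generators `T_1, …, T_{n-1}`. -/
abbrev Words (n : ℕ) : Type := WithZero (FreeMonoid (Idx n))

/-- A generator of the free pointed monoid. -/
def gen {n : ℕ} (i : Idx n) : Words n := ((FreeMonoid.of i : FreeMonoid (Idx n)) : Words n)

/-- The relations of the nil Hecke monoid. -/
inductive NHRel (n : ℕ) : Words n → Words n → Prop
  | nil (i : Idx n) : NHRel n (gen i * gen i) 0
  | comm (i j : Idx n) (h : i.1 + 1 < j.1) : NHRel n (gen i * gen j) (gen j * gen i)
  | braid (i j : Idx n) (h : i.1 + 1 = j.1) :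
    NHRel n (gen i * gen j * gen i) (gen j * gen i * gen j)

/-- The nil Hecke monoid `H_n^•` of the symmetric group `𝔖_n`, a pointed monoid. -/
def NH (n : ℕ) : Type := (conGen (NHRel n)).Quotient

namespace NH

variable {n : ℕ}

instance : Monoid (NH n) := inferInstanceAs (Monoid (conGen (NHRel n)).Quotient)

/-- The quotient map from the free pointed monoid. -/
def cl : Words n →* NH n := (conGen (NHRel n)).mk'

theorem cl_surj (a : NH n) : ∃ w, cl w = a := Con.mk'_surjective a

instance : MonoidWithZero (NH n) where
  zero := cl 0
  zero_mul a := by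
    obtain ⟨w, rfl⟩ := cl_surj a
    exact (map_mul cl 0 w).symm.trans (congrArg cl (zero_mul w))
  mul_zero a := by
    obtain ⟨w, rfl⟩ := cl_surj a
    exact (map_mul cl w 0).symm.trans (congrArg cl (mul_zero w))

@[simp] theorem cl_zero : cl (0 : Words n) = 0 := rfl

theorem cl_rel {u v : Words n} (h : NHRel n u v) : cl u = cl v :=
  (Con.eq _).2 (ConGen.Rel.of _ _ h)

/-- The class of a word. -/
def word (w : FreeMonoid (Idx n)) : NH n := cl (w : Words n)

@[simp] theorem word_one : word (1 : FreeMonoid (Idx n)) = 1 := rfl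

theorem word_mul (u v : FreeMonoid (Idx n)) : word (u * v) = word u * word v := by
  simp [word]

/-- The element `T_{i+1}` of `H_n^•` (which is `0` if `i + 1 ≥ n`). -/
def T (n i : ℕ) : NH n := if h : i + 1 < n then word (FreeMonoid.of ⟨i, h⟩) else 0

theorem T_idx (i : Idx n) : T n i.1 = word (FreeMonoid.of i) := by simp [T, i.2]

theorem T_out {i : ℕ} (h : ¬ i + 1 < n) : T n i = 0 := by simp [T, h]

/-- Every element is zero or a product of generators. -/
theorem ind {P : NH n → Prop} (h0 : P 0) (h1 : P 1) (h : ∀ (i : Idx n) a, P a → P (T n i * a))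
    (a : NH n) : P a := by
  obtain ⟨w, rfl⟩ := cl_surj a
  induction w using WithZero.recZeroCoe with
  | zero => exact h0
  | coe w =>
    change P (word w)
    induction w using FreeMonoid.inductionOn' with
    | one => exact h1
    | of_mul i w ih => rw [word_mul, ← T_idx]; exact h i _ ih

theorem T_sq (i : ℕ) : T n i * T n i = 0 := by
  by_cases h : i + 1 < n
  · have := cl_rel (NHRel.nil (n := n) ⟨i, h⟩)
    rw [map_mul] at this
    simpa [T, h, word, gen] using this
  · simp [T_out h]

theorem T_comm {i j : ℕ} (hij : i + 1 < j) : T n i * T n j = T n j * T n i := by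
  by_cases h : j + 1 < n
  · have hi : i + 1 < n := by omega
    have := cl_rel (NHRel.comm (n := n) ⟨i, hi⟩ ⟨j, h⟩ hij)
    rw [map_mul, map_mul] at this
    simpa [T, h, hi, word, gen] using this
  · simp [T_out h]

theorem T_braid (i : ℕ) : T n i * T n (i + 1) * T n i = T n (i + 1) * T n i * T n (i + 1) := by
  by_cases h : i + 1 + 1 < n
  · have hi : i + 1 < n := by omega
    have := cl_rel (NHRel.braid (n := n) ⟨i, hi⟩ ⟨i + 1, h⟩ rfl)
    simp only [map_mul] at this
    simpa [T, h, hi, word, gen] using this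
  · simp [T_out h]

/-- The morphism of pointed monoids determined by the images of the generators. -/
def lift {A : Type} [MonoidWithZero A] (f : ℕ → A) (h1 : ∀ i, f i * f i = 0)
    (h2 : ∀ i j, i + 1 < j → f i * f j = f j * f i)
    (h3 : ∀ i, f i * f (i + 1) * f i = f (i + 1) * f i * f (i + 1)) : NH n →* A :=
  (conGen (NHRel n)).lift
    (WithZero.lift' (FreeMonoid.lift fun i : Idx n => f i.1) : Words n →*₀ A).toMonoidHom (by
      have e : ∀ i : Idx n, (WithZero.lift' (FreeMonoid.lift fun i : Idx n => f i.1) : Words n →*₀ A)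
        (gen i) = f i.1 := fun i => by simp [gen]
      refine Con.conGen_le.2 ?_
      rintro _ _ (i | ⟨i, j, h⟩ | ⟨i, j, h⟩)
      · simp [Con.ker_rel, e, h1]
      · simp [Con.ker_rel, e, h2 _ _ h]
      · simp [Con.ker_rel, e, ← h, h3])

section
variable {A : Type} [MonoidWithZero A] {f : ℕ → A} {h1 : ∀ i, f i * f i = 0}
    {h2 : ∀ i j, i + 1 < j → f i * f j = f j * f i}
    {h3 : ∀ i, f i * f (i + 1) * f i = f (i + 1) * f i * f (i + 1)}

theorem lift_T (i : Idx n) : lift f h1 h2 h3 (T n i.1) = f i.1 := by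
  rw [T_idx]
  exact (WithZero.lift'_coe _ _).trans (FreeMonoid.lift_eval_of _ _)

theorem lift_zero : lift (n := n) f h1 h2 h3 0 = 0 := by
  change (WithZero.lift' (FreeMonoid.lift fun i : Idx n => f i.1) : Words n →*₀ A) 0 = _
  simp
end

/-- `d(T_{i_1} ⋯ T_{i_r}) = ∑_k T_{i_1} ⋯ T_{i_{k-1}} T_{i_{k+1}} ⋯ T_{i_r}`, defined on words. -/
def dList : List (Idx n) → F2 (NH n)
  | [] => 0
  | i :: w => of (word (FreeMonoid.ofList w)) + map (fun a => T n i.1 * a) (dList w)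

/-- The differential on the free pointed monoid. -/
def dWord : Words n → F2 (NH n)
  | none => 0
  | some w => dList w.toList

@[simp] theorem dWord_zero : dWord (0 : Words n) = 0 := rfl

theorem dWord_one : dWord (1 : Words n) = 0 := rfl

theorem dWord_gen (i : Idx n) (w : Words n) :
    dWord (gen i * w) = of (cl w) + map (fun a => T n i.1 * a) (dWord w) := by
  induction w using WithZero.recZeroCoe with
  | zero => simp
  | coe w => rfl

theorem cl_gen (i : Idx n) : cl (gen i) = T n i.1 := (T_idx i).symm

theorem words_ind {P : Words n → Prop} (h0 : P 0) (h1 : P 1) (h : ∀ (i : Idx n) a, P a → P (gen i * a))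
    (w : Words n) : P w := by
  induction w using WithZero.recZeroCoe with
  | zero => exact h0
  | coe w =>
    induction w using FreeMonoid.inductionOn' with
    | one => exact h1
    | of_mul i w ih => rw [WithZero.coe_mul]; exact h i _ ih

theorem dWord_mul (u v : Words n) :
    dWord (u * v) = map (fun a => a * cl v) (dWord u) + map (fun b => cl u * b) (dWord v) := by
  induction u using words_ind with
  | h0 => simp [map_zero_fun]
  | h1 => simp [dWord_one, map_id]
  | h i u ih =>
    rw [mul_assoc, dWord_gen, ih, dWord_gen, map_add, map_add, map_of (fun a => a * cl v) (zero_mul _),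
      map_map (fun a => a * cl v) _ (zero_mul _) (mul_zero _), map_map _ _ (mul_zero _) (mul_zero _),
      map_map _ (fun a => a * cl v) (mul_zero _) (zero_mul _), map_mul, map_mul, cl_gen, ← add_assoc]
    simp only [mul_assoc]

/-- The congruence `cl u = cl v` and `d u = d v`. -/
def dCon (n : ℕ) : Con (Words n) where
  r u v := cl u = cl v ∧ dWord u = dWord v
  iseqv := ⟨fun _ => ⟨rfl, rfl⟩, fun h => ⟨h.1.symm, h.2.symm⟩,
    fun h h' => ⟨h.1.trans h'.1, h.2.trans h'.2⟩⟩
  mul' := fun {a b c e} h h' => ⟨by rw [map_mul, map_mul, h.1, h'.1], by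
    rw [dWord_mul, dWord_mul, h.1, h.2, h'.1, h'.2]⟩

theorem dWord_gen' (i : Idx n) : dWord (gen i) = of 1 := by
  have := dWord_gen i 1
  rw [mul_one, dWord_one, map_zero, add_zero] at this
  rw [this, map_one]

theorem dWord_congr {u v : Words n} (h : cl u = cl v) : dWord u = dWord v := by
  have hle : conGen (NHRel n) ≤ dCon n := by
    refine Con.conGen_le.2 ?_
    intro u v huv
    refine ⟨cl_rel huv, ?_⟩
    rcases huv with i | ⟨i, j, h⟩ | ⟨i, j, h⟩
    · rw [dWord_gen, dWord_gen', map_of _ (mul_zero _), cl_gen, mul_one]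
      exact F2.add_self _
    · rw [dWord_gen, dWord_gen', dWord_gen, dWord_gen', map_of _ (mul_zero _), map_of _ (mul_zero _),
        cl_gen, cl_gen, mul_one, mul_one, add_comm]
    · have e : ∀ i j : Idx n, dWord (gen i * gen j * gen i) =
          of (T n j * T n i) + of (T n i * T n j) := fun i j => by
        rw [mul_assoc, dWord_gen, dWord_gen, dWord_gen', map_of _ (mul_zero _), map_add,
          map_of _ (mul_zero _), map_of _ (mul_zero _), map_mul, cl_gen, cl_gen, mul_one, T_sq,
          of_zero, zero_add]
      rw [e, e, add_comm]
  exact (hle ((Con.eq _).1 h)).2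

instance : DGP (NH n) where
  gr g := {a | a = 0 ∨ ∃ w : FreeMonoid (Idx n), a = word w ∧ -(w.length : ℤ) = g}
  d := F2.lift (Quot.lift dWord fun _ _ h => dWord_congr (Quot.sound h))

theorem d_cl (w : Words n) : d (of (cl w)) = dWord w := F2.lift_of _ rfl _

theorem leibniz (a b : NH n) :
    d (of (a * b)) = map (fun a' => a' * b) (d (of a)) + map (fun b' => a * b') (d (of b)) := by
  obtain ⟨u, rfl⟩ := cl_surj a
  obtain ⟨v, rfl⟩ := cl_surj b
  rw [← map_mul, d_cl, d_cl, d_cl, dWord_mul]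

theorem d_T (i : ℕ) (h : i + 1 < n) : d (of (T n i)) = of 1 := by
  rw [← cl_gen ⟨i, h⟩, d_cl, dWord_gen']

theorem d_one : d (of (1 : NH n)) = 0 := (d_cl 1).trans dWord_one

theorem zero_gr (g : ℤ) : (0 : NH n) ∈ gr g := Or.inl rfl

theorem one_gr : (1 : NH n) ∈ gr 0 := Or.inr ⟨1, rfl, rfl⟩

theorem T_gr (i : ℕ) : T n i ∈ gr (-1) := by
  by_cases h : i + 1 < n
  · exact Or.inr ⟨FreeMonoid.of ⟨i, h⟩, by simp [T, h], rfl⟩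
  · exact Or.inl (T_out h)

theorem mul_gr {p q : ℤ} {a b : NH n} (ha : a ∈ gr p) (hb : b ∈ gr q) : a * b ∈ gr (p + q) := by
  rcases ha with rfl | ⟨u, rfl, rfl⟩
  · exact Or.inl (zero_mul _)
  rcases hb with rfl | ⟨v, rfl, rfl⟩
  · exact Or.inl (mul_zero _)
  exact Or.inr ⟨u * v, (word_mul u v).symm, by simp [FreeMonoid.length_mul]; ring⟩

/-- The length of a word. -/
def len : Words n → ℤ
  | none => 0
  | some w => w.length

/-- The congruence `cl u = cl v`, and `u` and `v` have the same length unless `cl u = 0`. -/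
def lenCon (n : ℕ) : Con (Words n) where
  r u v := cl u = cl v ∧ (cl u ≠ 0 → len u = len v)
  iseqv := ⟨fun _ => ⟨rfl, fun _ => rfl⟩, fun h => ⟨h.1.symm, fun h' => (h.2 (h.1 ▸ h')).symm⟩,
    fun h h' => ⟨h.1.trans h'.1, fun h0 => (h.2 h0).trans (h'.2 (h.1 ▸ h0))⟩⟩
  mul' := fun {a b c e} h h' => by
    refine ⟨by rw [map_mul, map_mul, h.1, h'.1], fun h0 => ?_⟩
    rw [map_mul] at h0
    have e1 := h.2 (left_ne_zero_of_mul h0)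
    have e2 := h'.2 (right_ne_zero_of_mul h0)
    have key : ∀ a b : Words n, cl a ≠ 0 → cl b ≠ 0 → len (a * b) = len a + len b := by
      intro a b ha hb
      induction a using WithZero.recZeroCoe with
      | zero => exact absurd cl_zero ha
      | coe a =>
        induction b using WithZero.recZeroCoe with
        | zero => exact absurd cl_zero hb
        | coe b =>
          change ((a * b).length : ℤ) = a.length + b.length
          simp [FreeMonoid.length_mul]
    rw [key _ _ (left_ne_zero_of_mul h0) (right_ne_zero_of_mul h0), e1, e2, key]
    · rw [← h.1]; exact left_ne_zero_of_mul h0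
    · rw [← h'.1]; exact right_ne_zero_of_mul h0

theorem len_congr {u v : Words n} (h : cl u = cl v) (h0 : cl u ≠ 0) : len u = len v := by
  have hle : conGen (NHRel n) ≤ lenCon n := by
    refine Con.conGen_le.2 ?_
    intro u v huv
    refine ⟨cl_rel huv, fun h0 => ?_⟩
    rcases huv with i | ⟨i, j, h⟩ | ⟨i, j, h⟩
    · exact absurd (cl_rel (.nil i)) h0
    · rfl
    · rfl
  exact (hle ((Con.eq _).1 h)).2 h0

theorem d_T_mul (i : Idx n) (a : NH n) :
    d (of (T n i.1 * a)) = of a + map (fun b => T n i.1 * b) (d (of a)) := by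
  rw [leibniz, d_T _ i.2, map_of (fun b => b * a) (zero_mul _), one_mul]

theorem d_map_T (i : Idx n) (x : F2 (NH n)) :
    d (map (fun b => T n i.1 * b) x) = x + map (fun b => T n i.1 * b) (d x) := by
  refine hom_ext_apply (φ := (d (S := NH n)).comp (map fun b => T n i.1 * b))
    (ψ := LinearMap.id + (map fun b => T n i.1 * b).comp d) (fun a => ?_) x
  simp only [LinearMap.comp_apply, LinearMap.add_apply, LinearMap.id_apply]
  rw [map_of _ (mul_zero _), d_T_mul]

theorem d_sq (a : NH n) : d (d (of a)) = 0 := by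
  induction a using ind with
  | h0 => simp
  | h1 => rw [d_one, map_zero]
  | h i a ih => rw [d_T_mul, map_add, d_map_T, ih, map_zero, add_zero, F2.add_self]

theorem d_gr_word (w : List (Idx n)) : d (of (word (FreeMonoid.ofList w))) ∈
    on (gr (S := NH n) (-(w.length : ℤ) + 1)) := by
  induction w with
  | nil => exact (d_one (n := n)).symm ▸ Submodule.zero_mem _
  | cons i w ih =>
    rw [FreeMonoid.ofList_cons, word_mul, ← T_idx, d_T_mul]
    refine Submodule.add_mem _ (of_mem_on (Or.inr ⟨FreeMonoid.ofList w, rfl, ?_⟩))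
      (map_mem_on _ (mul_zero _) (fun a ha => ?_) ih)
    · simp [FreeMonoid.length]
    · have := mul_gr (T_gr i.1) ha
      convert this using 1
      simp

instance : LawfulDGP (NH n) where
  zero_mem g := Or.inl rfl
  exhaust a := by
    obtain ⟨w, rfl⟩ := cl_surj a
    induction w using WithZero.recZeroCoe with
    | zero => exact ⟨0, Or.inl rfl⟩
    | coe w => exact ⟨_, Or.inr ⟨w, rfl, rfl⟩⟩
  separated := by
    rintro g h a (ha | ⟨u, rfl, hu⟩) (ha' | ⟨v, hv, hv'⟩) hgh
    · exact ha
    · exact ha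
    · exact ha'
    · by_contra h0
      have := len_congr hv h0
      apply hgh
      rw [← hu, ← hv']
      exact congrArg _ this
  d_sq x := by
    refine hom_ext_apply (φ := d.comp d) (ψ := 0) (fun w => ?_) x
    exact d_sq w
  d_gr := by
    rintro g a (rfl | ⟨w, rfl, rfl⟩)
    · simp
    · exact d_gr_word w.toList

/-- The morphism of pointed monoids `H_r^• → H_s^•`, `T_i ↦ T_{i+k}`. It is used for `r + k ≤ s`: for `k = 0` it is the inclusion,
and for `k = 1` it is `f_1`. -/
def sh (k r s : ℕ) : NH r →* NH s :=
  lift (fun i => T s (i + k)) (fun i => T_sq _) (fun i j h => T_comm (by omega))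
    (fun i => by have := T_braid (n := s) (i + k); rwa [Nat.add_right_comm] at this)

@[simp] theorem sh_zero (k r s : ℕ) : sh k r s 0 = 0 := lift_zero

theorem sh_T (k r s : ℕ) (i : Idx r) : sh k r s (T r i.1) = T s (i.1 + k) := lift_T i

theorem sh_id (r : ℕ) (a : NH r) : sh 0 r r a = a := by
  induction a using ind with
  | h0 => simp
  | h1 => simp
  | h i a ih => rw [map_mul, sh_T, ih, add_zero]

theorem sh_sh (k l r s t : ℕ) (h : r + k ≤ s) (a : NH r) : sh l s t (sh k r s a) = sh (k + l) r t a := by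
  induction a using ind with
  | h0 => simp
  | h1 => simp
  | h i a ih =>
    have := i.2
    rw [map_mul, map_mul, map_mul, sh_T, ih, sh_T, sh_T _ _ _ ⟨i.1 + k, by omega⟩, add_assoc]

theorem d_sh (k r s : ℕ) (h : r + k ≤ s) (a : NH r) : d (of (sh k r s a)) = map (sh k r s) (d (of a)) := by
  induction a using ind with
  | h0 => simp
  | h1 => rw [map_one, d_one, d_one, map_zero]
  | h i a ih =>
    have := i.2
    rw [map_mul, sh_T, d_T_mul, map_add, map_of _ (sh_zero _ _ _), map_map _ _ (mul_zero _) (sh_zero _ _ _),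
      d_T_mul ⟨i.1 + k, by omega⟩, ih, map_map _ _ (sh_zero _ _ _) (mul_zero _)]
    simp only [map_mul, sh_T]

theorem sh_gr (k r s : ℕ) {g : ℤ} {a : NH r} (h : a ∈ gr g) : sh k r s a ∈ gr g := by
  rcases h with rfl | ⟨w, rfl, rfl⟩
  · exact Or.inl (sh_zero _ _ _)
  · induction w using FreeMonoid.inductionOn' with
    | one => rw [word_one, map_one]; exact one_gr
    | of_mul i w ih =>
      rw [word_mul, map_mul, ← T_idx, sh_T]
      have := mul_gr (T_gr (n := s) (i.1 + k)) ih
      convert this using 1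
      simp [FreeMonoid.length_mul]; ring_nf

/-- `T_1` commutes with the image of `T_i ↦ T_{i+2}`. -/
theorem T_zero_comm (r s : ℕ) (a : NH r) : sh 2 r s a * T s 0 = T s 0 * sh 2 r s a := by
  induction a using ind with
  | h0 => simp
  | h1 => simp
  | h i a ih => rw [map_mul, mul_assoc, ih, ← mul_assoc, sh_T, ← T_comm (by omega), mul_assoc]

/-- `T_{r+1}` commutes with the image of `H_r`. -/
theorem T_last_comm (r s : ℕ) (a : NH r) : sh 0 r s a * T s r = T s r * sh 0 r s a := by
  induction a using ind with
  | h0 => simp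
  | h1 => simp
  | h i a ih =>
    have := i.2
    rw [map_mul, mul_assoc, ih, ← mul_assoc, sh_T, add_zero, T_comm (by omega), mul_assoc]

end NH

/-! ## The pointed category `𝒰^•` and its regular bimodules -/

/-- The pointed set which is `S` if `p` holds, and is reduced to the base point otherwise. -/
def Diag (p : Prop) (S : Type) [Zero S] : Type := {s : S // ¬p → s = 0}

namespace Diag

section
variable {p : Prop} {S : Type} [Zero S]

instance : Zero (Diag p S) := ⟨⟨0, fun _ => rfl⟩⟩

/-- The inclusion in `S`. -/
def val (s : Diag p S) : S := s.1

/-- The element given by `s` if `p` holds. -/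
def mk (p : Prop) (s : S) : Diag p S := ⟨if p then s else 0, fun h => if_neg h⟩

theorem mk_val (h : p) (s : S) : (mk p s).val = s := if_pos h

@[simp] theorem zero_val : (0 : Diag p S).val = 0 := rfl

@[simp] theorem mk_zero : mk p (0 : S) = 0 := Subtype.ext (ite_self 0)

theorem ext {s t : Diag p S} (h : p → s.val = t.val) : s = t := by
  by_cases hp : p
  · exact Subtype.ext (h hp)
  · exact Subtype.ext ((s.2 hp).trans (t.2 hp).symm)

theorem mk_eta (s : Diag p S) : mk p s.val = s := ext fun h => mk_val h _

theorem cases (s : Diag p S) : s = 0 ∨ p := by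
  by_cases hp : p
  · exact Or.inr hp
  · exact Or.inl (Subtype.ext (s.2 hp))

theorem mk_neg (h : ¬p) (s : S) : mk p s = 0 := Subtype.ext (if_neg h)

end

section
variable {p : Prop} {S : Type} [DGP S]

instance : DGP (Diag p S) where
  gr g := {s | s.val ∈ gr (S := S) g}
  d := (map (mk p)).comp ((d (S := S)).comp (map val))

theorem mem_gr {g : ℤ} {s : Diag p S} : s ∈ gr g ↔ s.val ∈ gr (S := S) g := Iff.rfl

theorem mk_gr [LawfulDGP S] {g : ℤ} {s : S} (h : s ∈ gr g) : mk p s ∈ gr g := by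
  by_cases hp : p
  · rwa [mem_gr, mk_val hp]
  · rw [mk_neg hp]; exact LawfulDGP.zero_mem (S := S) g

theorem d_of (s : Diag p S) : d (of s) = map (mk p) (d (of s.val)) := by
  change map (mk p) (d (map val (of s))) = _
  rw [map_of val rfl]

theorem map_val_map_mk (h : p) (x : F2 S) : map val (map (mk p) x) = x := by
  rw [map_map _ _ mk_zero rfl]
  simp only [mk_val h, map_id]

instance [LawfulDGP S] : LawfulDGP (Diag p S) where
  zero_mem g := LawfulDGP.zero_mem (S := S) g
  exhaust s := LawfulDGP.exhaust (S := S) s.val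
  separated hg hh hgh := Subtype.ext (LawfulDGP.separated (S := S) hg hh hgh)
  d_sq x := by
    refine hom_ext_apply (φ := d.comp d) (ψ := 0) (fun s => ?_) x
    change d (d (of s)) = 0
    rcases cases s with rfl | h
    · simp
    · rw [d_of]
      change map (mk p) (d (map val (map (mk p) (d (of s.val))))) = 0
      rw [map_val_map_mk h, LawfulDGP.d_sq, map_zero]
  d_gr hs := by
    rw [d_of]
    exact map_mem_on _ mk_zero (fun _ ht => mk_gr ht) (LawfulDGP.d_gr (S := S) hs)

theorem leibniz {q r : Prop} {T U : Type} [DGP T] [DGP U] (m : S → T → U) (f : Diag p S) (g : Diag q T)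
    (hz : ∀ t, m 0 t = 0) (hz' : ∀ s, m s 0 = 0) (hp : p) (hq : q)
    (h : d (of (m f.val g.val)) = map (fun f' => m f' g.val) (d (of f.val)) +
      map (fun g' => m f.val g') (d (of g.val))) :
    d (of (mk r (m f.val g.val))) = map (fun f' : Diag p S => mk r (m f'.val g.val)) (d (of f)) +
      map (fun g' : Diag q T => mk r (m f.val g'.val)) (d (of g)) := by
  by_cases hr : r
  · rw [d_of, mk_val hr, h, map_add, d_of f, d_of g, map_map (fun f' => m f' _) _ (hz _) mk_zero,
      map_map (fun g' => m _ g') _ (hz' _) mk_zero, map_map _ _ mk_zero (by simp [hz]), map_map _ _ mk_zero (by simp [hz'])]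
    simp only [mk_val hp, mk_val hq]
  · have e : ∀ u : U, mk r u = 0 := mk_neg hr
    simp [e, map_zero_fun]

end

end Diag

/-- Transport along an equality of indices (and `0` if the indices are different). -/
def tr (A : ℕ → Type) [∀ n, Zero (A n)] (m n : ℕ) (a : A m) : A n := if h : m = n then h ▸ a else 0

@[simp] theorem tr_self (A : ℕ → Type) [∀ n, Zero (A n)] (n : ℕ) (a : A n) : tr A n n a = a := by
  simp [tr]

@[simp] theorem tr_zero (A : ℕ → Type) [∀ n, Zero (A n)] (m n : ℕ) : tr A m n 0 = 0 := by
  by_cases h : m = n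
  · subst h; simp
  · simp [tr, h]

/-- The category with objects `n ∈ ℕ`, with no non-zero maps between different objects, and with `End(n) = A n`. -/
def diagCat (A : ℕ → Type) [∀ n, DGP (A n)] (one : ∀ n, A n) (mul : ∀ n, A n → A n → A n) : DPCat ℕ where
  mor x y := Diag (x = y) (A x)
  one x := Diag.mk (x = x) (one x)
  comp := fun {x y z} f g =>
    Diag.mk (x = z) (if x = y ∧ y = z then mul x f.val (tr A y x g.val) else 0)

/-- The differential graded pointed category `𝒰^•`: its objects are the `e^n`, `n ∈ ℕ`, and `End(e^n) = H_n^•`. -/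
def catU : DPCat ℕ := diagCat NH (fun _ => 1) (fun _ a b => a * b)

namespace catU

theorem zero_comp {x y z : ℕ} (g : catU.mor y z) : catU.comp (0 : catU.mor x y) g = 0 := by
  change Diag.mk (x = z) (if _ then (0 : NH x) * _ else 0) = 0
  simp

theorem comp_zero {x y z : ℕ} (f : catU.mor x y) : catU.comp f (0 : catU.mor y z) = 0 := by
  change Diag.mk (x = z) (if _ then _ * tr NH y x (0 : NH y) else 0) = 0
  simp

theorem eq_or (x y : ℕ) (f : catU.mor x y) : f = 0 ∨ x = y := Diag.cases f

/-- The underlying element of `H_x^•`. -/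
def val {x y : ℕ} (f : catU.mor x y) : NH x := Diag.val f

@[simp] theorem val_zero {x y : ℕ} : val (0 : catU.mor x y) = 0 := rfl

theorem comp_self {x : ℕ} (f g : catU.mor x x) : catU.comp f g = Diag.mk (x = x) (val f * val g) := by
  simp [catU, diagCat, val]

theorem comp_val {x : ℕ} (f g : catU.mor x x) : val (catU.comp f g) = val f * val g := by
  rw [comp_self]; exact Diag.mk_val rfl _

theorem one_val (x : ℕ) : val (catU.one x) = 1 := Diag.mk_val rfl _

theorem ext {x y : ℕ} {f g : catU.mor x y} (h : val f = val g) : f = g := Subtype.ext h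

theorem val_gr {x y : ℕ} {p : ℤ} {f : catU.mor x y} (h : f ∈ gr p) : val f ∈ gr p := h

instance : catU.Lawful where
  lawful x y := inferInstanceAs (LawfulDGP (Diag (x = y) (NH x)))
  zero_comp := zero_comp
  comp_zero := comp_zero
  one_comp := fun {x y} f => by
    rcases eq_or x y f with rfl | rfl
    · exact comp_zero _
    · exact ext (by rw [comp_val, one_val, one_mul])
  comp_one := fun {x y} f => by
    rcases eq_or x y f with rfl | rfl
    · exact zero_comp _
    · exact ext (by rw [comp_val, one_val, mul_one])
  assoc := fun {x y z w} f g h => by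
    rcases eq_or _ _ f with rfl | rfl
    · simp only [zero_comp]
    rcases eq_or _ _ g with rfl | rfl
    · simp only [zero_comp, comp_zero]
    rcases eq_or _ _ h with rfl | rfl
    · simp only [comp_zero]
    exact ext (by simp only [comp_val, mul_assoc])
  one_gr x := Diag.mk_gr NH.one_gr
  comp_gr := fun {x y z p q f g} hf hg => by
    rcases eq_or _ _ f with rfl | rfl
    · rw [zero_comp]; exact Or.inl rfl
    rcases eq_or _ _ g with rfl | rfl
    · rw [comp_zero]; exact Or.inl rfl
    rw [comp_self]
    exact Diag.mk_gr (NH.mul_gr hf hg)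
  leibniz := fun {x y z} f g => by
    rcases eq_or _ _ f with rfl | rfl
    · simp [zero_comp, map_zero_fun]
    rcases eq_or _ _ g with rfl | rfl
    · simp [comp_zero, map_zero_fun]
    simp only [comp_self]
    exact Diag.leibniz (fun a b => a * b) f g zero_mul mul_zero rfl rfl (NH.leibniz _ _)

end catU

/-- The bimodule `R^-(-, -, e)`: `R^-(e^s, e^r, e) = δ_{s, r+1} H_s^•`, where `H_s^•` acts by left multiplication
and `h ∈ H_r^•` acts by right multiplication by `f_1(h)`. -/
def bimodR : Bimod catU where
  car s r := Diag (s = r + 1) (NH s)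
  lawful s r := inferInstance
  lact := fun {s' s r} f m =>
    Diag.mk (s' = r + 1) (if s' = s then catU.val f * tr NH s s' m.val else 0)
  ract := fun {s r r'} m f =>
    Diag.mk (s = r' + 1) (if r = r' then m.val * NH.sh 1 r s (catU.val f) else 0)
  zero_lact m := by simp
  lact_zero f := by simp
  zero_ract f := by simp
  ract_zero m := by simp
  one_lact m := by
    refine Diag.ext fun h => ?_
    rw [Diag.mk_val h]; simp [catU.one_val]
  ract_one m := by
    refine Diag.ext fun h => ?_
    rw [Diag.mk_val h]; simp [catU.one_val]
  lact_lact := fun {x y z w} f g m => by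
    rcases catU.eq_or _ _ f with rfl | rfl
    · simp [catU.zero_comp]
    rcases catU.eq_or _ _ g with rfl | rfl
    · simp [catU.comp_zero]
    refine Diag.ext fun h => ?_
    simp [Diag.mk_val h, catU.comp_val, mul_assoc]
  ract_ract := fun {x y z w} m f g => by
    rcases catU.eq_or _ _ f with rfl | rfl
    · simp [catU.zero_comp]
    rcases catU.eq_or _ _ g with rfl | rfl
    · simp [catU.comp_zero]
    refine Diag.ext fun h => ?_
    simp [Diag.mk_val h, catU.comp_val, mul_assoc]
  lact_ract := fun {x y z w} f m g => by
    rcases catU.eq_or _ _ f with rfl | rfl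
    · simp
    rcases catU.eq_or _ _ g with rfl | rfl
    · simp
    refine Diag.ext fun h => ?_
    simp [Diag.mk_val h, mul_assoc]
  lact_gr := fun {x y z p q f m} hf hm => by
    rcases catU.eq_or _ _ f with rfl | rfl
    · rw [catU.val_zero]; simp; exact Or.inl rfl
    rw [if_pos rfl, tr_self]
    exact Diag.mk_gr (NH.mul_gr (catU.val_gr hf) hm)
  ract_gr := fun {x y z p q m f} hm hf => by
    rcases catU.eq_or _ _ f with rfl | rfl
    · rw [catU.val_zero]; simp; exact Or.inl rfl
    rw [if_pos rfl]
    exact Diag.mk_gr (NH.mul_gr hm (NH.sh_gr _ _ _ (catU.val_gr hf)))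
  lleibniz := fun {x y z} f m => by
    rcases catU.eq_or _ _ f with rfl | rfl
    · simp [map_zero_fun]
    rcases Diag.cases m with rfl | h
    · simp [map_zero_fun]
    simp only [if_true, tr_self]
    exact Diag.leibniz (fun a b => a * b) f m zero_mul mul_zero rfl h (NH.leibniz _ _)
  rleibniz := fun {x y z} m f => by
    rcases catU.eq_or _ _ f with rfl | rfl
    · simp [map_zero_fun]
    rcases Diag.cases m with rfl | h
    · simp [map_zero_fun]
    simp only [if_true]
    refine Diag.leibniz (fun a b => a * NH.sh 1 y x b) m f (by simp) (by simp) h rfl ?_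
    obtain rfl := h
    rw [NH.leibniz, NH.d_sh _ _ _ le_rfl, map_map _ _ (NH.sh_zero _ _ _) (mul_zero _)]

/-- The bimodule `L^+(-, -, e)`: `L^+(e^r, e^s, e) = δ_{s, r+1} H_s^•`, where `h ∈ H_r^•` acts by left multiplication by
its image in `H_s^•` and `H_s^•` acts by right multiplication. -/
def bimodL : Bimod catU where
  car r s := Diag (s = r + 1) (NH s)
  lawful r s := inferInstance
  lact := fun {r' r s} f m =>
    Diag.mk (s = r' + 1) (if r' = r then NH.sh 0 r' s (catU.val f) * m.val else 0)
  ract := fun {r s s'} m f =>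
    Diag.mk (s' = r + 1) (if s = s' then tr NH s s' (m.val * catU.val f) else 0)
  zero_lact m := by simp
  lact_zero f := by simp
  zero_ract f := by simp
  ract_zero m := by simp
  one_lact m := by
    refine Diag.ext fun h => ?_
    rw [Diag.mk_val h]; simp [catU.one_val]
  ract_one m := by
    refine Diag.ext fun h => ?_
    rw [Diag.mk_val h]; simp [catU.one_val]
  lact_lact := fun {x y z w} f g m => by
    rcases catU.eq_or _ _ f with rfl | rfl
    · simp [catU.zero_comp]
    rcases catU.eq_or _ _ g with rfl | rfl
    · simp [catU.comp_zero]
    refine Diag.ext fun h => ?_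
    simp [Diag.mk_val h, catU.comp_val, mul_assoc]
  ract_ract := fun {x y z w} m f g => by
    rcases catU.eq_or _ _ f with rfl | rfl
    · simp [catU.zero_comp]
    rcases catU.eq_or _ _ g with rfl | rfl
    · simp [catU.comp_zero]
    refine Diag.ext fun h => ?_
    simp [Diag.mk_val h, catU.comp_val, mul_assoc]
  lact_ract := fun {x y z w} f m g => by
    rcases catU.eq_or _ _ f with rfl | rfl
    · simp
    rcases catU.eq_or _ _ g with rfl | rfl
    · simp
    refine Diag.ext fun h => ?_
    simp [Diag.mk_val h, mul_assoc]
  lact_gr := fun {x y z p q f m} hf hm => by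
    rcases catU.eq_or _ _ f with rfl | rfl
    · rw [catU.val_zero]; simp; exact Or.inl rfl
    rw [if_pos rfl]
    exact Diag.mk_gr (NH.mul_gr (NH.sh_gr _ _ _ (catU.val_gr hf)) hm)
  ract_gr := fun {x y z p q m f} hm hf => by
    rcases catU.eq_or _ _ f with rfl | rfl
    · rw [catU.val_zero]; simp; exact Or.inl rfl
    rw [if_pos rfl, tr_self]
    exact Diag.mk_gr (NH.mul_gr hm (catU.val_gr hf))
  lleibniz := fun {x y z} f m => by
    rcases catU.eq_or _ _ f with rfl | rfl
    · simp [map_zero_fun]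
    rcases Diag.cases m with rfl | h
    · simp [map_zero_fun]
    simp only [if_true]
    refine Diag.leibniz (fun a b => NH.sh 0 x z a * b) f m (by simp) (by simp) rfl h ?_
    obtain rfl := h
    rw [NH.leibniz, NH.d_sh _ _ _ (by omega), map_map _ (fun a => a * _) (NH.sh_zero _ _ _) (zero_mul _)]
  rleibniz := fun {x y z} m f => by
    rcases catU.eq_or _ _ f with rfl | rfl
    · simp [map_zero_fun]
    rcases Diag.cases m with rfl | h
    · simp [map_zero_fun]
    simp only [if_true, tr_self]
    exact Diag.leibniz (fun a b => a * b) m f zero_mul mul_zero h rfl (NH.leibniz _ _)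

/-- The element of `R^-(e^s, e^r, e)` given by `a ∈ H_s^•` (`0` if `s ≠ r + 1`). -/
def elR {s r : ℕ} (a : NH s) : bimodR.car s r := Diag.mk (s = r + 1) a

/-- The element of `L^+(e^r, e^s, e)` given by `a ∈ H_s^•` (`0` if `s ≠ r + 1`). -/
def elL {r s : ℕ} (a : NH s) : bimodL.car r s := Diag.mk (s = r + 1) a

/-- The element of `H_s^•` underlying an element of `R^-(e^s, e^r, e)`. -/
def valR {s r : ℕ} (a : bimodR.car s r) : NH s := Diag.val a

/-- The element of `H_s^•` underlying an element of `L^+(e^r, e^s, e)`. -/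
def valL {r s : ℕ} (a : bimodL.car r s) : NH s := Diag.val a

theorem elR_valR {s r : ℕ} (a : bimodR.car s r) : elR (valR a) = a := Diag.mk_eta _
theorem elL_valL {r s : ℕ} (a : bimodL.car r s) : elL (valL a) = a := Diag.mk_eta _
@[simp] theorem elR_zero {s r : ℕ} : elR (0 : NH s) = (0 : bimodR.car s r) := Diag.mk_zero
@[simp] theorem elL_zero {r s : ℕ} : elL (0 : NH s) = (0 : bimodL.car r s) := Diag.mk_zero
@[simp] theorem valR_zero {s r : ℕ} : valR (0 : bimodR.car s r) = 0 := rfl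
@[simp] theorem valL_zero {r s : ℕ} : valL (0 : bimodL.car r s) = 0 := rfl
theorem valR_elR {r : ℕ} (a : NH (r + 1)) : valR (elR a : bimodR.car (r + 1) r) = a := Diag.mk_val rfl _
theorem valL_elL {r : ℕ} (a : NH (r + 1)) : valL (elL a : bimodL.car r (r + 1)) = a := Diag.mk_val rfl _
theorem R_cases {s r : ℕ} (a : bimodR.car s r) : a = 0 ∨ s = r + 1 := Diag.cases a
theorem L_cases {r s : ℕ} (a : bimodL.car r s) : a = 0 ∨ s = r + 1 := Diag.cases a
theorem valR_gr {s r : ℕ} {g : ℤ} {a : bimodR.car s r} (h : a ∈ gr g) : valR a ∈ gr g := h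
theorem valL_gr {r s : ℕ} {g : ℤ} {a : bimodL.car r s} (h : a ∈ gr g) : valL a ∈ gr g := h
theorem elR_gr {s r : ℕ} {g : ℤ} {a : NH s} (h : a ∈ gr g) : (elR a : bimodR.car s r) ∈ gr g := Diag.mk_gr h
theorem elL_gr {r s : ℕ} {g : ℤ} {a : NH s} (h : a ∈ gr g) : (elL a : bimodL.car r s) ∈ gr g := Diag.mk_gr h
theorem d_elR {r : ℕ} (a : NH (r + 1)) : d (of (elR a : bimodR.car (r + 1) r)) = map elR (d (of a)) :=
  (Diag.d_of _).trans (by rw [elR, Diag.mk_val rfl]; rfl)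
theorem d_elL {r : ℕ} (a : NH (r + 1)) : d (of (elL a : bimodL.car r (r + 1))) = map elL (d (of a)) :=
  (Diag.d_of _).trans (by rw [elL, Diag.mk_val rfl]; rfl)

/-- The element of `End(e^x)` given by `a ∈ H_x^•`. -/
def elU {x : ℕ} (a : NH x) : catU.mor x x := Diag.mk (x = x) a

theorem val_elU {x : ℕ} (a : NH x) : catU.val (elU a) = a := Diag.mk_val rfl _

theorem elU_val {x : ℕ} (a : catU.mor x x) : elU (catU.val a) = a := Diag.mk_eta _

theorem lactR {s r : ℕ} (f : catU.mor s s) (a : NH s) :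
    bimodR.lact f (elR a : bimodR.car s r) = elR (catU.val f * a) := by
  refine Diag.ext fun h => ?_
  simp [bimodR, elR, Diag.mk_val h]

theorem ractR {s r : ℕ} (f : catU.mor r r) (a : NH s) :
    bimodR.ract (elR a : bimodR.car s r) f = elR (a * NH.sh 1 r s (catU.val f)) := by
  refine Diag.ext fun h => ?_
  simp [bimodR, elR, Diag.mk_val h]

theorem lactL {r s : ℕ} (f : catU.mor r r) (a : NH s) :
    bimodL.lact f (elL a : bimodL.car r s) = elL (NH.sh 0 r s (catU.val f) * a) := by
  refine Diag.ext fun h => ?_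
  simp [bimodL, elL, Diag.mk_val h]

theorem ractL {r s : ℕ} (f : catU.mor s s) (a : NH s) :
    bimodL.ract (elL a : bimodL.car r s) f = elL (a * catU.val f) := by
  refine Diag.ext fun h => ?_
  simp [bimodL, elL, Diag.mk_val h]

/-! ## The gluing datum of the left and right regular bimodule `2`-representations -/

theorem R_ind {s r : ℕ} {P : bimodR.car s r → Prop} (h : ∀ a, P (elR a)) (m : bimodR.car s r) : P m := by
  rw [← elR_valR m]; exact h _

theorem L_ind {r s : ℕ} {P : bimodL.car r s → Prop} (h : ∀ a, P (elL a)) (m : bimodL.car r s) : P m := by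
  rw [← elL_valL m]; exact h _

/-- Induction principle for a tensor product of bimodules: `0` or `m ∧ n` with `m, n ≠ 0`. -/
theorem wedge_ind' {M N : Bimod catU} {x z : ℕ} {P : (wedge M N).car x z → Prop} (h0 : P 0)
    (h : ∀ (y : ℕ) (m : M.car x y) (n : N.car y z), m ≠ 0 → n ≠ 0 → P (wmk m n))
    (w : (wedge M N).car x z) : P w := by
  induction w using wedge_ind with
  | h0 => exact h0
  | h y m n =>
    by_cases hm : m = 0
    · rw [hm, zero_wmk]; exact h0
    by_cases hn : n = 0
    · rw [hn, wmk_zero]; exact h0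
    exact h y m n hm hn

theorem R_eq {s r : ℕ} {m : bimodR.car s r} (h : m ≠ 0) : s = r + 1 := (R_cases m).resolve_left h
theorem L_eq {r s : ℕ} {m : bimodL.car r s} (h : m ≠ 0) : s = r + 1 := (L_cases m).resolve_left h

theorem wmk_elR {M : Bimod catU} {x t y : ℕ} (m : M.car x t) (b : NH t) :
    wmk m (elR b : bimodR.car t y) = wmk (M.ract m (elU b)) (elR 1 : bimodR.car t y) := by
  rw [wmk_move, lactR, val_elU, mul_one]

theorem elL_wmk {N : Bimod catU} {x t y : ℕ} (a : NH t) (n : N.car t y) :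
    wmk (elL a : bimodL.car x t) n = wmk (elL 1 : bimodL.car x t) (N.lact (elU a) n) := by
  rw [← wmk_move, ractL, val_elU, one_mul]

theorem wmk_gr {M N : Bimod catU} {x t y : ℕ} {p q g : ℤ} {m : M.car x t} {n : N.car t y} (hm : m ∈ gr p)
    (hn : n ∈ gr q) (h : p + q = g) : wmk m n ∈ gr (S := (wedge M N).car x y) g :=
  wedge_gr.2 (Or.inr ⟨p, q, t, m, n, h, hm, hn, rfl⟩)

theorem elR_one_d {t : ℕ} : d (of (elR 1 : bimodR.car (t + 1) t)) = 0 := by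
  rw [d_elR, NH.d_one, map_zero]

theorem elL_one_d {t : ℕ} : d (of (elL 1 : bimodL.car t (t + 1))) = 0 := by
  rw [d_elL, NH.d_one, map_zero]

/-- `τ₁(a ∧ b) = a f_1(b) T_1 ∧ 1`, on `F_1²` for `F_1 = R^-(-, -, e)`. -/
def tauR : BHom (wedge bimodR bimodR) (wedge bimodR bimodR) where
  toFun := fun {x y} w => wlift (fun t a b =>
      wmk (elR (valR a * NH.sh 1 t x (valR b) * NH.T x 0) : bimodR.car x t) (elR 1 : bimodR.car t y))
    (fun _ _ => by simp [zero_wmk]) (fun _ _ => by simp [zero_wmk])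
    (fun {t t'} m f n => by
      rcases catU.eq_or _ _ f with rfl | rfl
      · simp [bimodR.ract_zero, bimodR.zero_lact, zero_wmk]
      rcases R_cases m with rfl | rfl
      · simp [bimodR.zero_ract, zero_wmk]
      rcases R_cases n with rfl | rfl
      · simp [bimodR.lact_zero, zero_wmk]
      induction m using R_ind with | h a =>
      induction n using R_ind with | h b =>
      rw [ractR, lactR, valR_elR, valR_elR, valR_elR, valR_elR, map_mul, ← mul_assoc]) w
  map_zero := rfl
  map_lact f w := by
    rcases catU.eq_or _ _ f with rfl | rfl
    · rw [(wedge _ _).zero_lact, (wedge _ _).zero_lact]; rfl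
    induction w using wedge_ind' with
    | h0 => rfl
    | h t m n hm hn =>
      obtain rfl := R_eq hm
      induction m using R_ind with | h a =>
      rw [lact_wmk, wlift_wmk, wlift_wmk, lact_wmk, lactR, lactR, valR_elR, valR_elR, mul_assoc, mul_assoc,
        mul_assoc]
  map_ract w f := by
    rcases catU.eq_or _ _ f with rfl | rfl
    · rw [(wedge _ _).ract_zero, (wedge _ _).ract_zero]; rfl
    induction w using wedge_ind' with
    | h0 => rfl
    | h t m n hm hn =>
      obtain rfl := R_eq hm
      obtain rfl := R_eq hn
      induction m using R_ind with | h a =>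
      induction n using R_ind with | h b =>
      rw [wmk_ract, wlift_wmk, wlift_wmk, wmk_ract, ractR, ractR, valR_elR, valR_elR, valR_elR, map_mul,
        NH.sh_sh _ _ _ _ _ le_rfl, mul_assoc, mul_assoc, NH.T_zero_comm, one_mul, wmk_elR, ractR, val_elU, ← mul_assoc,
        ← mul_assoc, map_one, mul_one, wmk_elR _ (NH.sh 1 _ _ _), ractR, val_elU, NH.sh_sh _ _ _ _ _ le_rfl]

theorem tauR_wmk {x t y : ℕ} (a : bimodR.car x t) (b : bimodR.car t y) : tauR.toFun (wmk a b) =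
    wmk (elR (valR a * NH.sh 1 t x (valR b) * NH.T x 0) : bimodR.car x t) (elR 1 : bimodR.car t y) := rfl

theorem tauR_gr {x y : ℕ} {g : ℤ} {p : (wedge bimodR bimodR).car x y} (hp : p ∈ gr g) :
    tauR.toFun p ∈ gr (S := (wedge bimodR bimodR).car x y) (g - 1) := by
  rcases wedge_gr.1 hp with rfl | ⟨p, q, t, m, n, h, hm, hn, rfl⟩
  · rw [tauR.map_zero]; exact Or.inl rfl
  · rw [tauR_wmk]
    refine wmk_gr (elR_gr (NH.mul_gr (NH.mul_gr (valR_gr hm) (NH.sh_gr _ _ _ (valR_gr hn))) (NH.T_gr 0)))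
      (elR_gr NH.one_gr) ?_
    omega

theorem d_tauR {x y : ℕ} (p : (wedge bimodR bimodR).car x y) :
    d (of (tauR.toFun p)) = of p + map tauR.toFun (d (of p)) := by
  induction p using wedge_ind' with
  | h0 => rw [tauR.map_zero]; simp
  | h t m n hm hn =>
    obtain rfl := R_eq hm
    obtain rfl := R_eq hn
    induction m using R_ind with | h a =>
    induction n using R_ind with | h b =>
    rw [wmk_elR, ractR]
    generalize a * NH.sh 1 (y + 1) (y + 1 + 1) (catU.val (elU b)) = c
    have z1 : wmk (elR (0 : NH (y + 1 + 1)) : bimodR.car _ (y + 1)) (elR 1 : bimodR.car (y + 1) y) = 0 := by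
      rw [elR_zero, zero_wmk]
    have e : ∀ c : NH (y + 1 + 1), tauR.toFun (wmk (elR c : bimodR.car _ (y + 1))
        (elR 1 : bimodR.car _ y)) = wmk (elR (c * NH.T _ 0)) (elR 1) := fun a => by
      rw [tauR_wmk, valR_elR, valR_elR, map_one, mul_one]
    have e' : ∀ c : NH (y + 1 + 1), d (of (wmk (elR c : bimodR.car _ (y + 1)) (elR 1 : bimodR.car _ y))) =
        map (fun c => wmk (elR c) (elR 1)) (d (of c)) := fun c => by
      rw [d_wmk, elR_one_d, map_zero, add_zero, d_elR, map_map elR (fun m => wmk m _) elR_zero (zero_wmk _)]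
    rw [e, e', e', NH.leibniz, NH.d_T _ (by omega), map_of _ (mul_zero _), mul_one, map_add,
      map_of _ z1, map_map _ _ z1 tauR.map_zero, map_map (fun c => c * _) _ (zero_mul _) z1]
    simp only [e]
    exact add_comm _ _

/-- `τ₂(u ∧ v) = 1 ∧ T_{s-1} u v`, on `E_2²(e^{s-2}, e^s)` for `E_2 = L^+(-, -, e)`. -/
def tauL : BHom (wedge bimodL bimodL) (wedge bimodL bimodL) where
  toFun := fun {x y} w => wlift (fun t u v =>
      wmk (elL 1 : bimodL.car x t) (elL (NH.T y (y - 2) * (NH.sh 0 t y (valL u) * valL v)) : bimodL.car t y))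
    (fun _ _ => by simp [wmk_zero]) (fun _ _ => by simp [wmk_zero])
    (fun {t t'} m f n => by
      rcases catU.eq_or _ _ f with rfl | rfl
      · simp [bimodL.ract_zero, bimodL.zero_lact, wmk_zero]
      rcases L_cases m with rfl | rfl
      · simp [bimodL.zero_ract, wmk_zero]
      rcases L_cases n with rfl | rfl
      · simp [bimodL.lact_zero, wmk_zero]
      induction m using L_ind with | h a =>
      induction n using L_ind with | h b =>
      rw [ractL, lactL, valL_elL, valL_elL, valL_elL, valL_elL, map_mul, mul_assoc]) w
  map_zero := rfl
  map_lact f w := by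
    rcases catU.eq_or _ _ f with rfl | rfl
    · rw [(wedge _ _).zero_lact, (wedge _ _).zero_lact]; rfl
    induction w using wedge_ind' with
    | h0 => rfl
    | h t m n hm hn =>
      rename_i x y
      obtain rfl := L_eq hm
      obtain rfl := L_eq hn
      induction m using L_ind with | h a =>
      induction n using L_ind with | h b =>
      rw [lact_wmk, wlift_wmk, wlift_wmk, lact_wmk, lactL, lactL, valL_elL, valL_elL, valL_elL, map_mul,
        NH.sh_sh _ _ _ _ _ (by omega), mul_one, elL_wmk (NH.sh 0 _ _ _), lactL, val_elU,
        NH.sh_sh _ _ _ _ _ (by omega), ← mul_assoc (NH.sh (0 + 0) _ _ _), show x + 1 + 1 - 2 = x from rfl,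
        ← mul_assoc (NH.T _ _), mul_assoc (NH.sh (0 + 0) _ _ _), ← mul_assoc (NH.T _ _),
        ← NH.T_last_comm, mul_assoc, mul_assoc]
  map_ract w f := by
    rcases catU.eq_or _ _ f with rfl | rfl
    · rw [(wedge _ _).ract_zero, (wedge _ _).ract_zero]; rfl
    induction w using wedge_ind' with
    | h0 => rfl
    | h t m n hm hn =>
      obtain rfl := L_eq hn
      induction n using L_ind with | h b =>
      rw [wmk_ract, wlift_wmk, wlift_wmk, wmk_ract, ractL, ractL, valL_elL, valL_elL, mul_assoc, mul_assoc]

theorem tauL_wmk {x t y : ℕ} (u : bimodL.car x t) (v : bimodL.car t y) : tauL.toFun (wmk u v) =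
    wmk (elL 1 : bimodL.car x t)
      (elL (NH.T y (y - 2) * (NH.sh 0 t y (valL u) * valL v)) : bimodL.car t y) := rfl

theorem tauL_gr {x y : ℕ} {g : ℤ} {p : (wedge bimodL bimodL).car x y} (hp : p ∈ gr g) :
    tauL.toFun p ∈ gr (S := (wedge bimodL bimodL).car x y) (g - 1) := by
  rcases wedge_gr.1 hp with rfl | ⟨p, q, t, m, n, h, hm, hn, rfl⟩
  · rw [tauL.map_zero]; exact Or.inl rfl
  · rw [tauL_wmk]
    refine wmk_gr (elL_gr NH.one_gr)
      (elL_gr (NH.mul_gr (NH.T_gr _) (NH.mul_gr (NH.sh_gr _ _ _ (valL_gr hm)) (valL_gr hn)))) ?_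
    omega

theorem d_tauL {x y : ℕ} (p : (wedge bimodL bimodL).car x y) :
    d (of (tauL.toFun p)) = of p + map tauL.toFun (d (of p)) := by
  induction p using wedge_ind' with
  | h0 => rw [tauL.map_zero]; simp
  | h t m n hm hn =>
    obtain rfl := L_eq hm
    obtain rfl := L_eq hn
    induction m using L_ind with | h a =>
    induction n using L_ind with | h b =>
    rw [elL_wmk, lactL]
    generalize NH.sh 0 (x + 1) (x + 1 + 1) (catU.val (elU a)) * b = c
    have z1 : wmk (elL 1 : bimodL.car x (x + 1)) (elL (0 : NH (x + 1 + 1)) : bimodL.car (x + 1) _) = 0 := by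
      rw [elL_zero, wmk_zero]
    have e : ∀ c : NH (x + 1 + 1), tauL.toFun (wmk (elL 1 : bimodL.car x (x + 1))
        (elL c : bimodL.car (x + 1) _)) = wmk (elL 1) (elL (NH.T _ x * c)) := fun a => by
      rw [tauL_wmk, valL_elL, valL_elL, map_one, one_mul]
      rfl
    have e' : ∀ c : NH (x + 1 + 1), d (of (wmk (elL 1 : bimodL.car x (x + 1)) (elL c : bimodL.car (x + 1) _))) =
        map (fun c => wmk (elL 1) (elL c)) (d (of c)) := fun c => by
      rw [d_wmk, elL_one_d, map_zero, zero_add, d_elL, map_map elL (fun m => wmk _ m) elL_zero (wmk_zero _)]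
    rw [e, e', e', NH.leibniz, NH.d_T _ (by omega), map_of (fun a => a * c) (zero_mul _), one_mul, map_add,
      map_of _ z1, map_map _ _ z1 tauL.map_zero, map_map (fun c => _ * c) _ (mul_zero _) z1]
    simp only [e]

/-- `λ(a ∧ b) = a ∧ f_1(b)`, from `F_1 E_2` to `E_2 F_1`. On `(e^s, e^s)`, it maps `a ∧ b` with `a ∈ R^-(e^s, e^{s-1}, e) = H_s^•`
and `b ∈ L^+(e^{s-1}, e^s, e) = H_s^•` to `a ∧ f_1(b)` with `a ∈ L^+(e^s, e^{s+1}, e) = H_{s+1}^•` and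
`f_1(b) ∈ R^-(e^{s+1}, e^s, e) = H_{s+1}^•`. -/
def lamRL : BHom (wedge bimodR bimodL) (wedge bimodL bimodR) where
  toFun := fun {x y} w => wlift (fun t a b =>
      wmk (elL (NH.sh 0 x (x + 1) (valR a)) : bimodL.car x (x + 1))
        (elR (NH.sh 1 y (x + 1) (valL b)) : bimodR.car (x + 1) y))
    (fun _ _ => by simp [zero_wmk]) (fun _ _ => by simp [wmk_zero])
    (fun {t t'} m f n => by
      rcases catU.eq_or _ _ f with rfl | rfl
      · simp [bimodR.ract_zero, bimodL.zero_lact, wmk_zero, zero_wmk]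
      rcases R_cases m with rfl | rfl
      · simp [bimodR.zero_ract, zero_wmk]
      rcases L_cases n with rfl | rfl
      · simp [bimodL.lact_zero, wmk_zero]
      induction m using R_ind with | h a =>
      induction n using L_ind with | h b =>
      rw [ractR, lactL, valR_elR, valL_elL, valR_elR, valL_elL, map_mul, map_mul,
        NH.sh_sh _ _ _ _ _ (by omega), NH.sh_sh _ _ _ _ _ (by omega)]
      have := ractL (r := t + 1) (s := t + 1 + 1) (elU (NH.sh 1 t (t + 1 + 1) (catU.val f)))
        (NH.sh 0 (t + 1) (t + 1 + 1) a)
      rw [val_elU] at this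
      rw [← this, wmk_move, lactR, val_elU]) w
  map_zero := rfl
  map_lact f w := by
    rcases catU.eq_or _ _ f with rfl | rfl
    · rw [(wedge _ _).zero_lact, (wedge _ _).zero_lact]; rfl
    induction w using wedge_ind' with
    | h0 => rfl
    | h t m n hm hn =>
      obtain rfl := R_eq hm
      induction m using R_ind with | h a =>
      rw [lact_wmk, wlift_wmk, wlift_wmk, lact_wmk, lactR, lactL, valR_elR, valR_elR, map_mul]
  map_ract w f := by
    rcases catU.eq_or _ _ f with rfl | rfl
    · rw [(wedge _ _).ract_zero, (wedge _ _).ract_zero]; rfl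
    induction w using wedge_ind' with
    | h0 => rfl
    | h t m n hm hn =>
      obtain rfl := L_eq hn
      induction n using L_ind with | h b =>
      rw [wmk_ract, wlift_wmk, wlift_wmk, wmk_ract, ractL, ractR, valL_elL, valL_elL, map_mul]

theorem lamRL_wmk {x t y : ℕ} (a : bimodR.car x t) (b : bimodL.car t y) : lamRL.toFun (wmk a b) =
    wmk (elL (NH.sh 0 x (x + 1) (valR a)) : bimodL.car x (x + 1))
        (elR (NH.sh 1 y (x + 1) (valL b)) : bimodR.car (x + 1) y) := rfl

theorem lamRL_gr {x y : ℕ} {g : ℤ} {p : (wedge bimodR bimodL).car x y} (hp : p ∈ gr g) :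
    lamRL.toFun p ∈ gr (S := (wedge bimodL bimodR).car x y) g := by
  rcases wedge_gr.1 hp with rfl | ⟨p, q, t, m, n, h, hm, hn, rfl⟩
  · rw [lamRL.map_zero]; exact Or.inl rfl
  · rw [lamRL_wmk]
    exact wmk_gr (elL_gr (NH.sh_gr _ _ _ (valR_gr hm))) (elR_gr (NH.sh_gr _ _ _ (valL_gr hn))) h

theorem d_lamRL {x y : ℕ} (p : (wedge bimodR bimodL).car x y) :
    d (of (lamRL.toFun p)) = map lamRL.toFun (d (of p)) := by
  induction p using wedge_ind' with
  | h0 => rw [lamRL.map_zero]; simp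
  | h t m n hm hn =>
    obtain rfl := R_eq hm
    obtain rfl := L_eq hn
    induction m using R_ind with | h a =>
    induction n using L_ind with | h b =>
    have e : ∀ a b : NH (t + 1), lamRL.toFun (wmk (elR a : bimodR.car _ t) (elL b : bimodL.car t _)) =
        wmk (elL (NH.sh 0 (t + 1) (t + 1 + 1) a) : bimodL.car (t + 1) (t + 1 + 1))
        (elR (NH.sh 1 (t + 1) (t + 1 + 1) b)) := fun a b => by rw [lamRL_wmk, valR_elR, valL_elL]
    have z1 : ∀ b, lamRL.toFun (wmk (elR 0 : bimodR.car (t + 1) t) (elL b : bimodL.car t (t + 1))) = 0 :=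
      fun b => by rw [elR_zero, zero_wmk, lamRL.map_zero]
    have z2 : ∀ a, lamRL.toFun (wmk (elR a : bimodR.car (t + 1) t) (elL 0 : bimodL.car t (t + 1))) = 0 :=
      fun b => by rw [elL_zero, wmk_zero, lamRL.map_zero]
    rw [e, d_wmk, d_wmk, d_elL, d_elR, d_elR, d_elL, NH.d_sh _ _ _ (by omega), NH.d_sh _ _ _ (by omega),
      map_map elL (fun m => wmk m _) elL_zero (zero_wmk _), map_map elR (fun m => wmk _ m) elR_zero (wmk_zero _),
      map_map elR (fun m => wmk m _) elR_zero (zero_wmk _), map_map elL (fun m => wmk _ m) elL_zero (wmk_zero _),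
      map_add,
      map_map _ lamRL.toFun (by rw [elR_zero, zero_wmk]) lamRL.map_zero,
      map_map _ lamRL.toFun (by rw [elL_zero, wmk_zero]) lamRL.map_zero,
      map_map (NH.sh _ _ _) _ (NH.sh_zero _ _ _) (by rw [elL_zero, zero_wmk]),
      map_map (NH.sh _ _ _) _ (NH.sh_zero _ _ _) (by rw [elR_zero, wmk_zero])]
    simp only [e]

/-- The gluing datum `F_1 = R^-(-, -, e)`, `E_2 = L^+(-, -, e)`, `τ₁`, `τ₂`, `λ` on `𝒰^•`. -/
def glueU : GlueDatum catU where
  F := bimodR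
  E := bimodL
  tau₁ := tauR
  tau₁_gr := tauR_gr
  d_tau₁ := d_tauR
  tau₂ := tauL
  tau₂_gr := tauL_gr
  d_tau₂ := d_tauL
  lam := lamRL
  lam_gr := lamRL_gr
  d_lam := d_lamRL

/-- The diagonal category `Δ'_λ(𝒰^•)`. -/
def diagU : DPCat ℕ := glueU.diagonal

/-! ## Affine symmetric groups and the category `ℋ^+` -/

/-- The map `ℤ → ℤ` exchanging `r` and `r + 1` for all `r ∈ a + nℤ`, if `n ≥ 2` (and the identity if `n ≤ 1`). -/
def sFun (n : ℕ) (a r : ℤ) : ℤ :=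
  if n < 2 then r else if (n : ℤ) ∣ r - a then r + 1 else if (n : ℤ) ∣ r - (a + 1) then r - 1 else r

theorem sFun_invol (n : ℕ) (a : ℤ) : Function.Involutive (sFun n a) := by
  intro r
  by_cases hn : n < 2
  · simp [sFun, hn]
  have h1 : ¬ (n : ℤ) ∣ 1 := fun h => by have := Int.le_of_dvd one_pos h; omega
  by_cases ha : (n : ℤ) ∣ r - a
  · have h2 : ¬ (n : ℤ) ∣ r + 1 - a := fun h => h1 (by simpa using dvd_sub h ha)
    simp [sFun, hn, ha, h2]
  by_cases hb : (n : ℤ) ∣ r - (a + 1)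
  · have h2 : (n : ℤ) ∣ r - 1 - a := by rwa [sub_sub, add_comm]
    simp [sFun, hn, ha, hb, h2]
  · simp [sFun, hn, ha, hb]

/-- The simple reflection `s_a`, for `a ∈ ℤ/n` (a permutation of `ℤ`; it is the identity if `n ≤ 1`). -/
def simpleRefl (n : ℕ) (a : ℤ) : Equiv.Perm ℤ := (sFun_invol n a).toPerm

/-- The permutation `c : j ↦ j + 1` of `ℤ`. -/
def shiftPerm : Equiv.Perm ℤ := Equiv.addRight 1

/-- The product `s_{a_1} ⋯ s_{a_l} c^e`. -/
def expr (n : ℕ) (w : List ℤ) (e : ℤ) : Equiv.Perm ℤ := (w.map (simpleRefl n)).prod * shiftPerm ^ e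

/-- The length of an element `σ = s_{a_1} ⋯ s_{a_l} c^e` of the extended affine symmetric group: the smallest
possible `l`. -/
def ell (n : ℕ) (σ : Equiv.Perm ℤ) : ℕ := sInf {l | ∃ w e, w.length = l ∧ expr n w e = σ}

/-- The extended Chevalley–Bruhat order `σ' ≤ σ`: there is a reduced expression `σ = s_{a_1} ⋯ s_{a_l} c^e` such that
`σ'` is the product of a subexpression of `s_{a_1} ⋯ s_{a_l}` and of `c^e`. -/
def BruhatLE (n : ℕ) (σ' σ : Equiv.Perm ℤ) : Prop :=
  ∃ (w w' : List ℤ) (e : ℤ), expr n w e = σ ∧ w.length = ell n σ ∧ w'.Sublist w ∧ expr n w' e = σ'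

/-- The permutations `σ` in the positive monoid `Ŝ_n^+`: those with `σ(r + n) = σ(r) + n` for all `r`
and `σ(ℤ_{>0}) ⊆ ℤ_{>0}`. By convention, `Ŝ_0 = 1`. -/
def IsAffPos (n : ℕ) (σ : Equiv.Perm ℤ) : Prop :=
  (∀ r, σ (r + n) = σ r + n) ∧ (∀ r, 0 < r → 0 < σ r) ∧ (n = 0 → σ = 1)

/-- The set of non-zero elements of the positive affine nil Hecke monoid `Ŝ_n^{+,nil}`. -/
abbrev AffPos (n : ℕ) : Type := {σ : Equiv.Perm ℤ // IsAffPos n σ}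

/-- The positive affine nil Hecke monoid `Ŝ_n^{+,nil} = {0} ∪ {T_σ}`, for `σ ∈ Ŝ_n^+`. -/
def NilAff (n : ℕ) : Type := Option (AffPos n)

namespace NilAff

variable {n : ℕ}

instance : Zero (NilAff n) := ⟨none⟩

/-- The element `T_σ` (`0` if `σ` is not in `Ŝ_n^+`). -/
def T (n : ℕ) (σ : Equiv.Perm ℤ) : NilAff n := if h : IsAffPos n σ then some ⟨σ, h⟩ else none

/-- The unit `T_1`. -/
def one (n : ℕ) : NilAff n := T n 1

/-- `T_σ T_τ = T_{στ}` if `ℓ(στ) = ℓ(σ) + ℓ(τ)`, and `T_σ T_τ = 0` otherwise. -/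
def mul : NilAff n → NilAff n → NilAff n
  | some σ, some τ => if ell n (σ.1 * τ.1) = ell n σ.1 + ell n τ.1 then T n (σ.1 * τ.1) else none
  | _, _ => none

/-- `d(T_σ) = ∑ T_{σ'}`, the sum over `σ' < σ` with `ℓ(σ') = ℓ(σ) - 1`. -/
def dT : NilAff n → F2 (NilAff n)
  | some σ => ∑ᶠ τ ∈ {τ : AffPos n | BruhatLE n τ.1 σ.1 ∧ ell n τ.1 + 1 = ell n σ.1}, of (T n τ.1)
  | none => 0

instance : DGP (NilAff n) where
  gr g := {a | a = 0 ∨ ∃ σ : AffPos n, a = T n σ.1 ∧ -(ell n σ.1 : ℤ) = g}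
  d := F2.lift dT

end NilAff

/-- The category `ℋ^+`, with objects the integers `n ≥ 0`, with `End(n) = Ŝ_n^{+,nil}`, and with no non-zero maps between
different objects. -/
def catH : DPCat ℕ := diagCat NilAff NilAff.one fun _ a b => NilAff.mul a b

/-- The endomorphism of `n` in `ℋ^+` given by an element of `Ŝ_n^{+,nil}`. -/
def elH {n : ℕ} (a : NilAff n) : catH.mor n n := Diag.mk (n = n) a

/-- The element of `Ŝ_n^{+,nil}` underlying an endomorphism of `n` in `ℋ^+`. -/
def valH {n : ℕ} (a : catH.mor n n) : NilAff n := Diag.val a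

/-- The endomorphism of `e^s` in `Δ'_λ(𝒰^•)` given by `a ∈ H_s^•`. -/
def inH (s : ℕ) (a : NH s) : diagU.mor s s :=
  qmk _ _ (incl (wedge bimodR bimodL) 0 (elU a : (pow (wedge bimodR bimodL) s 0).car s))

/-- The endomorphism of `e^s` in `Δ'_λ(𝒰^•)` given by `a ∧ b ∈ R^-(e^s, e^{s-1}, e) ∧ L^+(e^{s-1}, e^s, e)`,
for `a, b ∈ H_s^•` (and `0` if `s = 0`). -/
def inM (s : ℕ) (a b : NH s) : diagU.mor s s :=
  qmk _ _ (incl (wedge bimodR bimodL) 1 (powCons (wedge bimodR bimodL)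
    (wmk (elR a : bimodR.car s (s - 1)) (elL b : bimodL.car (s - 1) s)) 0 (powOne _ s)))

/-! ## The differential graded algebra `T_{H_s}(M_s)/(κ)` -/

/-- The bilinear extension of a product of pointed sets. -/
def F2.bil {S T U : Type} [Zero S] [Zero T] [Zero U] (m : S → T → U) :
    F2 S →ₗ[ZMod 2] F2 T →ₗ[ZMod 2] F2 U :=
  F2.lift fun s => F2.map (m s)

/-- The nil Hecke algebra `H_n = 𝔽₂[H_n^•]` (a differential graded algebra over `𝔽₂`). -/
abbrev HA (n : ℕ) : Type := F2 (NH n)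

/-- The product of `H_n`. -/
def mulH {n : ℕ} : HA n →ₗ[ZMod 2] HA n →ₗ[ZMod 2] HA n := F2.bil fun a b => a * b

/-- The product of the algebra `Ĥ_n^+ = 𝔽₂[Ŝ_n^{+,nil}]`. -/
def mulA {n : ℕ} : F2 (NilAff n) →ₗ[ZMod 2] F2 (NilAff n) →ₗ[ZMod 2] F2 (NilAff n) := F2.bil NilAff.mul

section BalancedTensor

variable {A B K : Type} [AddCommGroup A] [Module (ZMod 2) A] [AddCommGroup B] [Module (ZMod 2) B]
    (p : Prop) (r : A → K → A) (l : K → B → B)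

/-- The subspace of `A ⊗ B` spanned by the elements `a h ⊗ b - a ⊗ h b` (and the whole space if `p` does not hold). -/
def balSub : Submodule (ZMod 2) (TensorProduct (ZMod 2) A B) :=
  Submodule.span (ZMod 2) {t | ¬p ∨ ∃ (a : A) (h : K) (b : B),
    t = TensorProduct.tmul (ZMod 2) (r a h) b - TensorProduct.tmul (ZMod 2) a (l h b)}

/-- The tensor product `A ⊗_K B`, where `K` acts on the right on `A` by `r` and on the left on `B` by `l`
(and `0` if `p` does not hold). -/
def BalTensor : Type := TensorProduct (ZMod 2) A B ⧸ balSub p r l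

instance : AddCommGroup (BalTensor p r l) :=
  inferInstanceAs (AddCommGroup (TensorProduct (ZMod 2) A B ⧸ balSub p r l))

instance : Module (ZMod 2) (BalTensor p r l) :=
  inferInstanceAs (Module (ZMod 2) (TensorProduct (ZMod 2) A B ⧸ balSub p r l))

/-- The element `a ⊗ b`. -/
def BalTensor.mk (a : A) (b : B) : BalTensor p r l := (balSub p r l).mkQ (TensorProduct.tmul (ZMod 2) a b)

end BalancedTensor

/-- The bimodule `M_s = H_s ⊗_{H_{s-1}} H_s` if `s ≥ 1`, where `h ∈ H_{s-1}` acts on the right on the first factor by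
right multiplication by `f_1(h)`, and on the left on the second factor by left multiplication. By convention, `M_0 = 0`. -/
abbrev MM (s : ℕ) : Type :=
  BalTensor (A := HA s) (B := HA s) (K := HA (s - 1)) (s ≠ 0) (fun a h => mulH a (F2.map (NH.sh 1 (s - 1) s) h))
    (fun h b => mulH (F2.map (NH.sh 0 (s - 1) s) h) b)

/-- The element `a ⊗ b` of `M_s`. -/
def tens {s : ℕ} (a b : HA s) : MM s := BalTensor.mk _ _ _ a b

/-- The defining relations of `T_{H_s}(M_s)/(κ)`: the structure map of `H_s` is a morphism of algebras, that of `M_s` is a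
morphism of `(H_s, H_s)`-bimodules, and `κ = (1 ⊗ 1) ⊗ (1 ⊗ T_{s-1}) - (T_1 ⊗ 1) ⊗ (1 ⊗ 1)` vanishes if `s ≥ 2`. -/
inductive TRel (s : ℕ) : FreeAlgebra (ZMod 2) (HA s ⊕ MM s) → FreeAlgebra (ZMod 2) (HA s ⊕ MM s) → Prop
  | addH (h h' : HA s) : TRel s (FreeAlgebra.ι (ZMod 2) (Sum.inl (h + h')))
      (FreeAlgebra.ι (ZMod 2) (Sum.inl h) + FreeAlgebra.ι (ZMod 2) (Sum.inl h'))
  | oneH : TRel s (FreeAlgebra.ι (ZMod 2) (Sum.inl (of 1))) 1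
  | mulH (h h' : HA s) : TRel s (FreeAlgebra.ι (ZMod 2) (Sum.inl (mulH h h')))
      (FreeAlgebra.ι (ZMod 2) (Sum.inl h) * FreeAlgebra.ι (ZMod 2) (Sum.inl h'))
  | addM (m m' : MM s) : TRel s (FreeAlgebra.ι (ZMod 2) (Sum.inr (m + m')))
      (FreeAlgebra.ι (ZMod 2) (Sum.inr m) + FreeAlgebra.ι (ZMod 2) (Sum.inr m'))
  | left (h a b : HA s) : TRel s (FreeAlgebra.ι (ZMod 2) (Sum.inr (tens (NilGlue.mulH h a) b)))
      (FreeAlgebra.ι (ZMod 2) (Sum.inl h) * FreeAlgebra.ι (ZMod 2) (Sum.inr (tens a b)))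
  | right (a b h : HA s) : TRel s (FreeAlgebra.ι (ZMod 2) (Sum.inr (tens a (NilGlue.mulH b h))))
      (FreeAlgebra.ι (ZMod 2) (Sum.inr (tens a b)) * FreeAlgebra.ι (ZMod 2) (Sum.inl h))
  | kappa (hs : 2 ≤ s) : TRel s
      (FreeAlgebra.ι (ZMod 2) (Sum.inr (tens (of 1) (of 1))) *
        FreeAlgebra.ι (ZMod 2) (Sum.inr (tens (of 1) (of (NH.T s (s - 2))))))
      (FreeAlgebra.ι (ZMod 2) (Sum.inr (tens (of (NH.T s 0)) (of 1))) *
        FreeAlgebra.ι (ZMod 2) (Sum.inr (tens (of 1) (of 1))))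

/-- The algebra `T_{H_s}(M_s)/(κ)`. -/
abbrev TA (s : ℕ) : Type := RingQuot (TRel s)

/-- The structure map `H_s → T_{H_s}(M_s)/(κ)`. -/
def iH {s : ℕ} (h : HA s) : TA s := RingQuot.mkAlgHom (ZMod 2) (TRel s) (FreeAlgebra.ι (ZMod 2) (Sum.inl h))

/-- The structure map `M_s → T_{H_s}(M_s)/(κ)`. -/
def iM {s : ℕ} (m : MM s) : TA s := RingQuot.mkAlgHom (ZMod 2) (TRel s) (FreeAlgebra.ι (ZMod 2) (Sum.inr m))

/-- The products of homogeneous elements of `H_s` and of elements `a ⊗ b ∈ M_s` with `a` and `b` homogeneous. -/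
inductive Homog (s : ℕ) : ℤ → TA s → Prop
  | one : Homog s 0 1
  | mulH {p q : ℤ} {h : HA s} {x : TA s} (hh : h ∈ F2.on (gr (S := NH s) p)) (hx : Homog s q x) :
    Homog s (p + q) (iH h * x)
  | mulM {p q r : ℤ} {a b : HA s} {x : TA s} (ha : a ∈ F2.on (gr (S := NH s) p))
    (hb : b ∈ F2.on (gr (S := NH s) q)) (hx : Homog s r x) : Homog s (p + q + r) (iM (tens a b) * x)

/-- The homogeneous component of degree `g` of `T_{H_s}(M_s)/(κ)`. -/
def grT (s : ℕ) (g : ℤ) : Submodule (ZMod 2) (TA s) := Submodule.span (ZMod 2) {x | Homog s g x}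

end NilGlue
end
end

section
open scoped Classical
noncomputable section
namespace NilGlue
open DGP F2

/-! ## Permutations commuting with a translation, and their reflections -/

/-! All objects are compared through one presentation. The pointed monoid `Ŝ_s^{+,nil}` is generated
by `T_{s_1}, …, T_{s_{s-1}}` and `T_c`, subject to the nil Hecke relations, to `T_{s_{i+1}} c = c
T_{s_i}` and to `T_{s_1} c² = c² T_{s_{s-1}}` (`NilRel`, with indices lowered by one, and with `c =
0` when `s = 0`). The middle family says that `a c b` is balanced over `H_{s-1}`, so it is built
into both `F_1 E_2` and `M_s`. The last relation is `κ`, and it is also the gluing relation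
evaluated at `1 ∧ 1 ∧ 1 ∧ 1`. Hence `T_{H_s}(M_s)/(κ)` and `End(e^s)` satisfy the same relations
(`TA.nilRel`, `EndU.nilRel`).

The presentation is proved by rewriting. A positive permutation other than `1` has a descent inside
the window `1, …, n` or satisfies `0 < σ 0`; it can then be divided on the right by a simple
reflection or by `c`, and this terminates (`IsAffPos.induction`). Two different divisions can be
completed to a common one, using exactly one defining relation (`diamond_simple`, `diamond_shift`).
By Newman's argument the value of a word obtained in this way depends on `σ` only (`Val.unique`),
which gives the universal property `NilAff.lift`.

The differential is controlled by the strong exchange property (`exchange`): the elements just below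
`σ` are the one-letter deletions of any fixed reduced expression (`bruhatLE_iff`, `d_T_expr`). This
gives the Leibniz rule, with `d(T_{s_i}) = 1` and `d(T_c) = 0` (`NilAff.leibniz`). Boundedness holds
because a reflection that is far away both in positions and in values lowers the length by at least
three (`ell_refl_far`), so only about `2n²` reflections can contribute.

It remains to construct maps both ways on generators and to check that they are inverse to each
other and compatible with degrees and differentials, again on generators. The differential of
`T_{H_s}(M_s)/(κ)` and the axioms for the diagonal category are transported along these
isomorphisms. -/

/-- The permutations of `ℤ` that commute with the translation by `n`. -/
def IsAff (n : ℕ) (σ : Equiv.Perm ℤ) : Prop := ∀ r, σ (r + n) = σ r + n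

namespace IsAff

variable {n : ℕ} {σ τ : Equiv.Perm ℤ}

theorem add_mul (h : IsAff n σ) (r k : ℤ) : σ (r + n * k) = σ r + n * k := by
  induction k using Int.induction_on with
  | zero => simp
  | succ k ih => rw [mul_add, mul_one, ← add_assoc, h, ih, add_assoc]
  | pred k ih =>
    have := h (r + n * (-k - 1))
    rw [show r + (n : ℤ) * (-k - 1) + n = r + n * -k by ring, ih] at this
    linarith

theorem sub (h : IsAff n σ) (r : ℤ) : σ (r - n) = σ r - n := by
  have := h.add_mul r (-1)
  simpa [sub_eq_add_neg] using this

theorem apply_of_dvd (h : IsAff n σ) {p q : ℤ} (hd : (n : ℤ) ∣ p - q) : σ p = σ q + (p - q) := by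
  obtain ⟨k, hk⟩ := hd
  rw [hk, ← h.add_mul, ← hk]
  congr 1
  ring

theorem one : IsAff n 1 := fun _ => rfl

theorem mul (h : IsAff n σ) (h' : IsAff n τ) : IsAff n (σ * τ) := fun r => by
  simp only [Equiv.Perm.mul_apply, h' r, h (τ r)]

theorem inv (h : IsAff n σ) : IsAff n σ⁻¹ := fun r => by
  rw [Equiv.Perm.inv_eq_iff_eq, h]
  simp

theorem dvd_iff (h : IsAff n σ) (p q : ℤ) : (n : ℤ) ∣ σ p - σ q ↔ (n : ℤ) ∣ p - q := by
  have key : ∀ {σ : Equiv.Perm ℤ}, IsAff n σ → ∀ p q, (n : ℤ) ∣ p - q → (n : ℤ) ∣ σ p - σ q :=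
    fun h p q hd => by rw [h.apply_of_dvd hd]; simpa using hd
  refine ⟨fun hd => ?_, key h p q⟩
  simpa using key h.inv _ _ hd

theorem shift : IsAff n shiftPerm := fun r => by simp [shiftPerm]; ring

theorem shift_zpow (e : ℤ) : IsAff n (shiftPerm ^ e) := by
  induction e using Int.induction_on with
  | zero => exact one
  | succ k ih => rw [zpow_add_one]; exact ih.mul shift
  | pred k ih => rw [zpow_sub_one]; exact ih.mul shift.inv

end IsAff

@[simp] theorem shiftPerm_apply (r : ℤ) : shiftPerm r = r + 1 := rfl

@[simp] theorem shiftPerm_inv_apply (r : ℤ) : shiftPerm⁻¹ r = r - 1 := by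
  rw [Equiv.Perm.inv_eq_iff_eq]; simp

@[simp] theorem shiftPerm_symm_apply (r : ℤ) : shiftPerm.symm r = r - 1 := shiftPerm_inv_apply r

theorem shiftPerm_zpow_apply (e r : ℤ) : (shiftPerm ^ e) r = r + e := by
  induction e using Int.induction_on generalizing r with
  | zero => simp
  | succ k ih => rw [zpow_add_one, Equiv.Perm.mul_apply, ih]; simp; ring
  | pred k ih => rw [zpow_sub_one, Equiv.Perm.mul_apply, ih]; simp; ring

/-- The map exchanging `p + kn` and `q + kn` for all `k` (and the identity if `p` and `q` are congruent modulo `n`). -/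
def reflFun (n : ℕ) (p q r : ℤ) : ℤ :=
  if (n : ℤ) ∣ p - q then r else if (n : ℤ) ∣ r - p then r + (q - p)
    else if (n : ℤ) ∣ r - q then r - (q - p) else r

theorem reflFun_invol (n : ℕ) (p q : ℤ) : Function.Involutive (reflFun n p q) := by
  intro r
  by_cases h : (n : ℤ) ∣ p - q
  · simp [reflFun, h]
  by_cases hp : (n : ℤ) ∣ r - p
  · have h1 : ¬ (n : ℤ) ∣ r + (q - p) - p := fun h1 => h (by
      have := dvd_sub hp h1; rwa [show r - p - (r + (q - p) - p) = p - q by ring] at this)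
    have h2 : (n : ℤ) ∣ r + (q - p) - q := by rwa [show r + (q - p) - q = r - p by ring]
    simp [reflFun, h, hp, h1, h2]
  by_cases hq : (n : ℤ) ∣ r - q
  · have h2 : (n : ℤ) ∣ r - (q - p) - p := by rwa [show r - (q - p) - p = r - q by ring]
    simp [reflFun, h, hp, hq, h2]
  · simp [reflFun, h, hp, hq]

/-- The reflection exchanging `p + kn` and `q + kn` for all `k`. -/
def refl (n : ℕ) (p q : ℤ) : Equiv.Perm ℤ := (reflFun_invol n p q).toPerm

variable {n : ℕ} {σ τ : Equiv.Perm ℤ}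

theorem refl_apply (n : ℕ) (p q r : ℤ) : refl n p q r = reflFun n p q r := rfl

@[simp] theorem refl_mul_self (n : ℕ) (p q : ℤ) : refl n p q * refl n p q = 1 :=
  Equiv.ext fun r => reflFun_invol n p q r

theorem refl_left (p q : ℤ) (h : ¬ (n : ℤ) ∣ p - q) : refl n p q p = q := by
  simp [refl_apply, reflFun, h]

theorem refl_comm (n : ℕ) (p q : ℤ) : refl n p q = refl n q p := by
  ext r
  have h : (n : ℤ) ∣ q - p ↔ (n : ℤ) ∣ p - q := dvd_sub_comm
  simp only [refl_apply, reflFun, h]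
  split_ifs with h1 h2 h3 h4
  · rfl
  · exact absurd (by have := dvd_sub h3 h2; rwa [show r - q - (r - p) = p - q by ring] at this) h1
  · ring
  · ring
  · rfl

theorem refl_right (p q : ℤ) (h : ¬ (n : ℤ) ∣ p - q) : refl n p q q = p := by
  rw [refl_comm, refl_left _ _ (by rwa [dvd_sub_comm])]

/-- Only the residue classes of the two points and their difference matter, and these survive a
common translation by a multiple of `n`. Thus `s_{n-1}` and `s_{-1}`, or `s_1` and `s_{n+1}`, are
the same permutation. -/
theorem refl_of_dvd_sub (p q r : ℤ) (h : (n : ℤ) ∣ r) : refl n (p + r) (q + r) = refl n p q := by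
  ext x
  have e : ∀ p : ℤ, (n : ℤ) ∣ x - (p + r) ↔ (n : ℤ) ∣ x - p := fun p => by
    rw [show x - (p + r) = x - p - r by ring]; exact dvd_sub_left h
  simp only [refl_apply, reflFun, e, add_sub_add_right_eq_sub]

/-- Conjugation by `σ` carries the exchange of two classes to the exchange of their images. The
braid and commutation relations, and the passage of `c` across reflections, are instances. -/
theorem IsAff.mul_refl (h : IsAff n σ) (p q : ℤ) : σ * refl n p q = refl n (σ p) (σ q) * σ := by
  ext r
  simp only [Equiv.Perm.mul_apply, refl_apply, reflFun, h.dvd_iff]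
  split_ifs with h1 h2 h3
  · rfl
  · rw [h.apply_of_dvd h2, h.apply_of_dvd (p := r + (q - p)) (q := q) (by convert h2 using 1; ring)]
    ring
  · rw [h.apply_of_dvd h3, h.apply_of_dvd (p := r - (q - p)) (q := p) (by convert h3 using 1; ring)]
    ring
  · rfl

theorem IsAff.refl (n : ℕ) (p q : ℤ) : IsAff n (NilGlue.refl n p q) := fun r => by
  have e : ∀ p : ℤ, (n : ℤ) ∣ r + n - p ↔ (n : ℤ) ∣ r - p := fun p => by
    rw [show r + n - p = r - p + n by ring]; exact dvd_add_self_right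
  simp only [refl_apply, reflFun, e]
  split_ifs <;> ring

theorem not_dvd_one (hn : 2 ≤ n) : ¬ (n : ℤ) ∣ 1 := fun h => by
  have := Int.le_of_dvd one_pos h; omega

theorem simpleRefl_eq_refl (hn : 2 ≤ n) (a : ℤ) : simpleRefl n a = refl n a (a + 1) := by
  ext r
  have h1 : ¬ (n : ℤ) ∣ a - (a + 1) := by simpa using not_dvd_one hn
  change sFun n a r = _
  simp only [refl_apply, reflFun, sFun, h1, not_lt.2 hn, if_false]
  simp

theorem simpleRefl_of_lt (hn : n < 2) (a : ℤ) : simpleRefl n a = 1 := by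
  ext r
  change sFun n a r = r
  simp [sFun, hn]

@[simp] theorem simpleRefl_mul_self (n : ℕ) (a : ℤ) : simpleRefl n a * simpleRefl n a = 1 :=
  Equiv.ext fun r => sFun_invol n a r

@[simp] theorem mul_simpleRefl_mul (n : ℕ) (a : ℤ) (σ : Equiv.Perm ℤ) :
    σ * simpleRefl n a * simpleRefl n a = σ := by
  rw [mul_assoc, simpleRefl_mul_self, mul_one]

theorem IsAff.simpleRefl (n : ℕ) (a : ℤ) : IsAff n (simpleRefl n a) := by
  by_cases hn : n < 2
  · rw [simpleRefl_of_lt hn]; exact one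
  · rw [simpleRefl_eq_refl (not_lt.1 hn)]; exact IsAff.refl _ _ _

theorem IsAff.mul_simpleRefl_of_sub_eq (h : IsAff n σ) {a b : ℤ} (h1 : σ a = b) (h2 : σ (a + 1) = b + 1) :
    σ * NilGlue.simpleRefl n a = NilGlue.simpleRefl n b * σ := by
  by_cases hn : n < 2
  · rw [simpleRefl_of_lt hn, simpleRefl_of_lt hn, mul_one, one_mul]
  · rw [simpleRefl_eq_refl (not_lt.1 hn), simpleRefl_eq_refl (not_lt.1 hn), h.mul_refl, h1, h2]

theorem shiftPerm_zpow_mul_simpleRefl (n : ℕ) (e a : ℤ) :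
    shiftPerm ^ e * simpleRefl n a = simpleRefl n (a + e) * shiftPerm ^ e :=
  (IsAff.shift_zpow e).mul_simpleRefl_of_sub_eq (shiftPerm_zpow_apply e a)
    (by rw [shiftPerm_zpow_apply]; ring)

theorem simpleRefl_apply_le (n : ℕ) (a r : ℤ) : simpleRefl n a r ≤ r + 1 ∧ r - 1 ≤ simpleRefl n a r := by
  change sFun n a r ≤ _ ∧ _ ≤ sFun n a r
  unfold sFun
  split_ifs <;> constructor <;> linarith

/-- A simple reflection only changes the order of neighbours. -/
theorem IsAff.simpleRefl_mul_of_flip (h : IsAff n σ) {a p q : ℤ} (h1 : σ p < σ q)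
    (h2 : NilGlue.simpleRefl n a (σ q) < NilGlue.simpleRefl n a (σ p)) :
    σ q = σ p + 1 ∧ NilGlue.simpleRefl n a * σ = σ * NilGlue.refl n p q := by
  have hn : 2 ≤ n := by
    by_contra hn
    rw [simpleRefl_of_lt (by omega)] at h2
    exact absurd h1 h2.not_gt
  -- A simple reflection moves each integer by at most `1`, so two values that it reverses are
  -- consecutive.
  have e : σ q = σ p + 1 := by
    have := simpleRefl_apply_le n a (σ p)
    have := simpleRefl_apply_le n a (σ q)
    omega
  refine ⟨e, ?_⟩
  rw [h.mul_refl, e, simpleRefl_eq_refl hn]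
  congr 1
  -- Consecutive values are reversed only when they form an exchanged pair, that is when `σ p ≡ a`;
  -- in any other position their order survives.
  have hd : (n : ℤ) ∣ σ p - a := by
    by_contra hd
    rw [e] at h2
    change sFun n a (σ p + 1) < sFun n a (σ p) at h2
    simp only [sFun, not_lt.2 hn, hd, if_false, add_sub_add_right_eq_sub] at h2
    split_ifs at h2 <;> linarith
  have := refl_of_dvd_sub a (a + 1) (σ p - a) hd
  rw [← this]
  congr 1 <;> ring

/-! ## Expressions and lengths -/

theorem expr_nil (n : ℕ) (e : ℤ) : expr n [] e = shiftPerm ^ e := by simp [expr]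

theorem expr_cons (n : ℕ) (a : ℤ) (w : List ℤ) (e : ℤ) : expr n (a :: w) e = simpleRefl n a * expr n w e := by
  simp [expr, mul_assoc]

theorem expr_append (n : ℕ) (u w : List ℤ) (e : ℤ) : expr n (u ++ w) e = expr n u 0 * expr n w e := by
  simp [expr, mul_assoc]

theorem IsAff.expr (n : ℕ) (w : List ℤ) (e : ℤ) : IsAff n (expr n w e) := by
  induction w with
  | nil => rw [expr_nil]; exact shift_zpow e
  | cons a w ih => rw [expr_cons]; exact (IsAff.simpleRefl n a).mul ih

/-- Each crossing uses `c^e s_a = s_{a+e} c^e`. This is why products of expressions are again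
expressions. -/
theorem zpow_mul_expr (n : ℕ) (e e' : ℤ) (w : List ℤ) :
    shiftPerm ^ e * expr n w e' = expr n (w.map (· + e)) (e + e') := by
  induction w with
  | nil => rw [List.map_nil, expr_nil, expr_nil, zpow_add]
  | cons a w ih =>
    rw [List.map_cons, expr_cons, expr_cons, ← mul_assoc, shiftPerm_zpow_mul_simpleRefl, mul_assoc, ih]

theorem expr_mul_expr (n : ℕ) (w w' : List ℤ) (e e' : ℤ) :
    expr n w e * expr n w' e' = expr n (w ++ w'.map (· + e)) (e + e') := by
  rw [expr_append, ← zpow_mul_expr, ← mul_assoc]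
  simp [expr]

theorem expr_mul_simpleRefl (n : ℕ) (w : List ℤ) (e a : ℤ) :
    expr n w e * simpleRefl n a = expr n (w ++ [a + e]) e := by
  have := expr_mul_expr n w [a] e 0
  simpa [expr_cons, expr_nil] using this

theorem expr_mul_shiftPerm (n : ℕ) (w : List ℤ) (e : ℤ) : expr n w e * shiftPerm = expr n w (e + 1) := by
  rw [expr, expr, mul_assoc, ← zpow_add_one]

/-- The strong exchange property. -/
theorem exchange (w : List ℤ) (e : ℤ) {p q : ℤ} (hpq : p < q) (h : expr n w e q < expr n w e p) :
    ∃ k < w.length, expr n (w.eraseIdx k) e = expr n w e * refl n p q := by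
  induction w with
  | nil =>
    -- A power of `c` is increasing, so it has no inversion.
    rw [expr_nil, shiftPerm_zpow_apply, shiftPerm_zpow_apply] at h
    omega
  | cons a w ih =>
    -- Either the tail of the word already inverts `p` and `q`, and the letter to delete lies in the
    -- tail, or the leading letter creates the inversion.
    by_cases h' : expr n w e q < expr n w e p
    · obtain ⟨k, hk, hw⟩ := ih h'
      exact ⟨k + 1, by simpa using hk, by rw [List.eraseIdx_cons_succ, expr_cons, hw, expr_cons, mul_assoc]⟩
    · have hlt : expr n w e p < expr n w e q :=
        lt_of_le_of_ne (not_lt.1 h') fun h0 => hpq.ne ((expr n w e).injective h0)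
      rw [expr_cons] at h
      -- With `x` the tail, `s_a x = x · refl n p q`, so the reflection cancels the leading letter.
      refine ⟨0, by simp, ?_⟩
      rw [List.eraseIdx_cons_zero, expr_cons, ((IsAff.expr n w e).simpleRefl_mul_of_flip hlt h).2, mul_assoc,
        refl_mul_self, mul_one]

/-- `σ` has an expression `s_{a_1} ⋯ s_{a_l} c^e`. -/
def IsExpr (n : ℕ) (σ : Equiv.Perm ℤ) : Prop := ∃ w e, expr n w e = σ

theorem isExpr_expr (n : ℕ) (w : List ℤ) (e : ℤ) : IsExpr n (expr n w e) := ⟨w, e, rfl⟩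

theorem ell_expr_le (n : ℕ) (w : List ℤ) (e : ℤ) : ell n (expr n w e) ≤ w.length :=
  Nat.sInf_le ⟨w, e, rfl, rfl⟩

namespace IsExpr

/-- The length is an infimum of natural numbers, with default value `0` on a permutation without any
expression. This is why the lemmas on lengths carry `IsExpr`. -/
theorem exists_reduced (h : IsExpr n σ) : ∃ w e, expr n w e = σ ∧ w.length = ell n σ := by
  obtain ⟨w, e, hw⟩ := h
  obtain ⟨w, e, h1, h2⟩ := Nat.sInf_mem (s := {l | ∃ w e, w.length = l ∧ expr n w e = σ}) ⟨_, w, e, rfl, hw⟩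
  exact ⟨w, e, h2, h1⟩

theorem one : IsExpr n 1 := ⟨[], 0, by simp [expr_nil]⟩

theorem shift : IsExpr n shiftPerm := ⟨[], 1, by simp [expr_nil]⟩

theorem shift_inv : IsExpr n shiftPerm⁻¹ := ⟨[], -1, by simp [expr_nil]⟩

theorem simpleRefl (n : ℕ) (a : ℤ) : IsExpr n (simpleRefl n a) := ⟨[a], 0, by simp [expr_nil, expr_cons]⟩

theorem mul (h : IsExpr n σ) (h' : IsExpr n τ) : IsExpr n (σ * τ) := by
  obtain ⟨w, e, rfl⟩ := h
  obtain ⟨w', e', rfl⟩ := h'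
  exact ⟨_, _, (expr_mul_expr n w w' e e').symm⟩

theorem ell_mul_le (h : IsExpr n σ) (h' : IsExpr n τ) : ell n (σ * τ) ≤ ell n σ + ell n τ := by
  obtain ⟨w, e, rfl, hw⟩ := h.exists_reduced
  obtain ⟨w', e', rfl, hw'⟩ := h'.exists_reduced
  rw [← hw, ← hw', expr_mul_expr]
  refine (ell_expr_le _ _ _).trans ?_
  simp

/-- The exchange property deletes one letter from a reduced expression. The variation of the length
under reflections is always deduced from this. -/
theorem refl_lt (h : IsExpr n σ) {p q : ℤ} (hpq : p < q) (hlt : σ q < σ p) :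
    IsExpr n (σ * refl n p q) ∧ ell n (σ * refl n p q) < ell n σ := by
  obtain ⟨w, e, rfl, hw⟩ := h.exists_reduced
  obtain ⟨k, hk, he⟩ := exchange w e hpq hlt
  rw [← he]
  refine ⟨isExpr_expr _ _ _, (ell_expr_le _ _ _).trans_lt ?_⟩
  rw [← hw, List.length_eraseIdx_of_lt hk]
  omega

end IsExpr

@[simp] theorem ell_one (n : ℕ) : ell n 1 = 0 := by
  have := ell_expr_le n [] 0
  simpa [expr_nil] using this

@[simp] theorem ell_shiftPerm (n : ℕ) : ell n shiftPerm = 0 := by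
  have := ell_expr_le n [] 1
  simpa [expr_nil] using this

theorem ell_simpleRefl_le (n : ℕ) (a : ℤ) : ell n (simpleRefl n a) ≤ 1 := by
  have := ell_expr_le n [a] 0
  simpa [expr_nil, expr_cons] using this

/-- `c` and its inverse have length `0`, so subadditivity gives both inequalities. -/
theorem IsExpr.ell_mul_shiftPerm (h : IsExpr n σ) : ell n (σ * shiftPerm) = ell n σ := by
  have hi : ell n shiftPerm⁻¹ = 0 := by
    have := ell_expr_le n [] (-1)
    simpa [expr_nil] using this
  have h1 := h.ell_mul_le (n := n) .shift
  have h2 := (h.mul .shift).ell_mul_le .shift_inv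
  rw [mul_inv_cancel_right, hi] at h2
  rw [ell_shiftPerm] at h1
  omega

/-- The descent makes the length fall strictly, and subadditivity with `ℓ(s_a) ≤ 1` prevents a fall
by more than one. -/
theorem IsExpr.ell_mul_simpleRefl_of_gt (hn : 2 ≤ n) (h : IsExpr n σ) {a : ℤ} (ha : σ (a + 1) < σ a) :
    ell n (σ * NilGlue.simpleRefl n a) + 1 = ell n σ := by
  have h1 := (h.refl_lt (lt_add_one a) ha).2
  rw [← simpleRefl_eq_refl hn] at h1
  have h2 := (h.mul (.simpleRefl n a)).ell_mul_le (.simpleRefl n a)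
  have h3 := ell_simpleRefl_le n a
  rw [mul_simpleRefl_mul] at h2
  omega

theorem simpleRefl_self (hn : 2 ≤ n) (a : ℤ) : simpleRefl n a a = a + 1 := by
  rw [simpleRefl_eq_refl hn, refl_left _ _ (by simpa using not_dvd_one hn)]

theorem simpleRefl_succ (hn : 2 ≤ n) (a : ℤ) : simpleRefl n a (a + 1) = a := by
  rw [simpleRefl_eq_refl hn, refl_right _ _ (by simpa using not_dvd_one hn)]

theorem simpleRefl_of_ne {a r : ℤ} (h1 : ¬ (n : ℤ) ∣ r - a) (h2 : ¬ (n : ℤ) ∣ r - (a + 1)) :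
    simpleRefl n a r = r := by
  change sFun n a r = r
  simp [sFun, h1, h2]

/-- This is the descent case for `σ s_a`, where `a` has become a descent. -/
theorem IsExpr.ell_mul_simpleRefl_of_lt (hn : 2 ≤ n) (h : IsExpr n σ) {a : ℤ} (ha : σ a < σ (a + 1)) :
    ell n (σ * NilGlue.simpleRefl n a) = ell n σ + 1 := by
  have := (h.mul (.simpleRefl n a)).ell_mul_simpleRefl_of_gt hn (a := a) (by
    simpa [simpleRefl_self hn, simpleRefl_succ hn] using ha)
  rw [mul_simpleRefl_mul] at this
  exact this.symm

theorem ell_simpleRefl (hn : 2 ≤ n) (a : ℤ) : ell n (simpleRefl n a) = 1 := by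
  have := IsExpr.one.ell_mul_simpleRefl_of_lt hn (a := a) (by simp)
  simpa using this

theorem perm_lt_or_gt (σ : Equiv.Perm ℤ) {a b : ℤ} (h : a ≠ b) : σ a < σ b ∨ σ b < σ a :=
  lt_or_gt_of_ne fun h' => h (σ.injective h')

/-! ## The positive monoid: generation -/

/-- At distance less than `n`, a congruence is an equality. Values of simple reflections at explicit
points reduce in this way to linear arithmetic. -/
theorem simpleRefl_window {n : ℕ} {a r : ℤ} (h1 : |r - a| < n) (h2 : |r - (a + 1)| < n) (h3 : r ≠ a) (h4 : r ≠ a + 1) :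
    simpleRefl n a r = r :=
  simpleRefl_of_ne (fun h => h3 (by have := Int.eq_zero_of_abs_lt_dvd h h1; omega))
    (fun h => h4 (by have := Int.eq_zero_of_abs_lt_dvd h h2; omega))

namespace IsAffPos

variable {n : ℕ} {σ τ : Equiv.Perm ℤ}

theorem isAff (h : IsAffPos n σ) : IsAff n σ := h.1

theorem one (n : ℕ) : IsAffPos n 1 := ⟨fun _ => rfl, fun _ h => h, fun _ => rfl⟩

theorem mul (h : IsAffPos n σ) (h' : IsAffPos n τ) : IsAffPos n (σ * τ) :=
  ⟨h.isAff.mul h'.isAff, fun r hr => h.2.1 _ (h'.2.1 r hr), fun hn => by rw [h.2.2 hn, h'.2.2 hn, mul_one]⟩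

/-- The only positive integer that could leave the positive ones is `1`, and only `s_0` sends it to
`0`; the indices `1, …, n-1` avoid that class. -/
theorem simpleRefl {i : ℕ} (hi : i + 1 < n) : IsAffPos n (simpleRefl n ((i : ℤ) + 1)) := by
  refine ⟨IsAff.simpleRefl n _, fun r hr => ?_, fun hn => by omega⟩
  change 0 < sFun n _ r
  unfold sFun
  split_ifs with h1 h2 h3
  · exact hr
  · omega
  · by_contra h4
    have hr1 : r = 1 := by omega
    subst hr1
    have := Int.eq_zero_of_abs_lt_dvd h3 (by rw [abs_lt]; omega)
    omega
  · exact hr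

theorem shift (hn : n ≠ 0) : IsAffPos n shiftPerm :=
  ⟨IsAff.shift, fun r hr => by rw [shiftPerm_apply]; omega, fun h => absurd h hn⟩

theorem mul_shift_inv (h : IsAffPos n σ) (hn : n ≠ 0) (h0 : 0 < σ 0) : IsAffPos n (σ * shiftPerm⁻¹) := by
  refine ⟨h.isAff.mul IsAff.shift.inv, fun r hr => ?_, fun h => absurd h hn⟩
  rw [Equiv.Perm.mul_apply, shiftPerm_inv_apply]
  rcases eq_or_ne r 1 with rfl | hr'
  · simpa using h0
  · exact h.2.1 _ (by omega)

/-- Without descents `σ` is increasing on the window `1, …, n`. Going up from `σ 1 ≥ 1` gives `σ i ≥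
i`; going down from `σ n = σ 0 + n ≤ n` gives `σ i ≤ i`. This is the terminal case of the rewriting,
where no letter can be removed. -/
theorem eq_one (h : IsAffPos n σ) (h0 : σ 0 ≤ 0) (hd : ∀ i : ℕ, i + 1 < n → σ (i + 1) < σ (i + 1 + 1)) : σ = 1 := by
  rcases Nat.eq_zero_or_pos n with hn | hn
  · exact h.2.2 hn
  have hge : ∀ i : ℕ, i < n → (i : ℤ) + 1 ≤ σ (i + 1) := by
    intro i
    induction i with
    | zero => intro _; have := h.2.1 1 one_pos; simpa using Int.add_one_le_iff.2 this
    | succ i ih =>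
      intro hi
      have h1 := ih (by omega)
      have h2 := hd i hi
      push_cast
      omega
  have hle : ∀ i : ℕ, i < n → σ (n - i) ≤ n - i := by
    intro i
    induction i with
    | zero =>
      intro _
      have := h.isAff 0
      rw [zero_add] at this
      simp only [Nat.cast_zero, sub_zero]
      omega
    | succ i ih =>
      intro hi
      have h1 := ih (by omega)
      have h2 := hd (n - (i + 2)) (by omega)
      rw [show ((n - (i + 2) : ℕ) : ℤ) + 1 = n - (i + 1 : ℕ) by omega,
        show (n - (i + 1 : ℕ) : ℤ) + 1 = n - i by omega] at h2
      push_cast at h2 ⊢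
      omega
  have heq : ∀ i : ℕ, i < n → σ (i + 1) = i + 1 := fun i hi => by
    have h1 := hge i hi
    have h2 := hle (n - (i + 1)) (by omega)
    rw [show (n : ℤ) - (n - (i + 1) : ℕ) = i + 1 by omega] at h2
    omega
  ext r
  -- The window starts at `1`, so `r - 1` is what gets divided by `n`.
  have e := h.isAff.add_mul ((r - 1) % n + 1) ((r - 1) / n)
  have h1 := Int.emod_nonneg (r - 1) (b := n) (by omega)
  have h2 := Int.emod_lt_of_pos (r - 1) (b := n) (by omega)
  have h3 := heq ((r - 1) % n).toNat (by omega)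
  rw [Int.toNat_of_nonneg h1] at h3
  have h4 := Int.emod_add_mul_ediv (r - 1) n
  rw [h3, show (r - 1) % n + 1 + n * ((r - 1) / n) = r by omega] at e
  exact e

theorem sum_range_pair {n i : ℕ} (hi : i + 1 < n) (f : ℕ → ℤ) (hf : ∀ j, j < n → j ≠ i → j ≠ i + 1 → f j = 0) :
    ∑ j ∈ Finset.range n, f j = f i + f (i + 1) := by
  rw [← Finset.sum_pair (f := f) (by omega : i ≠ i + 1)]
  symm
  refine Finset.sum_subset (fun j hj => ?_) fun j hj hj' => ?_
  · simp only [Finset.mem_insert, Finset.mem_singleton] at hj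
    rw [Finset.mem_range]; omega
  · simp only [Finset.mem_insert, Finset.mem_singleton, not_or] at hj'
    exact hf j (Finset.mem_range.1 hj) hj'.1 hj'.2

/-- The positive monoid is generated by `c` and the simple reflections `s_1, …, s_{n-1}`. -/
theorem induction {P : Equiv.Perm ℤ → Prop} (one : P 1)
    (simple : ∀ (i : ℕ) (σ : Equiv.Perm ℤ), i + 1 < n → IsAffPos n σ → σ (i + 1) < σ (i + 1 + 1) → P σ →
      P (σ * NilGlue.simpleRefl n (i + 1)))
    (shift : ∀ σ : Equiv.Perm ℤ, n ≠ 0 → IsAffPos n σ → P σ → P (σ * shiftPerm)) (h : IsAffPos n σ) : P σ := by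
  rcases eq_or_ne n 0 with hn | hn
  · rw [h.2.2 hn]; exact one
  have hpos : ∀ {σ : Equiv.Perm ℤ}, IsAffPos n σ → ∀ j : ℕ, 0 < σ (j + 1) := fun h j => h.2.1 _ (by omega)
  -- First measure: the sum of the values on the window. It drops by `n` when `c` is removed and
  -- does not change when a simple reflection is removed.
  obtain ⟨S, hS⟩ : ∃ S : ℕ, (∑ j ∈ Finset.range n, σ (j + 1)).toNat = S := ⟨_, rfl⟩
  induction S using Nat.strong_induction_on generalizing σ with
  | _ S ihS =>
  -- Second measure: the same sum with decreasing positive weights. Removing a descent moves the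
  -- larger value to the smaller weight, so this sum decreases while the first one is constant.
  obtain ⟨W, hW⟩ : ∃ W : ℕ, (∑ j ∈ Finset.range n, ((n : ℤ) - j) * σ (j + 1)).toNat = W := ⟨_, rfl⟩
  induction W using Nat.strong_induction_on generalizing σ with
  | _ W ihW =>
  by_cases hd : ∃ i : ℕ, i + 1 < n ∧ σ (i + 1 + 1) < σ (i + 1)
  · obtain ⟨i, hi, hlt⟩ := hd
    have hn2 : 2 ≤ n := by omega
    have e1 := simpleRefl_self hn2 ((i : ℤ) + 1)
    have e2 := simpleRefl_succ hn2 ((i : ℤ) + 1)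
    have e3 : ∀ j : ℕ, j < n → j ≠ i → j ≠ i + 1 → NilGlue.simpleRefl n (i + 1) (j + 1) = j + 1 :=
      fun j hj h1 h2 => simpleRefl_window (by rw [abs_lt]; omega) (by rw [abs_lt]; omega) (by omega) (by omega)
    have h' := h.mul (.simpleRefl hi)
    have hs := sum_range_pair hi
      (fun j => (σ * NilGlue.simpleRefl n (i + 1)) (j + 1) - σ (j + 1)) (fun j hj h1 h2 => by
        simp only [Equiv.Perm.mul_apply]; rw [e3 j hj h1 h2, sub_self])
    have hw := sum_range_pair hi
      (fun j => ((n : ℤ) - j) * (σ * NilGlue.simpleRefl n (i + 1)) (j + 1) - ((n : ℤ) - j) * σ (j + 1))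
      (fun j hj h1 h2 => by
        simp only [Equiv.Perm.mul_apply]; rw [e3 j hj h1 h2, sub_self])
    rw [Finset.sum_sub_distrib] at hs hw
    simp only [Equiv.Perm.mul_apply, Nat.cast_add, Nat.cast_one, e1, e2] at hs hw
    have hwpos : 0 < ∑ j ∈ Finset.range n, ((n : ℤ) - j) * σ (j + 1) := by
      refine Finset.sum_pos (fun j hj => mul_pos ?_ (hpos h j)) ⟨0, by simp; omega⟩
      have := Finset.mem_range.1 hj
      omega
    have := ihW (∑ j ∈ Finset.range n, ((n : ℤ) - j) * (σ * NilGlue.simpleRefl n (i + 1)) (j + 1)).toNat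
      (by simp only [Equiv.Perm.mul_apply]; rw [← hW, Int.toNat_lt_toNat hwpos]; linarith) h'
      (by simp only [Equiv.Perm.mul_apply]; rw [← hS]; congr 1; linarith) rfl
    have := simple i _ hi h' (by simpa [e1, e2] using hlt) this
    rwa [mul_simpleRefl_mul] at this
  · by_cases h0 : 0 < σ 0
    · have h' := h.mul_shift_inv hn h0
      have hspos : 0 < ∑ j ∈ Finset.range n, σ (j + 1) :=
        Finset.sum_pos (fun j _ => hpos h j) ⟨0, by simp; omega⟩
      -- Removing `c` moves the window one step to the left: the value `σ n = σ 0 + n` is replaced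
      -- by `σ 0`.
      have hs : ∑ j ∈ Finset.range n, (σ * shiftPerm⁻¹) (j + 1) = ∑ j ∈ Finset.range n, σ (j + 1) - n := by
        have h1 := Finset.sum_range_succ (fun j : ℕ => σ j) n
        rw [Finset.sum_range_succ'] at h1
        have h2 := h.isAff 0
        rw [zero_add] at h2
        simp only [Nat.cast_add, Nat.cast_one, Nat.cast_zero] at h1
        simp only [Equiv.Perm.mul_apply, shiftPerm_inv_apply, add_sub_cancel_right]
        linarith
      have := ihS _ (by rw [← hS, Int.toNat_lt_toNat hspos, hs]; omega) h' rfl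
      have := shift _ hn h' this
      rwa [inv_mul_cancel_right] at this
    · rw [h.eq_one (not_lt.1 h0) fun i hi => ?_]
      · exact one
      · by_contra h1
        rcases perm_lt_or_gt σ (a := (i : ℤ) + 1) (b := i + 1 + 1) (by omega) with h2 | h2
        · exact h1 h2
        · exact hd ⟨i, hi, h2⟩

theorem isExpr (h : IsAffPos n σ) : IsExpr n σ :=
  h.induction .one (fun _ _ _ _ _ h => h.mul (.simpleRefl n _)) (fun _ _ _ h => h.mul .shift)

/-- The positive monoid is stable under removing inversions. -/
theorem mul_refl (h : IsAffPos n σ) {p q : ℤ} (hpq : p < q) (hlt : σ q < σ p) : IsAffPos n (σ * refl n p q) := by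
  refine ⟨h.isAff.mul (IsAff.refl n p q), fun r hr => ?_, fun hn => ?_⟩
  · rw [Equiv.Perm.mul_apply, refl_apply, reflFun]
    split_ifs with h1 h2 h3
    · exact h.2.1 r hr
    · exact h.2.1 _ (by omega)
    -- A point `r ≡ q` is now sent to `σ p + (r - q)`, which exceeds `σ r = σ q + (r - q)` because
    -- `(p, q)` is an inversion.
    · have e1 := h.isAff.apply_of_dvd h3
      have e2 := h.isAff.apply_of_dvd (p := r - (q - p)) (q := p) (by convert h3 using 1; ring)
      have := h.2.1 r hr
      omega
    · exact h.2.1 r hr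
  · rw [h.2.2 hn] at hlt
    exact absurd hpq hlt.not_gt

end IsAffPos

/-! ## The positive affine nil Hecke monoid -/

namespace NilAff

variable {n : ℕ}

theorem T_of_pos {σ : Equiv.Perm ℤ} (h : IsAffPos n σ) : T n σ = some ⟨σ, h⟩ := dif_pos h

theorem T_of_not {σ : Equiv.Perm ℤ} (h : ¬ IsAffPos n σ) : T n σ = 0 := dif_neg h

theorem T_injective {σ τ : Equiv.Perm ℤ} (h : IsAffPos n σ) (h' : IsAffPos n τ) (e : T n σ = T n τ) : σ = τ := by
  rw [T_of_pos h, T_of_pos h'] at e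
  exact congrArg Subtype.val (Option.some.inj e)

theorem cases_T {P : NilAff n → Prop} (h0 : P 0) (h : ∀ σ, IsAffPos n σ → P (T n σ)) (a : NilAff n) : P a := by
  match a with
  | none => exact h0
  | some σ => have := h σ.1 σ.2; rwa [T_of_pos σ.2] at this

theorem mul_T {σ τ : Equiv.Perm ℤ} (h : IsAffPos n σ) (h' : IsAffPos n τ) :
    mul (T n σ) (T n τ) = if ell n (σ * τ) = ell n σ + ell n τ then T n (σ * τ) else 0 := by
  rw [T_of_pos h, T_of_pos h']; rfl

theorem zero_mul' (a : NilAff n) : mul 0 a = 0 := by cases a <;> rfl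

theorem mul_zero' (a : NilAff n) : mul a 0 = 0 := by cases a <;> rfl

instance : MonoidWithZero (NilAff n) where
  mul := mul
  one := one n
  zero_mul := zero_mul'
  mul_zero := mul_zero'
  one_mul a := by
    induction a using cases_T with
    | h0 => exact mul_zero' _
    | h σ h =>
      change mul (T n 1) _ = _
      rw [mul_T (.one n) h, one_mul, ell_one, zero_add, if_pos rfl]
  mul_one a := by
    induction a using cases_T with
    | h0 => exact zero_mul' _
    | h σ h =>
      change mul _ (T n 1) = _
      rw [mul_T h (.one n), mul_one, ell_one, add_zero, if_pos rfl]
  mul_assoc a b c := by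
    change mul (mul a b) c = mul a (mul b c)
    induction a using cases_T with
    | h0 => simp only [zero_mul']
    | h σ hσ =>
    induction b using cases_T with
    | h0 => simp only [zero_mul', mul_zero']
    | h τ hτ =>
    induction c using cases_T with
    | h0 => simp only [mul_zero']
    | h ρ hρ =>
    -- Either bracketing is non-zero exactly when the length of the triple product is the sum of the
    -- three lengths; by subadditivity a defect in an inner product cannot be recovered by the outer
    -- one.
    have h1 := hσ.isExpr.ell_mul_le hτ.isExpr
    have h2 := hτ.isExpr.ell_mul_le hρ.isExpr
    have h3 := hσ.isExpr.ell_mul_le (hτ.mul hρ).isExpr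
    have h4 := (hσ.mul hτ).isExpr.ell_mul_le hρ.isExpr
    rw [← mul_assoc] at h3
    rw [mul_T hσ hτ, mul_T hτ hρ]
    split_ifs with e1 e2 e2
    · rw [mul_T (hσ.mul hτ) hρ, mul_T hσ (hτ.mul hρ), mul_assoc, e1, e2, add_assoc]
    · rw [mul_T (hσ.mul hτ) hρ, mul_zero', if_neg (by omega)]
    · rw [mul_T hσ (hτ.mul hρ), zero_mul', ← mul_assoc, if_neg (by omega)]
    · rw [zero_mul', mul_zero']

theorem mul_def (a b : NilAff n) : mul a b = a * b := rfl

theorem T_one : T n 1 = 1 := rfl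

/-- The element `T_{s_{i+1}}`, for `i + 1 < n`. -/
def t (n i : ℕ) : NilAff n := T n (simpleRefl n ((i : ℤ) + 1))

/-- The element `T_c` (`0` if `n = 0`). -/
def c (n : ℕ) : NilAff n := T n shiftPerm

theorem T_mul_c {σ : Equiv.Perm ℤ} (hn : n ≠ 0) (h : IsAffPos n σ) : T n σ * c n = T n (σ * shiftPerm) := by
  rw [← mul_def, c, mul_T h (.shift hn), ell_shiftPerm, add_zero, if_pos h.isExpr.ell_mul_shiftPerm]

/-- As `ℓ(s_{i+1}) = 1`, additivity of lengths means an ascent at `i + 1`; a descent gives `0`. -/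
theorem T_mul_t_of_lt {σ : Equiv.Perm ℤ} {i : ℕ} (hi : i + 1 < n) (h : IsAffPos n σ)
    (hlt : σ (i + 1) < σ (i + 1 + 1)) : T n σ * t n i = T n (σ * simpleRefl n (i + 1)) := by
  have hn : 2 ≤ n := by omega
  rw [← mul_def, t, mul_T h (.simpleRefl hi), ell_simpleRefl hn, if_pos (h.isExpr.ell_mul_simpleRefl_of_lt hn hlt)]

theorem T_mul_t_of_gt {σ : Equiv.Perm ℤ} {i : ℕ} (hi : i + 1 < n) (h : IsAffPos n σ)
    (hlt : σ (i + 1 + 1) < σ (i + 1)) : T n σ * t n i = 0 := by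
  have hn : 2 ≤ n := by omega
  have := h.isExpr.ell_mul_simpleRefl_of_gt hn hlt
  rw [← mul_def, t, mul_T h (.simpleRefl hi), ell_simpleRefl hn, if_neg (by omega)]

/-- By convention `Ŝ_0` is trivial, so it does not contain the shift and `T` takes its default
value. -/
theorem c_zero : c 0 = 0 := T_of_not fun h => by
  have := congrArg (fun σ : Equiv.Perm ℤ => σ 0) (h.2.2 rfl)
  simp at this

/-- The monoid `Ŝ_n^{+,nil}` is generated by the `T_{s_i}` and `T_c`. -/
theorem ind {P : NilAff n → Prop} (h0 : P 0) (h1 : P 1) (ht : ∀ (a : NilAff n) (i : ℕ), i + 1 < n → P a → P (a * t n i))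
    (hc : ∀ a, n ≠ 0 → P a → P (a * c n)) (a : NilAff n) : P a := by
  induction a using cases_T with
  | h0 => exact h0
  | h σ h =>
    refine h.induction (P := fun σ => P (T n σ)) h1 (fun i σ hi h hlt ih => ?_) (fun σ hn h ih => ?_)
    · rw [← T_mul_t_of_lt hi h hlt]; exact ht _ i hi ih
    · rw [← T_mul_c hn h]; exact hc _ hn ih

end NilAff

/-! ## The universal property of the positive affine nil Hecke monoid -/

/-- The defining relations of `Ŝ_n^{+,nil}`, for elements `t_i` and `c` of a monoid with zero. -/
structure NilRel (n : ℕ) {A : Type} [MonoidWithZero A] (t : ℕ → A) (c : A) : Prop where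
  sq : ∀ i, i + 1 < n → t i * t i = 0
  comm : ∀ i j, i + 1 < j → j + 1 < n → t i * t j = t j * t i
  braid : ∀ i, i + 2 < n → t i * t (i + 1) * t i = t (i + 1) * t i * t (i + 1)
  shift : ∀ i, i + 2 < n → t (i + 1) * c = c * t i
  kappa : ∀ i, i + 2 = n → t 0 * (c * c) = c * c * t i
  zero : n = 0 → c = 0

/-- `a` is the value of a reduced word of length `m` for `σ`. -/
inductive Val (n : ℕ) {A : Type} [MonoidWithZero A] (t : ℕ → A) (c : A) : ℕ → Equiv.Perm ℤ → A → Prop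
  | one : Val n t c 0 1 1
  | simple {m : ℕ} {σ : Equiv.Perm ℤ} {a : A} (i : ℕ) (hi : i + 1 < n) (h : σ (i + 1) < σ (i + 1 + 1)) :
    Val n t c m σ a → Val n t c (m + 1) (σ * simpleRefl n (i + 1)) (a * t i)
  | shift {m : ℕ} {σ : Equiv.Perm ℤ} {a : A} (hn : n ≠ 0) :
    Val n t c m σ a → Val n t c (m + 1) (σ * shiftPerm) (a * c)

/-- Both sides are the exchange of `a` and `a + 2`: conjugate `s_{a+1}` by `s_a`, and `s_a` by
`s_{a+1}`. The bound on `n` keeps `a` and `a + 2` incongruent. -/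
theorem refl_braid {n : ℕ} (hn : 3 ≤ n) (a : ℤ) : simpleRefl n a * simpleRefl n (a + 1) * simpleRefl n a =
    simpleRefl n (a + 1) * simpleRefl n a * simpleRefl n (a + 1) := by
  have hn' : 2 ≤ n := by omega
  have e1 : simpleRefl n a (a + 1 + 1) = a + 1 + 1 :=
    simpleRefl_window (by rw [abs_lt]; omega) (by rw [abs_lt]; omega) (by omega) (by omega)
  have e2 : simpleRefl n (a + 1) a = a :=
    simpleRefl_window (by rw [abs_lt]; omega) (by rw [abs_lt]; omega) (by omega) (by omega)
  have h1 := (IsAff.simpleRefl n a).mul_refl (a + 1) (a + 1 + 1)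
  have h2 := (IsAff.simpleRefl n (a + 1)).mul_refl a (a + 1)
  rw [simpleRefl_succ hn', e1, ← simpleRefl_eq_refl hn'] at h1
  rw [simpleRefl_self hn', e2, ← simpleRefl_eq_refl hn'] at h2
  rw [h1, h2, mul_simpleRefl_mul, mul_simpleRefl_mul]

theorem simpleRefl_comm {n i j : ℕ} (hij : i + 1 < j) (hj : j + 1 < n) :
    simpleRefl n ((i : ℤ) + 1) * simpleRefl n ((j : ℤ) + 1) =
      simpleRefl n ((j : ℤ) + 1) * simpleRefl n ((i : ℤ) + 1) :=
  (IsAff.simpleRefl n _).mul_simpleRefl_of_sub_eq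
    (simpleRefl_window (by rw [abs_lt]; omega) (by rw [abs_lt]; omega) (by omega) (by omega))
    (simpleRefl_window (by rw [abs_lt]; omega) (by rw [abs_lt]; omega) (by omega) (by omega))

/-! ### Uniqueness of the value of a reduced word -/

namespace Val

variable {n : ℕ} {A : Type} [MonoidWithZero A] {t : ℕ → A} {c : A} {m : ℕ} {σ : Equiv.Perm ℤ} {a : A}

theorem simple' {i : ℕ} (hi : i + 1 < n) (h : σ (i + 1 + 1) < σ (i + 1))
    (hv : Val n t c m (σ * simpleRefl n (i + 1)) a) : Val n t c (m + 1) σ (a * t i) := by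
  have hn : 2 ≤ n := by omega
  have := hv.simple i hi (by simpa [simpleRefl_self hn, simpleRefl_succ hn] using h)
  rwa [mul_simpleRefl_mul] at this

theorem shift' (hn : n ≠ 0) (hv : Val n t c m (σ * shiftPerm⁻¹) a) : Val n t c (m + 1) σ (a * c) := by
  have := hv.shift hn
  rwa [inv_mul_cancel_right] at this

theorem isAffPos (h : Val n t c m σ a) : IsAffPos n σ := by
  induction h with
  | one => exact .one n
  | simple i hi _ _ ih => exact ih.mul (.simpleRefl hi)
  | shift hn _ ih => exact ih.mul (.shift hn)

theorem _root_.NilGlue.IsAffPos.exists_val (t : ℕ → A) (c : A) (h : IsAffPos n σ) : ∃ m a, Val n t c m σ a :=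
  h.induction (P := fun σ => ∃ m a, Val n t c m σ a) ⟨0, 1, .one⟩
    (fun i _ hi _ hlt ⟨_, _, hv⟩ => ⟨_, _, hv.simple i hi hlt⟩) (fun _ hn _ ⟨_, _, hv⟩ => ⟨_, _, hv.shift hn⟩)

/-- `Step x m σ a` holds if `a = b x` where `b` is the value of a reduced word of length `m` for a right divisor of `σ`;
`none` stands for the letter `c`. -/
def Step (n : ℕ) (t : ℕ → A) (c : A) (σ : Equiv.Perm ℤ) (m : ℕ) (b : A) : Option ℕ → Prop
  | some i => i + 1 < n ∧ σ (i + 1 + 1) < σ (i + 1) ∧ Val n t c m (σ * simpleRefl n (i + 1)) b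
  | none => n ≠ 0 ∧ 0 < σ 0 ∧ Val n t c m (σ * shiftPerm⁻¹) b

/-- The value of a letter. -/
def letter (t : ℕ → A) (c : A) : Option ℕ → A
  | some i => t i
  | none => c

theorem cases_step (h : Val n t c m σ a) : (m = 0 ∧ σ = 1 ∧ a = 1) ∨
    ∃ x m' b, m = m' + 1 ∧ a = b * letter t c x ∧ Step n t c σ m' b x := by
  cases h with
  | one => exact Or.inl ⟨rfl, rfl, rfl⟩
  | @simple m' σ' b i hi hlt hv =>
    have hn : 2 ≤ n := by omega
    refine Or.inr ⟨some i, m', b, rfl, rfl, hi, ?_, ?_⟩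
    · simpa [simpleRefl_self hn, simpleRefl_succ hn] using hlt
    · rwa [mul_simpleRefl_mul]
  | @shift m' σ' b hn hv =>
    refine Or.inr ⟨none, m', b, rfl, rfl, hn, ?_, ?_⟩
    · simpa using hv.isAffPos.2.1 1 one_pos
    · rwa [mul_inv_cancel_right]

theorem not_step_one {b : A} {x : Option ℕ} : ¬ Step n t c 1 m b x := by
  rcases x with _ | i
  · rintro ⟨_, h, _⟩; simp at h
  · rintro ⟨_, h, _⟩; simp at h

/-- Two different last letters of reduced words for `σ` have a common multiple dividing `σ`: the case of two simple reflections. -/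
theorem diamond_simple (hR : NilRel n t c) (h : IsAffPos n σ) {i j : ℕ} (hij : i < j) (hj : j + 1 < n)
    (h1 : σ (i + 1 + 1) < σ (i + 1)) (h2 : σ (j + 1 + 1) < σ (j + 1)) :
    ∃ k z z', Val n t c k (σ * simpleRefl n (i + 1)) z ∧ Val n t c k (σ * simpleRefl n (j + 1)) z' ∧
      z * t i = z' * t j := by
  have hn : 2 ≤ n := by omega
  have hi : i + 1 < n := by omega
  -- Commuting letters: each reflection fixes the two points of the other, so the second descent
  -- persists after the first division and `σ` can be divided by both.
  by_cases hij' : i + 1 < j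
  · obtain ⟨m, r, hr⟩ := ((h.mul (.simpleRefl hi)).mul (.simpleRefl hj)).exists_val t c
    have hr' := hr
    rw [mul_assoc, simpleRefl_comm hij' hj, ← mul_assoc] at hr'
    have e : ∀ a b : ℤ, a < n → b < n → 0 ≤ a → 0 ≤ b → a ≠ b → a ≠ b + 1 → -n < a - b - 1 →
        simpleRefl n (b + 1) (a + 1) = a + 1 := fun a b h1 h2 h3 h4 h5 h6 h7 =>
      simpleRefl_window (by rw [abs_lt]; omega) (by rw [abs_lt]; omega) (by omega) (by omega)
    refine ⟨m + 1, r * t j, r * t i, hr.simple' hj ?_, hr'.simple' hi ?_, ?_⟩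
    · rw [Equiv.Perm.mul_apply, Equiv.Perm.mul_apply, e _ _ (by omega) (by omega) (by omega) (by omega) (by omega) (by omega) (by omega),
        e _ _ (by omega) (by omega) (by omega) (by omega) (by omega) (by omega) (by omega)]
      exact h2
    · rw [Equiv.Perm.mul_apply, Equiv.Perm.mul_apply, e _ _ (by omega) (by omega) (by omega) (by omega) (by omega) (by omega) (by omega),
        e _ _ (by omega) (by omega) (by omega) (by omega) (by omega) (by omega) (by omega)]
      exact h1
    · rw [mul_assoc, mul_assoc, hR.comm i j hij' hj]
  -- Adjacent letters: `σ` is decreasing on three consecutive points, so it can be divided by the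
  -- longest element of the corresponding `𝔖_3`. The two words to compare then differ by the braid
  -- relation.
  · obtain rfl : j = i + 1 := by omega
    push_cast at h2 ⊢
    obtain ⟨m, r, hr⟩ := (((h.mul (.simpleRefl hi)).mul (.simpleRefl hj)).mul (.simpleRefl hi)).exists_val t c
    push_cast at hr
    have e1 : simpleRefl n ((i : ℤ) + 1) (i + 1 + 1 + 1) = i + 1 + 1 + 1 :=
      simpleRefl_window (by rw [abs_lt]; omega) (by rw [abs_lt]; omega) (by omega) (by omega)
    have e2 : simpleRefl n ((i : ℤ) + 1 + 1) (i + 1) = i + 1 :=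
      simpleRefl_window (by rw [abs_lt]; omega) (by rw [abs_lt]; omega) (by omega) (by omega)
    have e3 := simpleRefl_self hn ((i : ℤ) + 1)
    have e4 := simpleRefl_succ hn ((i : ℤ) + 1)
    have e5 := simpleRefl_self hn ((i : ℤ) + 1 + 1)
    have e6 := simpleRefl_succ hn ((i : ℤ) + 1 + 1)
    have hr' := hr
    rw [mul_assoc, mul_assoc, ← mul_assoc (simpleRefl n _), refl_braid (by omega), ← mul_assoc, ← mul_assoc] at hr'
    have hj' : (i + 1) + 1 < n := hj
    refine ⟨m + 1 + 1, r * t i * t (i + 1), r * t (i + 1) * t i, ?_, ?_, ?_⟩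
    · refine (hr.simple' hi ?_).simple' hj' ?_
      · simp only [Equiv.Perm.mul_apply, e1, e2, e3, e5]
        exact h2
      · simp only [Nat.cast_add, Nat.cast_one, Equiv.Perm.mul_apply, e1, e4]
        exact h2.trans h1
    · have hr'' : Val n t c m (σ * simpleRefl n (i + 1 + 1) * simpleRefl n (i + 1) *
          simpleRefl n (((i + 1 : ℕ) : ℤ) + 1)) r := by push_cast; exact hr'
      refine (hr''.simple' hj' ?_).simple' hi ?_
      · simp only [Nat.cast_add, Nat.cast_one, Equiv.Perm.mul_apply, e1, e2, e4, e6]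
        exact h1
      simp only [Equiv.Perm.mul_apply, e2, e5]
      exact h2.trans h1
    · have := hR.braid i (by omega)
      rw [mul_assoc, mul_assoc, ← mul_assoc (t i), this]
      simp only [mul_assoc]

/-- Two different last letters of reduced words for `σ` have a common multiple dividing `σ`: the case of `c` and a
simple reflection. -/
theorem diamond_shift (hR : NilRel n t c) (h : IsAffPos n σ) {i : ℕ} (hi : i + 1 < n)
    (h1 : σ (i + 1 + 1) < σ (i + 1)) (h2 : 0 < σ 0) :
    ∃ k z z', Val n t c k (σ * simpleRefl n (i + 1)) z ∧ Val n t c k (σ * shiftPerm⁻¹) z' ∧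
      z * t i = z' * c := by
  have hn : 2 ≤ n := by omega
  have hn0 : n ≠ 0 := by omega
  -- Before the last letter, `s_{i+1}` fixes `0`, so `c` can still be removed after it. The two
  -- words differ by `t_{i+1} c = c t_i`.
  by_cases hi' : i + 2 < n
  · have e0 : simpleRefl n ((i : ℤ) + 1) 0 = 0 :=
      simpleRefl_window (by rw [abs_lt]; omega) (by rw [abs_lt]; omega) (by omega) (by omega)
    have hρ := (h.mul (.simpleRefl hi)).mul_shift_inv hn0 (by rwa [Equiv.Perm.mul_apply, e0])
    obtain ⟨m, r, hr⟩ := hρ.exists_val t c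
    have hr' := hr
    have hc : simpleRefl n ((i : ℤ) + 1) * shiftPerm⁻¹ = shiftPerm⁻¹ * simpleRefl n (((i + 1 : ℕ) : ℤ) + 1) := by
      have := shiftPerm_zpow_mul_simpleRefl n (-1) (((i + 1 : ℕ) : ℤ) + 1)
      rw [zpow_neg_one] at this
      rw [this]
      push_cast
      ring_nf
    rw [mul_assoc, hc, ← mul_assoc] at hr'
    refine ⟨m + 1, r * c, r * t (i + 1), hr.shift' hn0, hr'.simple' (by omega) ?_, ?_⟩
    · simpa using h1
    · rw [mul_assoc, mul_assoc, hR.shift i hi']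
  -- The last letter `s_{n-1}` also exchanges `-1` and `0`, and its descent translates to `σ 0 < σ
  -- (-1)`. With `0 < σ 0`, this allows `c` to be removed twice after `s_{n-1}`; the two words
  -- differ by `t_0 c² = c² t_{n-2}`.
  · have hin : (i : ℤ) + 1 = n - 1 := by omega
    have hs : ∀ r, (simpleRefl n ((i : ℤ) + 1)) r = simpleRefl n (-1) r := fun r => by
      have := refl_of_dvd_sub (n := n) (-1) (-1 + 1) n dvd_rfl
      rw [simpleRefl_eq_refl hn, simpleRefl_eq_refl hn, ← this, hin]
      congr 2; ring
    have e0 : simpleRefl n ((i : ℤ) + 1) 0 = -1 := by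
      rw [hs]; exact simpleRefl_succ hn (-1)
    have e1 : simpleRefl n ((i : ℤ) + 1) (-1) = 0 := by
      rw [hs]; exact simpleRefl_self hn (-1)
    have h3 : σ 0 < σ (-1) := by
      have a1 := h.isAff (-1)
      have a2 := h.isAff 0
      rw [show (-1 : ℤ) + n = i + 1 by omega] at a1
      rw [show (0 : ℤ) + n = i + 1 + 1 by omega] at a2
      omega
    have hρ := ((h.mul (.simpleRefl hi)).mul_shift_inv hn0 (by rw [Equiv.Perm.mul_apply, e0]; omega)).mul_shift_inv hn0
      (by simp [e1, h2])
    obtain ⟨m, r, hr⟩ := hρ.exists_val t c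
    have hr' := hr
    have hc : simpleRefl n ((i : ℤ) + 1) * shiftPerm⁻¹ * shiftPerm⁻¹ =
        shiftPerm⁻¹ * shiftPerm⁻¹ * simpleRefl n (((0 : ℕ) : ℤ) + 1) := by
      have := shiftPerm_zpow_mul_simpleRefl n (-2) 1
      have e : (shiftPerm ^ (-2 : ℤ)) = shiftPerm⁻¹ * shiftPerm⁻¹ := by
        rw [show (-2 : ℤ) = -1 + -1 by ring, zpow_add, zpow_neg_one]
      rw [e] at this
      rw [mul_assoc, Nat.cast_zero, zero_add, this]
      congr 1
      ext r
      rw [hs]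
      norm_num
    rw [mul_assoc, mul_assoc, ← mul_assoc (simpleRefl n _), hc, ← mul_assoc, ← mul_assoc] at hr'
    refine ⟨m + 1 + 1, r * c * c, r * t 0 * c, (hr.shift' hn0).shift' hn0,
      (hr'.simple' (by omega) ?_).shift' hn0, ?_⟩
    · simpa using h3
    · have := hR.kappa i (by omega)
      simp only [mul_assoc] at this ⊢
      rw [this]

theorem diamond (hR : NilRel n t c) {x y : Option ℕ} {m m' : ℕ} {b b' : A} (hx : Step n t c σ m b x) (hy : Step n t c σ m' b' y)
    (h : IsAffPos n σ) (hxy : x ≠ y) :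
    ∃ k z z', Step n t c σ k z x ∧ Step n t c σ k z' y ∧ z * letter t c x = z' * letter t c y := by
  rcases x with _ | i <;> rcases y with _ | j
  · exact absurd rfl hxy
  · obtain ⟨hn, h0, _⟩ := hx
    obtain ⟨hj, h1, _⟩ := hy
    obtain ⟨k, z, z', hz, hz', e⟩ := diamond_shift hR h hj h1 h0
    exact ⟨k, z', z, ⟨hn, h0, hz'⟩, ⟨hj, h1, hz⟩, e.symm⟩
  · obtain ⟨hn, h0, _⟩ := hy
    obtain ⟨hj, h1, _⟩ := hx
    obtain ⟨k, z, z', hz, hz', e⟩ := diamond_shift hR h hj h1 h0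
    exact ⟨k, z, z', ⟨hj, h1, hz⟩, ⟨hn, h0, hz'⟩, e⟩
  · obtain ⟨hi, h1, _⟩ := hx
    obtain ⟨hj, h2, _⟩ := hy
    have hne : i ≠ j := fun h => hxy (by rw [h])
    rcases lt_or_gt_of_ne hne with hij | hij
    · obtain ⟨k, z, z', hz, hz', e⟩ := diamond_simple hR h hij hj h1 h2
      exact ⟨k, z, z', ⟨hi, h1, hz⟩, ⟨hj, h2, hz'⟩, e⟩
    · obtain ⟨k, z, z', hz, hz', e⟩ := diamond_simple hR h hij hi h2 h1
      exact ⟨k, z', z, ⟨hi, h1, hz'⟩, ⟨hj, h2, hz⟩, e.symm⟩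

/-- All reduced words for `σ` have the same value and the same length. -/
theorem unique (hR : NilRel n t c) (h : Val n t c m σ a) {m' : ℕ} {a' : A} (h' : Val n t c m' σ a') :
    m' = m ∧ a' = a := by
  induction m using Nat.strong_induction_on generalizing σ a m' a' with
  | _ m ih =>
  have hstep : ∀ {k : ℕ} {b : A} {x : Option ℕ} {k' : ℕ} {b' : A}, k < m → Step n t c σ k b x → Step n t c σ k' b' x →
      k' = k ∧ b' = b := by
    intro k b x k' b' hk h1 h2
    rcases x with _ | i
    · exact ih k hk h1.2.2 h2.2.2
    · exact ih k hk h1.2.2 h2.2.2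
  rcases h.cases_step with ⟨rfl, rfl, rfl⟩ | ⟨x, k, b, rfl, rfl, hx⟩
  · rcases h'.cases_step with ⟨rfl, _, rfl⟩ | ⟨y, k', b', _, _, hy⟩
    · exact ⟨rfl, rfl⟩
    · exact absurd hy not_step_one
  · rcases h'.cases_step with ⟨_, rfl, _⟩ | ⟨y, k', b', rfl, rfl, hy⟩
    · exact absurd hx not_step_one
    by_cases hxy : x = y
    · subst hxy
      obtain ⟨rfl, rfl⟩ := hstep (by omega) hx hy
      exact ⟨rfl, rfl⟩
    -- Newman's argument. The induction hypothesis identifies the first word with the first branch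
    -- of the diamond, which fixes the length `l`. The second branch has the same length, so the
    -- hypothesis applies to it as well and identifies it with the second word.
    · obtain ⟨l, z, z', hz, hz', e⟩ := diamond hR hx hy h.isAffPos hxy
      obtain ⟨rfl, rfl⟩ := hstep (by omega) hx hz
      obtain ⟨rfl, rfl⟩ := hstep (by omega) hz' hy
      exact ⟨rfl, e.symm⟩

end Val

/-! ### The universal property: morphisms determined by the generators -/

namespace NilAff

section
variable {n : ℕ} {A : Type} [MonoidWithZero A] {t' : ℕ → A} {c' : A}

/-- The value of a reduced word for `σ`. -/
def liftFun (t' : ℕ → A) (c' : A) : NilAff n → A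
  | none => 0
  | some σ => (σ.2.exists_val t' c').choose_spec.choose

theorem liftFun_val (σ : Equiv.Perm ℤ) (h : IsAffPos n σ) : ∃ m, Val n t' c' m σ (liftFun t' c' (T n σ)) := by
  rw [T_of_pos h]
  exact ⟨_, (h.exists_val t' c').choose_spec.choose_spec⟩

theorem liftFun_of_val (hR : NilRel n t' c') {m : ℕ} {σ : Equiv.Perm ℤ} {a : A} (h : Val n t' c' m σ a) :
    liftFun t' c' (T n σ) = a := by
  obtain ⟨k, hk⟩ := liftFun_val (t' := t') (c' := c') σ h.isAffPos
  exact (h.unique hR hk).2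

/-- At an ascent the reduced word is extended by `t_i`. At a descent the product is `0`; a reduced
word ending with `t_i` may be chosen, so the other side contains `t_i² = 0`. -/
theorem liftFun_mul_t (hR : NilRel n t' c') (a : NilAff n) {i : ℕ} (hi : i + 1 < n) :
    liftFun t' c' (a * t n i) = liftFun t' c' a * t' i := by
  induction a using cases_T with
  | h0 => rw [zero_mul]; exact (zero_mul _).symm
  | h σ h =>
    rcases perm_lt_or_gt σ (a := (i : ℤ) + 1) (b := i + 1 + 1) (by omega) with hlt | hlt
    · obtain ⟨k, hk⟩ := liftFun_val (t' := t') (c' := c') σ h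
      rw [T_mul_t_of_lt hi h hlt]
      exact liftFun_of_val hR (hk.simple i hi hlt)
    · rw [T_mul_t_of_gt hi h hlt]
      obtain ⟨k, hk⟩ := liftFun_val (t' := t') (c' := c') _ (h.mul (.simpleRefl hi))
      rw [liftFun_of_val hR (hk.simple' hi hlt), mul_assoc, hR.sq i hi, mul_zero]
      rfl

/-- The letter `c` extends every reduced word, without any ascent condition; only the degenerate
case `n = 0` is separate. -/
theorem liftFun_mul_c (hR : NilRel n t' c') (a : NilAff n) :
    liftFun t' c' (a * c n) = liftFun t' c' a * c' := by
  rcases eq_or_ne n 0 with rfl | hn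
  · rw [c_zero, mul_zero, hR.zero rfl, mul_zero]; rfl
  induction a using cases_T with
  | h0 => rw [zero_mul]; exact (zero_mul _).symm
  | h σ h =>
    obtain ⟨k, hk⟩ := liftFun_val (t' := t') (c' := c') σ h
    rw [T_mul_c hn h]
    exact liftFun_of_val hR (hk.shift hn)

/-- The morphism of monoids with zero determined by the images of the `T_{s_i}` and of `T_c`. -/
def lift (t' : ℕ → A) (c' : A) (hR : NilRel n t' c') : NilAff n →*₀ A where
  toFun := liftFun t' c'
  map_zero' := rfl
  map_one' := liftFun_of_val hR .one
  map_mul' a b := by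
    induction b using ind with
    | h0 => rw [mul_zero]; exact (mul_zero _).symm
    | h1 => rw [mul_one, ← T_one, liftFun_of_val hR .one, mul_one]
    | ht b i hi ih => rw [← mul_assoc, liftFun_mul_t hR _ hi, ih, liftFun_mul_t hR _ hi, mul_assoc]
    | hc b hn ih => rw [← mul_assoc, liftFun_mul_c hR, ih, liftFun_mul_c hR, mul_assoc]

theorem lift_t (hR : NilRel n t' c') {i : ℕ} (hi : i + 1 < n) : lift t' c' hR (t n i) = t' i := by
  have := liftFun_mul_t hR 1 hi
  rwa [one_mul, ← T_one, liftFun_of_val hR .one, one_mul] at this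

theorem lift_c (hR : NilRel n t' c') : lift t' c' hR (c n) = c' := by
  have := liftFun_mul_c hR (1 : NilAff n)
  rwa [one_mul, ← T_one, liftFun_of_val hR .one, one_mul] at this

end

/-- Morphisms of monoids with zero that agree on the generators are equal. -/
theorem hom_ext {n : ℕ} {A : Type} [MonoidWithZero A] {f g : NilAff n →*₀ A} (ht : ∀ i, i + 1 < n → f (t n i) = g (t n i))
    (hc : f (c n) = g (c n)) (a : NilAff n) : f a = g a := by
  induction a using ind with
  | h0 => rw [map_zero, map_zero]
  | h1 => rw [map_one, map_one]
  | ht a i hi ih => rw [map_mul, map_mul, ih, ht i hi]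
  | hc a _ ih => rw [map_mul, map_mul, ih, hc]

/-- The generators of `Ŝ_n^{+,nil}` satisfy the defining relations. -/
theorem nilRel (n : ℕ) : NilRel n (t n) (c n) where
  sq i hi := by
    have hn : 2 ≤ n := by omega
    refine T_mul_t_of_gt hi (.simpleRefl hi) ?_
    rw [simpleRefl_self hn, simpleRefl_succ hn]
    exact lt_add_one _
  comm i j hij hj := by
    have hi : i + 1 < n := by omega
    have e1 : simpleRefl n ((i : ℤ) + 1) (j + 1) = j + 1 :=
      simpleRefl_window (by rw [abs_lt]; omega) (by rw [abs_lt]; omega) (by omega) (by omega)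
    have e2 : simpleRefl n ((i : ℤ) + 1) (j + 1 + 1) = j + 1 + 1 :=
      simpleRefl_window (by rw [abs_lt]; omega) (by rw [abs_lt]; omega) (by omega) (by omega)
    have e3 : simpleRefl n ((j : ℤ) + 1) (i + 1) = i + 1 :=
      simpleRefl_window (by rw [abs_lt]; omega) (by rw [abs_lt]; omega) (by omega) (by omega)
    have e4 : simpleRefl n ((j : ℤ) + 1) (i + 1 + 1) = i + 1 + 1 :=
      simpleRefl_window (by rw [abs_lt]; omega) (by rw [abs_lt]; omega) (by omega) (by omega)
    refine (T_mul_t_of_lt hj (.simpleRefl hi) (by rw [e1, e2]; exact lt_add_one _)).trans ?_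
    refine Eq.trans ?_ (T_mul_t_of_lt hi (.simpleRefl hj) (by rw [e3, e4]; exact lt_add_one _)).symm
    rw [simpleRefl_comm hij hj]
  braid i hi := by
    have hn : 2 ≤ n := by omega
    have hi' : i + 1 < n := by omega
    have e1 : simpleRefl n ((i : ℤ) + 1) (i + 1 + 1 + 1) = i + 1 + 1 + 1 :=
      simpleRefl_window (by rw [abs_lt]; omega) (by rw [abs_lt]; omega) (by omega) (by omega)
    have e2 : simpleRefl n ((i : ℤ) + 1 + 1) (i + 1) = i + 1 :=
      simpleRefl_window (by rw [abs_lt]; omega) (by rw [abs_lt]; omega) (by omega) (by omega)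
    have e3 := simpleRefl_self hn ((i : ℤ) + 1)
    have e4 := simpleRefl_succ hn ((i : ℤ) + 1)
    have e5 := simpleRefl_self hn ((i : ℤ) + 1 + 1)
    have e6 := simpleRefl_succ hn ((i : ℤ) + 1 + 1)
    have p1 := IsAffPos.simpleRefl hi'
    have p2 := IsAffPos.simpleRefl (n := n) (i := i + 1) hi
    have q1 : t n i * t n (i + 1) * t n i =
        T n (simpleRefl n (i + 1) * simpleRefl n (i + 1 + 1) * simpleRefl n (i + 1)) := by
      have a1 : t n i * t n (i + 1) = _ := T_mul_t_of_lt (σ := simpleRefl n (i + 1)) hi p1 (by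
        push_cast; rw [e4, e1]; omega)
      rw [a1]
      push_cast
      refine T_mul_t_of_lt hi' ?_ ?_
      · have := p1.mul p2
        push_cast at this
        exact this
      · simp only [Equiv.Perm.mul_apply, e1, e2, e3, e5]; omega
    have q2 : t n (i + 1) * t n i * t n (i + 1) =
        T n (simpleRefl n (i + 1 + 1) * simpleRefl n (i + 1) * simpleRefl n (i + 1 + 1)) := by
      have a1 : t n (i + 1) * t n i = _ := T_mul_t_of_lt (σ := simpleRefl n ((i + 1 : ℕ) + 1)) hi' p2 (by
        push_cast; rw [e2, e5]; omega)
      rw [a1, T_mul_t_of_lt (i := i + 1) hi (p2.mul p1) ?_]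
      · push_cast; rfl
      · simp only [Nat.cast_add, Nat.cast_one, Equiv.Perm.mul_apply, e1, e2, e4, e6]; omega
    rw [q1, q2, refl_braid (by omega)]
  shift i hi := by
    have hn : n ≠ 0 := by omega
    have h1 : t n (i + 1) * c n = _ := T_mul_c hn (.simpleRefl (i := i + 1) hi)
    have h2 : c n * t n i = _ := T_mul_t_of_lt (i := i) (by omega) (.shift hn) (by simp)
    rw [h1, h2]
    have := shiftPerm_zpow_mul_simpleRefl n 1 ((i : ℤ) + 1)
    rw [zpow_one] at this
    rw [this]
    push_cast
    rfl
  kappa i hi := by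
    have hn : n ≠ 0 := by omega
    have h1 : t n 0 * c n = _ := T_mul_c hn (.simpleRefl (i := 0) (by omega))
    have h2 : c n * c n = _ := T_mul_c hn (.shift hn)
    rw [← mul_assoc, h1, T_mul_c hn ((IsAffPos.simpleRefl (by omega)).mul (.shift hn)), h2,
      T_mul_t_of_lt (by omega) ((IsAffPos.shift hn).mul (.shift hn)) (by simp)]
    -- Here `c² s_{i+1} = s_{i+3} c²`, and `i + 3 = n + 1` gives `s_{n+1} = s_1`.
    have h3 := shiftPerm_zpow_mul_simpleRefl n 2 ((i : ℤ) + 1)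
    have e : (shiftPerm ^ (2 : ℤ)) = shiftPerm * shiftPerm := by
      rw [show (2 : ℤ) = 1 + 1 by ring, zpow_add, zpow_one]
    have h4 := refl_of_dvd_sub (n := n) 1 (1 + 1) n dvd_rfl
    rw [← e, h3, mul_assoc, ← e, simpleRefl_eq_refl (by omega), simpleRefl_eq_refl (by omega), Nat.cast_zero, zero_add, ← h4,
      show (i : ℤ) + 1 + 2 = 1 + n by omega, show (1 : ℤ) + n + 1 = 1 + 1 + n by ring]
  zero hn := by subst hn; exact c_zero

end NilAff

/-! ## The differential of the positive affine nil Hecke monoid -/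

variable {n : ℕ} {σ : Equiv.Perm ℤ}

theorem expr_eraseIdx (n : ℕ) (w : List ℤ) (e : ℤ) (k : ℕ) :
    ∃ p q, expr n (w.eraseIdx k) e = expr n w e * refl n p q := by
  -- The degenerate pair `(0, 0)` gives the identity. It serves for an index beyond the word and for
  -- `n < 2`, where the letters are trivial.
  have h1 : ∀ x : Equiv.Perm ℤ, ∃ p q, x = x * refl n p q := fun x => ⟨0, 0, by
    have : refl n 0 0 = 1 := by ext r; simp [refl_apply, reflFun]
    rw [this, mul_one]⟩
  induction w generalizing k with
  | nil => rw [List.eraseIdx_nil]; exact h1 _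
  | cons a w ih =>
    rcases k with _ | k
    · rw [List.eraseIdx_cons_zero, expr_cons]
      by_cases hn : n < 2
      · rw [simpleRefl_of_lt hn, one_mul]; exact h1 _
      -- With `x` the tail, `s_a x` equals `x` times the reflection in the preimages of `a` and `a +
      -- 1` under `x`.
      refine ⟨(expr n w e)⁻¹ a, (expr n w e)⁻¹ (a + 1), ?_⟩
      rw [mul_assoc, (IsAff.expr n w e).mul_refl, Equiv.Perm.inv_def, Equiv.apply_symm_apply, Equiv.apply_symm_apply,
        ← simpleRefl_eq_refl (not_lt.1 hn), ← mul_assoc, simpleRefl_mul_self, one_mul]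
    · obtain ⟨p, q, h⟩ := ih k
      exact ⟨p, q, by rw [List.eraseIdx_cons_succ, expr_cons, expr_cons, h, mul_assoc]⟩

/-- A reflection that decreases the length is an inversion. -/
theorem IsExpr.exists_inversion {p q : ℤ} (h' : IsExpr n (σ * refl n p q))
    (hlt : ell n (σ * refl n p q) < ell n σ) :
    ∃ p' q', p' < q' ∧ σ q' < σ p' ∧ refl n p q = refl n p' q' := by
  have hd : ¬ (n : ℤ) ∣ p - q := fun hd => by
    have : refl n p q = 1 := by ext r; simp [refl_apply, reflFun, hd]
    rw [this, mul_one] at hlt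
    exact lt_irrefl _ hlt
  have hpq : p ≠ q := fun h => hd (by simp [h])
  -- If `σ` kept `p` and `q` in order, they would be inverted by the product with the reflection;
  -- undoing this inversion would then show that `σ` is the shorter of the two.
  have key : ∀ p q : ℤ, ¬ (n : ℤ) ∣ p - q → IsExpr n (σ * refl n p q) → ell n (σ * refl n p q) < ell n σ → p < q →
      σ q < σ p := fun p q hd h' hlt hpq => by
    rcases perm_lt_or_gt σ hpq.ne with h1 | h1
    · have := (h'.refl_lt hpq (by
        rw [Equiv.Perm.mul_apply, Equiv.Perm.mul_apply, refl_left _ _ hd, refl_right _ _ hd]; exact h1)).2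
      rw [mul_assoc, refl_mul_self, mul_one] at this
      omega
    · exact h1
  rcases lt_or_gt_of_ne hpq with hpq | hpq
  · exact ⟨p, q, hpq, key p q hd h' hlt hpq, rfl⟩
  · rw [refl_comm] at h' hlt ⊢
    exact ⟨q, p, hpq, key q p (by rwa [dvd_sub_comm]) h' hlt hpq, rfl⟩

/-- An expression, with `σ = expr n w e`, is reduced. -/
theorem eraseIdx_inversion {w : List ℤ} {e : ℤ} (hw : w.length = ell n (expr n w e)) {k : ℕ} (hk : k < w.length) :
    ell n (expr n (w.eraseIdx k) e) + 1 ≤ ell n (expr n w e) ∧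
    ∃ p q, p < q ∧ expr n w e q < expr n w e p ∧ expr n (w.eraseIdx k) e = expr n w e * refl n p q := by
  have h1 := ell_expr_le n (w.eraseIdx k) e
  rw [List.length_eraseIdx_of_lt hk] at h1
  obtain ⟨p, q, h⟩ := expr_eraseIdx n w e k
  -- Deleting a letter of a reduced word shortens the permutation, so the reflection involved comes
  -- from an inversion.
  obtain ⟨p', q', h2, h3, h4⟩ := IsExpr.exists_inversion (σ := expr n w e) (p := p) (q := q)
    (h ▸ isExpr_expr _ _ _) (by rw [← h]; omega)
  exact ⟨by omega, p', q', h2, h3, by rw [h, h4]⟩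

/-- A deletion removes an inversion, and this preserves positivity. Hence the sum that defines `d`
loses no term by being taken inside the positive monoid. -/
theorem eraseIdx_pos {w : List ℤ} {e : ℤ} (h : IsAffPos n (expr n w e)) (hw : w.length = ell n (expr n w e)) {k : ℕ}
    (hk : k < w.length) : IsAffPos n (expr n (w.eraseIdx k) e) := by
  obtain ⟨_, p, q, h1, h2, h3⟩ := eraseIdx_inversion hw hk
  rw [h3]
  exact h.mul_refl h1 h2

/-- Write the word as `u a v b x` with the two letters `a`, `b`. Equality of the two deletions reads
`v b x = a v x`; multiplying by the involution `a` gives `a v b x = v x`. -/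
theorem expr_eq_of_eraseIdx_eq {w : List ℤ} {e : ℤ} {j k : ℕ} (hjk : j < k) (hk : k < w.length)
    (h : expr n (w.eraseIdx j) e = expr n (w.eraseIdx k) e) :
    expr n w e = expr n ((w.eraseIdx k).eraseIdx j) e := by
  induction w generalizing j k with
  | nil => simp at hk
  | cons a w ih =>
    obtain ⟨k, rfl⟩ : ∃ k', k = k' + 1 := ⟨k - 1, by omega⟩
    rcases j with _ | j
    · rw [List.eraseIdx_cons_zero, List.eraseIdx_cons_succ, expr_cons] at h
      rw [List.eraseIdx_cons_succ, List.eraseIdx_cons_zero, expr_cons, h, ← mul_assoc, simpleRefl_mul_self, one_mul]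
    · rw [List.eraseIdx_cons_succ, List.eraseIdx_cons_succ, expr_cons, expr_cons] at h
      rw [List.eraseIdx_cons_succ, List.eraseIdx_cons_succ, expr_cons, expr_cons,
        ih (by omega) (by simpa using hk) (mul_left_cancel h)]

/-- Two equal deletions would give an expression of the same permutation with two letters fewer. -/
theorem eraseIdx_injOn {w : List ℤ} {e : ℤ} (hw : w.length = ell n (expr n w e)) {j k : ℕ} (hj : j < w.length)
    (hk : k < w.length) (h : expr n (w.eraseIdx j) e = expr n (w.eraseIdx k) e) : j = k := by
  have key : ∀ {j k : ℕ}, j < k → k < w.length → expr n (w.eraseIdx j) e ≠ expr n (w.eraseIdx k) e := by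
    intro j k hjk hk h
    have h1 := ell_expr_le n ((w.eraseIdx k).eraseIdx j) e
    rw [← expr_eq_of_eraseIdx_eq hjk hk h, ← hw] at h1
    have h2 := List.length_eraseIdx_of_lt hk
    rw [List.length_eraseIdx_of_lt (by omega)] at h1
    omega
  rcases lt_trichotomy j k with hjk | hjk | hjk
  · exact absurd h (key hjk hk)
  · exact hjk
  · exact absurd h.symm (key hjk hj)

theorem exists_eraseIdx_of_sublist {α : Type} {l l' : List α} (h : l.Sublist l') (hl : l.length + 1 = l'.length) :
    ∃ k < l'.length, l = l'.eraseIdx k := by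
  induction h with
  | slnil => simp at hl
  | cons a h _ =>
    refine ⟨0, by simp, ?_⟩
    rw [List.eraseIdx_cons_zero]
    exact h.eq_of_length (by simpa using hl)
  | cons_cons a h ih =>
    obtain ⟨k, hk, e⟩ := ih (by simpa using hl)
    exact ⟨k + 1, by simpa using hk, by rw [List.eraseIdx_cons_succ, ← e]⟩

/-- `BruhatLE` allows any reduced expression. In codimension one a subexpression is a single
deletion, hence the removal of an inversion, and the exchange property realises this removal as a
deletion in the prescribed word `w`. -/
theorem bruhatLE_iff {w : List ℤ} {e : ℤ} (hw : w.length = ell n (expr n w e)) {τ : Equiv.Perm ℤ} :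
    BruhatLE n τ (expr n w e) ∧ ell n τ + 1 = ell n (expr n w e) ↔
    ∃ k < w.length, expr n (w.eraseIdx k) e = τ ∧ ell n τ + 1 = ell n (expr n w e) := by
  constructor
  · rintro ⟨⟨v, v', e', h1, h2, h3, h4⟩, h5⟩
    have h6 := ell_expr_le n v' e'
    rw [h4] at h6
    -- A full subexpression would give `σ` itself. On the other side `v'` has at least `ℓ(σ) - 1`
    -- letters, so exactly one letter is missing.
    have h7 : v'.length ≠ v.length := fun h7 => by
      rw [h3.eq_of_length h7, h1] at h4
      rw [← h4] at h5
      omega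
    have h8 := h3.length_le
    obtain ⟨k, hk, rfl⟩ := exists_eraseIdx_of_sublist h3 (by omega)
    rw [← h1] at h2
    obtain ⟨_, p, q, h9, h10, h11⟩ := eraseIdx_inversion h2 hk
    rw [h1] at h10 h11
    obtain ⟨k', hk', h12⟩ := exchange w e h9 h10
    exact ⟨k', hk', by rw [h12, ← h4, h11], h5⟩
  · rintro ⟨k, hk, h1, h2⟩
    exact ⟨⟨w, w.eraseIdx k, e, rfl, hw, List.eraseIdx_sublist _ _, h1⟩, h2⟩

/-! ### The Leibniz rule and the grading on `Ŝ_n^{+,nil}` -/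

namespace NilAff

theorem map_mulR_of (x a : NilAff n) : map (fun a' => a' * x) (of a) = of (a * x) :=
  map_of (fun a' => a' * x) (zero_mul x) a

theorem map_mulL_of (x a : NilAff n) : map (fun a' => x * a') (of a) = of (x * a) :=
  map_of (fun a' => x * a') (mul_zero x) a

theorem map_mulR_mulR (x y : NilAff n) (v : F2 (NilAff n)) :
    map (fun a => a * y) (map (fun a => a * x) v) = map (fun a => a * (x * y)) v := by
  rw [map_map (fun a => a * x) (fun a => a * y) (zero_mul x) (zero_mul y)]
  simp only [mul_assoc]

theorem map_mulR_mulL (x y : NilAff n) (v : F2 (NilAff n)) :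
    map (fun a => a * y) (map (fun a => x * a) v) = map (fun a => x * a * y) v :=
  map_map (fun a => x * a) (fun a => a * y) (mul_zero x) (zero_mul y) v

theorem map_mulL_mulR (x y : NilAff n) (v : F2 (NilAff n)) :
    map (fun a => x * a) (map (fun a => a * y) v) = map (fun a => x * (a * y)) v :=
  map_map (fun a => a * y) (fun a => x * a) (zero_mul y) (mul_zero x) v

/-- The differential of `T_σ`, computed with a reduced expression of `σ`. -/
theorem d_T_expr {w : List ℤ} {e : ℤ} (h : IsAffPos n (expr n w e)) (hw : w.length = ell n (expr n w e)) :
    d (of (T n (expr n w e))) = ∑ k ∈ Finset.range w.length,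
      if ell n (expr n (w.eraseIdx k) e) + 1 = w.length then of (T n (expr n (w.eraseIdx k) e)) else 0 := by
  have h0 : d (of (T n (expr n w e))) = dT (T n (expr n w e)) := F2.lift_of dT rfl _
  rw [h0, T_of_pos h, ← Finset.sum_filter]
  -- The default value `1` is never reached for `k < w.length`, since deletions stay positive.
  let f : ℕ → AffPos n := fun k =>
    if h : IsAffPos n (expr n (w.eraseIdx k) e) then ⟨_, h⟩ else ⟨1, .one n⟩
  have hf : ∀ k < w.length, (f k).1 = expr n (w.eraseIdx k) e := fun k hk => by
    simp only [f, dif_pos (eraseIdx_pos h hw hk)]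
  -- The summation set is the image of the deletions that lower the length by exactly one; as `f` is
  -- injective on these, the sum over permutations becomes a sum over positions.
  have hS : {τ : AffPos n | BruhatLE n τ.1 (expr n w e) ∧ ell n τ.1 + 1 = ell n (expr n w e)} =
      f '' ↑((Finset.range w.length).filter fun k => ell n (expr n (w.eraseIdx k) e) + 1 = w.length) := by
    ext τ
    rw [Set.mem_ofPred_eq, bruhatLE_iff hw]
    simp only [Finset.coe_filter, Finset.mem_range, Set.mem_image, Set.mem_ofPred_eq]
    constructor
    · rintro ⟨k, hk, h1, h2⟩
      exact ⟨k, ⟨hk, by rw [h1, h2, hw]⟩, Subtype.ext (by rw [hf k hk, h1])⟩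
    · rintro ⟨k, ⟨hk, h1⟩, rfl⟩
      exact ⟨k, hk, (hf k hk).symm, by rw [hf k hk, h1, hw]⟩
  change ∑ᶠ τ ∈ {τ : AffPos n | BruhatLE n τ.1 (expr n w e) ∧ ell n τ.1 + 1 = ell n (expr n w e)}, of (T n τ.1) = _
  rw [hS, finsum_mem_image, finsum_mem_coe_finset]
  · refine Finset.sum_congr rfl fun k hk => ?_
    rw [hf k (Finset.mem_range.1 (Finset.mem_filter.1 hk).1)]
  · intro j hj k hk hjk
    have hj := Finset.mem_range.1 (Finset.mem_filter.1 hj).1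
    have hk := Finset.mem_range.1 (Finset.mem_filter.1 hk).1
    have := congrArg Subtype.val hjk
    rw [hf j hj, hf k hk] at this
    exact eraseIdx_injOn hw hj hk this

/-- Append the letter to a reduced expression of `σ`. Deleting the new letter gives the term `T_σ`;
deleting an old one gives the terms of `d(T_σ)` multiplied by `t_i`. -/
theorem d_T_mul_t_of_lt {i : ℕ} (hi : i + 1 < n) (h : IsAffPos n σ) (hlt : σ (i + 1) < σ (i + 1 + 1)) :
    d (of (T n σ * t n i)) = map (fun a => a * t n i) (d (of (T n σ))) + of (T n σ) := by
  have hn : 2 ≤ n := by omega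
  obtain ⟨w, e, rfl, hw⟩ := h.isExpr.exists_reduced
  have hs := h.isExpr.ell_mul_simpleRefl_of_lt hn hlt
  have h' := h.mul (.simpleRefl hi)
  rw [T_mul_t_of_lt hi h hlt]
  have hm := expr_mul_simpleRefl n w e (i + 1)
  rw [hm] at hs h' ⊢
  rw [d_T_expr h hw, d_T_expr h' (by rw [hs]; simp [hw]), List.length_append, List.length_singleton,
    Finset.sum_range_succ, map_sum]
  congr 1
  · refine Finset.sum_congr rfl fun k hk => ?_
    have hk := Finset.mem_range.1 hk
    have hx := eraseIdx_pos h hw hk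
    have hle := (eraseIdx_inversion hw hk).1
    rw [List.eraseIdx_append_of_lt_length hk, ← expr_mul_simpleRefl]
    by_cases hc : ell n (expr n (w.eraseIdx k) e) + 1 = w.length
    · rw [if_pos hc, map_mulR_of]
      -- If the appended letter lengthens the shortened word, the term survives on both sides; if
      -- not, it is zero on both.
      rcases perm_lt_or_gt (expr n (w.eraseIdx k) e) (a := (i : ℤ) + 1) (b := i + 1 + 1) (by omega) with hlt | hlt
      · rw [T_mul_t_of_lt hi hx hlt, hx.isExpr.ell_mul_simpleRefl_of_lt hn hlt, hc, if_pos rfl]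
      · have := hx.isExpr.ell_mul_simpleRefl_of_gt hn hlt
        rw [T_mul_t_of_gt hi hx hlt, if_neg (by omega), of_zero]
    -- A deletion that lowers the length by more than one cannot be compensated by one appended
    -- letter, so it contributes to neither side.
    · have h1 := hx.isExpr.ell_mul_le (.simpleRefl n (i + 1))
      have h2 := ell_simpleRefl_le n ((i : ℤ) + 1)
      rw [if_neg hc, if_neg (by omega), map_zero]
  · rw [List.eraseIdx_append_of_length_le le_rfl]
    simp [hw]

/-- At a descent write `T_σ = T_τ t_i`. Then `T_σ t_i = 0`, and `d(T_σ) t_i + T_σ = d(T_τ) t_i² +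
T_τ t_i + T_τ t_i` vanishes in characteristic `2`. -/
theorem d_mul_t {i : ℕ} (hi : i + 1 < n) (a : NilAff n) :
    d (of (a * t n i)) = map (fun a => a * t n i) (d (of a)) + of a := by
  induction a using cases_T with
  | h0 => simp
  | h σ h =>
    rcases perm_lt_or_gt σ (a := (i : ℤ) + 1) (b := i + 1 + 1) (by omega) with hlt | hlt
    · exact d_T_mul_t_of_lt hi h hlt
    · have hn : 2 ≤ n := by omega
      have hp := h.mul (.simpleRefl hi)
      have hlt' : (σ * simpleRefl n (i + 1)) (i + 1) < (σ * simpleRefl n (i + 1)) (i + 1 + 1) := by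
        simpa [simpleRefl_self hn, simpleRefl_succ hn] using hlt
      have e : T n σ = T n (σ * simpleRefl n (i + 1)) * t n i := by
        rw [T_mul_t_of_lt hi hp hlt', mul_simpleRefl_mul]
      rw [e, d_T_mul_t_of_lt hi hp hlt', map_add, map_mulR_mulR, map_mulR_of, mul_assoc,
        (nilRel n).sq i hi, mul_zero, of_zero, map_zero, map_zero_fun _ mul_zero, zero_add, F2.add_self]

/-- Right multiplication by `c` only changes the exponent of an expression; lengths and deletions
are untouched. -/
theorem d_mul_c (a : NilAff n) : d (of (a * c n)) = map (fun a => a * c n) (d (of a)) := by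
  rcases eq_or_ne n 0 with rfl | hn
  · rw [map_zero_fun _ (fun a => by rw [c_zero, mul_zero]), c_zero, mul_zero, of_zero, map_zero]
  induction a using cases_T with
  | h0 => simp
  | h σ h =>
    obtain ⟨w, e, rfl, hw⟩ := h.isExpr.exists_reduced
    have h' := h.mul (.shift hn)
    have hl := h.isExpr.ell_mul_shiftPerm
    rw [T_mul_c hn h]
    rw [expr_mul_shiftPerm] at h' hl ⊢
    rw [d_T_expr h hw, d_T_expr h' (by rw [hl, hw]), map_sum]
    refine Finset.sum_congr rfl fun k hk => ?_
    have hx := eraseIdx_pos h hw (Finset.mem_range.1 hk)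
    have hl' := hx.isExpr.ell_mul_shiftPerm
    rw [expr_mul_shiftPerm] at hl'
    rw [hl']
    split_ifs
    · rw [map_mulR_of, T_mul_c hn hx, expr_mul_shiftPerm]
    · rw [map_zero]

theorem d_one : d (of (1 : NilAff n)) = 0 := by
  have h1 : expr n [] 0 = 1 := by simp [expr_nil]
  have := d_T_expr (n := n) (w := []) (e := 0) (by rw [h1]; exact .one n) (by rw [h1, ell_one]; rfl)
  rw [h1, T_one] at this
  simpa using this

theorem d_t {i : ℕ} (hi : i + 1 < n) : d (of (t n i)) = of 1 := by
  have := d_mul_t hi 1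
  rwa [one_mul, d_one, map_zero, zero_add] at this

theorem d_c : d (of (c n)) = 0 := by
  have := d_mul_c (n := n) 1
  rwa [one_mul, d_one, map_zero] at this

/-- Induction on the right factor, so that only right multiplication by a generator has to be known.
-/
theorem leibniz (a b : NilAff n) :
    d (of (a * b)) = map (fun a' => a' * b) (d (of a)) + map (fun b' => a * b') (d (of b)) := by
  induction b using ind with
  | h0 => simp [map_zero_fun]
  | h1 => simp [d_one, map_id]
  | ht b i hi ih =>
    rw [← mul_assoc, d_mul_t hi, ih, d_mul_t hi, map_add, map_add, map_mulR_mulR, map_mulR_mulL, map_mulL_mulR,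
      map_mulL_of, add_assoc]
    simp only [mul_assoc]
  | hc b _ ih =>
    rw [← mul_assoc, d_mul_c, ih, d_mul_c, map_add, map_mulR_mulR, map_mulR_mulL, map_mulL_mulR]
    simp only [mul_assoc]

theorem d_map_t {i : ℕ} (hi : i + 1 < n) (x : F2 (NilAff n)) :
    d (map (fun a => a * t n i) x) = map (fun a => a * t n i) (d x) + x := by
  refine hom_ext_apply (φ := (d (S := NilAff n)).comp (map fun b => b * t n i))
    (ψ := (map fun b => b * t n i).comp d + LinearMap.id) (fun a => ?_) x
  simp only [LinearMap.comp_apply, LinearMap.add_apply, LinearMap.id_apply]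
  rw [map_mulR_of, d_mul_t hi]

theorem d_map_c (x : F2 (NilAff n)) : d (map (fun a => a * c n) x) = map (fun a => a * c n) (d x) := by
  refine hom_ext_apply (φ := (d (S := NilAff n)).comp (map fun b => b * c n))
    (ψ := (map fun b => b * c n).comp d) (fun a => ?_) x
  simp only [LinearMap.comp_apply]
  rw [map_mulR_of, d_mul_c]

theorem d_sq (a : NilAff n) : d (d (of a)) = 0 := by
  induction a using ind with
  | h0 => simp
  | h1 => rw [d_one, map_zero]
  | ht a i hi ih => rw [d_mul_t hi, map_add, d_map_t hi, ih, map_zero, zero_add, F2.add_self]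
  | hc a _ ih => rw [d_mul_c, d_map_c, ih, map_zero]

theorem T_gr {σ : Equiv.Perm ℤ} (h : IsAffPos n σ) : T n σ ∈ gr (S := NilAff n) (-(ell n σ : ℤ)) :=
  Or.inr ⟨⟨σ, h⟩, rfl, rfl⟩

theorem zero_gr (g : ℤ) : (0 : NilAff n) ∈ gr (S := NilAff n) g := Or.inl rfl

theorem one_gr : (1 : NilAff n) ∈ gr (S := NilAff n) 0 := by
  have := T_gr (.one n)
  rwa [ell_one] at this

theorem t_gr {i : ℕ} (hi : i + 1 < n) : t n i ∈ gr (S := NilAff n) (-1) := by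
  have := T_gr (.simpleRefl hi)
  rwa [ell_simpleRefl (by omega)] at this

theorem c_gr : c n ∈ gr (S := NilAff n) 0 := by
  rcases eq_or_ne n 0 with rfl | hn
  · rw [c_zero]; exact zero_gr 0
  · have := T_gr (.shift hn)
    rwa [ell_shiftPerm] at this

theorem mul_gr {p q : ℤ} {a b : NilAff n} (ha : a ∈ gr (S := NilAff n) p) (hb : b ∈ gr (S := NilAff n) q) :
    a * b ∈ gr (S := NilAff n) (p + q) := by
  rcases ha with rfl | ⟨σ, rfl, rfl⟩
  · rw [zero_mul]; exact zero_gr _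
  rcases hb with rfl | ⟨τ, rfl, rfl⟩
  · rw [mul_zero]; exact zero_gr _
  rw [← mul_def, mul_T σ.2 τ.2]
  split_ifs with h
  · have := T_gr (σ.2.mul τ.2)
    rwa [h, Nat.cast_add, neg_add] at this
  · exact zero_gr _

instance : LawfulDGP (NilAff n) where
  zero_mem := zero_gr
  exhaust a := by
    induction a using cases_T with
    | h0 => exact ⟨0, zero_gr 0⟩
    | h σ h => exact ⟨_, T_gr h⟩
  separated := by
    rintro g h a (ha | ⟨σ, rfl, hu⟩) (ha' | ⟨τ, hv, hv'⟩) hgh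
    · exact ha
    · exact ha
    · exact ha'
    · rw [T_injective σ.2 τ.2 hv] at hu
      exact absurd (hu.symm.trans hv') hgh
  d_sq x := by
    refine NilGlue.F2.hom_ext_apply (φ := d.comp d) (ψ := 0) (fun w => ?_) x
    exact d_sq w
  d_gr := by
    rintro g a (rfl | ⟨⟨σ, h⟩, rfl, rfl⟩)
    · simp
    · obtain ⟨w, e, rfl, hw⟩ := h.isExpr.exists_reduced
      rw [d_T_expr h hw]
      refine Submodule.sum_mem _ fun k hk => ?_
      split_ifs with hc
      · refine of_mem_on ?_
        have := T_gr (eraseIdx_pos h hw (Finset.mem_range.1 hk))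
        convert this using 2
        change -(ell n (expr n w e) : ℤ) + 1 = _
        omega
      · exact Submodule.zero_mem _

end NilAff

/-! ## Boundedness -/

/-- Conjugating the reflection in `(p, q - n)` by the one in `(p, q)` gives that in `(q, p - n)`,
which is also that in `(p, q + n)`. This turns one distant reflection into two successive ones in
`ell_refl_far`. -/
theorem refl_mul_refl_shift (n : ℕ) {p q : ℤ} (hd : ¬ (n : ℤ) ∣ p - q) :
    refl n p (q + n) * refl n p q = refl n p q * refl n p (q - n) := by
  have e : refl n p q (q - n) = p - n := by rw [(IsAff.refl n p q).sub, refl_right _ _ hd]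
  have h := (IsAff.refl n p q).mul_refl p (q - n)
  rw [refl_left _ _ hd, e] at h
  have h' := refl_of_dvd_sub (n := n) q (p - n) n dvd_rfl
  rw [sub_add_cancel] at h'
  rw [h, refl_comm n p, h']

theorem IsAff.not_dvd (h : IsAff n σ) {p q : ℤ} (hpq : p < q) (hlt : σ q < σ p) : ¬ (n : ℤ) ∣ p - q := fun hd => by
  have := h.apply_of_dvd hd
  omega

theorem ell_simpleRefl_mul_le (a : ℤ) (h : IsExpr n σ) : ell n (simpleRefl n a * σ) ≤ ell n σ + 1 := by
  have h1 := (IsExpr.simpleRefl n a).ell_mul_le h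
  have := ell_simpleRefl_le n a
  omega

/-- Let `s_a` be the letter that creates the inversion and `x` the part of the word after it. Then
`x q = x p + 1`, and `s_a x` times the first reflection is `x`, one letter less. Moreover `x (q - n)
= x p + 1 - n < x p`, so the second reflection removes an inversion of `x` and costs another letter.
-/
theorem ell_two_refl (w : List ℤ) (e : ℤ) {p q : ℤ} (hpq : p < q - n) (h : expr n w e q < expr n w e p) :
    IsExpr n (expr n w e * refl n p q * refl n p (q - n)) ∧
      ell n (expr n w e * refl n p q * refl n p (q - n)) + 2 ≤ w.length := by
  induction w with
  | nil =>
    rw [expr_nil, shiftPerm_zpow_apply, shiftPerm_zpow_apply] at h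
    omega
  | cons a w ih =>
    have hx := IsAff.expr n w e
    by_cases h' : expr n w e q < expr n w e p
    · obtain ⟨h1, h2⟩ := ih h'
      have := ell_simpleRefl_mul_le a h1
      rw [expr_cons, mul_assoc, mul_assoc, ← mul_assoc (expr n w e), List.length_cons]
      exact ⟨(IsExpr.simpleRefl n a).mul h1, by omega⟩
    · have hlt : expr n w e p < expr n w e q :=
        lt_of_le_of_ne (not_lt.1 h') fun h0 => absurd ((expr n w e).injective h0) (by omega)
      have hnd := (IsAff.expr n (a :: w) e).not_dvd (by omega) h
      rw [expr_cons] at h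
      obtain ⟨e1, e2⟩ := hx.simpleRefl_mul_of_flip hlt h
      have hq := hx.sub q
      have hn : (n : ℤ) ≠ 1 := fun hn => hnd (by rw [hn]; exact one_dvd _)
      have hn' : expr n w e (q - n) ≠ expr n w e p := fun h0 => absurd ((expr n w e).injective h0) (by omega)
      rcases Nat.eq_zero_or_pos n with h0 | h0
      · rw [simpleRefl_of_lt (by omega)] at h
        exact absurd hlt h.not_gt
      obtain ⟨h1, h2⟩ := (isExpr_expr n w e).refl_lt (p := p) (q := q - n) hpq (by omega)
      have h3 := ell_expr_le n w e
      rw [expr_cons, e2, mul_assoc (expr n w e), refl_mul_self, mul_one, List.length_cons]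
      exact ⟨h1, by omega⟩

/-- The hypothesis on values says that `p` and `q + n` are inverted. Let `s_a` be the letter that
creates this inversion, and `x` what follows it. Then `s_a x` is `x` times the reflection in `(p, q
+ n)`; by `refl_mul_refl_shift` the product to estimate is `x` times the reflections in `(p, q)` and
`(p, q - n)`, and `ell_two_refl` saves two letters besides `s_a`. Such a reflection therefore never
contributes to `d`. -/
theorem ell_refl_far (w : List ℤ) (e : ℤ) {p q : ℤ} (hpq : p < q - n) (h : expr n w e q + n < expr n w e p) :
    IsExpr n (expr n w e * refl n p q) ∧ ell n (expr n w e * refl n p q) + 3 ≤ w.length := by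
  induction w with
  | nil =>
    rw [expr_nil, shiftPerm_zpow_apply, shiftPerm_zpow_apply] at h
    omega
  | cons a w ih =>
    have hx := IsAff.expr n w e
    by_cases h' : expr n w e q + n < expr n w e p
    · obtain ⟨h1, h2⟩ := ih h'
      have := ell_simpleRefl_mul_le a h1
      rw [expr_cons, mul_assoc, List.length_cons]
      exact ⟨(IsExpr.simpleRefl n a).mul h1, by omega⟩
    · rw [← hx] at h'
      have hlt : expr n w e p < expr n w e (q + n) :=
        lt_of_le_of_ne (not_lt.1 h') fun h0 => absurd ((expr n w e).injective h0) (by omega)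
      have hnd := (IsAff.expr n (a :: w) e).not_dvd (p := p) (q := q) (by omega) (by omega)
      rw [← IsAff.expr n (a :: w) e, expr_cons] at h
      obtain ⟨e1, e2⟩ := hx.simpleRefl_mul_of_flip hlt h
      rw [hx] at e1
      rcases Nat.lt_or_ge n 2 with h0 | h0
      · rw [simpleRefl_of_lt h0] at h
        exact absurd hlt h.not_gt
      obtain ⟨h1, h2⟩ := ell_two_refl w e hpq (by omega)
      rw [expr_cons, e2, mul_assoc (expr n w e), refl_mul_refl_shift n hnd, ← mul_assoc, List.length_cons]
      exact ⟨h1, by omega⟩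

theorem card_support_le {S : Type} [Zero S] (B : Finset S) {x : F2 S} (hx : x ∈ on (B : Set S)) :
    x.support.card ≤ B.card := by
  refine Finset.card_le_card_of_injOn Subtype.val (fun s hs => ?_) Subtype.val_injective.injOn
  exact (Finsupp.mem_supported _ _).1 hx hs

/-- Terms of `d(T_σ)` come from inversions `(p, q)`, which may be translated so that `0 ≤ p < n`. By
`ell_refl_far`, either `q - p < n` or `σ p - σ q < n`. In each case `q` takes at most `n` values for
a given `p`, which bounds the number of terms by `2n²`, independently of `σ`. -/
theorem NilAff.bounded (n : ℕ) : Bounded (NilAff n) := by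
  refine ⟨n * (n * 2) + 1, fun a => Nat.lt_succ_of_le ?_⟩
  induction a using NilAff.cases_T with
  | h0 => simp
  | h σ h =>
    -- The Boolean tells whether the second entry records `q - p` or `σ p - σ q`.
    let f : ℕ × ℕ × Bool → NilAff n := fun x => T n (σ * refl n x.1
      (if x.2.2 then (x.1 : ℤ) + x.2.1 else σ⁻¹ (σ x.1 - x.2.1)))
    let I : Finset (ℕ × ℕ × Bool) := Finset.range n ×ˢ (Finset.range n ×ˢ Finset.univ)
    have hI : (I.image f).card ≤ n * (n * 2) := Finset.card_image_le.trans (by simp [I])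
    refine (card_support_le (I.image f) ?_).trans hI
    obtain ⟨w, e, he, hw⟩ := h.isExpr.exists_reduced
    subst he
    rw [d_T_expr h hw]
    refine Submodule.sum_mem _ fun k hk => ?_
    split_ifs with hc
    swap
    · exact Submodule.zero_mem _
    refine of_mem_on ?_
    obtain ⟨_, p, q, hpq, hlt, hx⟩ := eraseIdx_inversion hw (Finset.mem_range.1 hk)
    have haff := IsAff.expr n w e
    have hn : 0 < n := Nat.pos_of_ne_zero fun hn => by
      rw [h.2.2 hn] at hlt
      exact absurd hpq hlt.not_gt
    have hm := Int.emod_add_mul_ediv p n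
    have hm0 := Int.emod_nonneg p (b := n) (by omega)
    have hm1 := Int.emod_lt_of_pos p (b := n) (by omega)
    obtain ⟨i, hi⟩ := Int.eq_ofNat_of_zero_le hm0
    have hp : p = i + n * (p / n) := by rw [← hi]; exact hm.symm
    obtain ⟨q', hq⟩ : ∃ q', q = q' + n * (p / n) := ⟨q - n * (p / n), by ring⟩
    rw [hp, hq, refl_of_dvd_sub _ _ _ (Dvd.intro _ rfl)] at hx
    have e1 := haff.add_mul i (p / n)
    have e2 := haff.add_mul q' (p / n)
    rw [hp, hq, e1, e2] at hlt
    have hpq' : (i : ℤ) < q' := by rw [hp, hq] at hpq; omega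
    have hlt' : expr n w e q' < expr n w e i := by omega
    have hin : i < n := by omega
    rw [hx] at hc ⊢
    simp only [Finset.coe_image, Set.mem_image, Finset.mem_coe]
    by_cases c1 : q' < i + n
    · obtain ⟨j, hj⟩ := Int.eq_ofNat_of_zero_le (a := q' - i) (by omega)
      refine ⟨(i, j, true), by simp [I]; omega, ?_⟩
      simp only [f, if_true]
      rw [← hj, add_sub_cancel]
    by_cases c2 : expr n w e i < expr n w e q' + n
    · obtain ⟨j, hj⟩ := Int.eq_ofNat_of_zero_le (a := expr n w e i - expr n w e q') (by omega)
      refine ⟨(i, j, false), by simp [I]; omega, ?_⟩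
      simp only [f]
      rw [← hj, if_neg (by simp), sub_sub_cancel, Equiv.Perm.inv_def, Equiv.symm_apply_apply]
    -- `ell_refl_far` needs strict inequalities. In the two boundary cases `q'` would be congruent
    -- to `i`, and such a pair is never inverted.
    · have c3 : q' ≠ i + n := fun c3 => by
        have := haff i
        rw [← c3] at this
        omega
      have c4 : expr n w e i ≠ expr n w e q' + n := fun c4 => by
        rw [← haff] at c4
        have := (expr n w e).injective c4
        omega
      have := (ell_refl_far (n := n) w e (p := i) (q := q') (by omega) (by omega)).2
      omega

/-! ## The category `ℋ^+` -/

namespace catH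

theorem zero_comp {x y z : ℕ} (g : catH.mor y z) : catH.comp (0 : catH.mor x y) g = 0 := by
  change Diag.mk (x = z) (if _ then NilAff.mul (0 : NilAff x) _ else 0) = 0
  simp [NilAff.mul_def]

theorem comp_zero {x y z : ℕ} (f : catH.mor x y) : catH.comp f (0 : catH.mor y z) = 0 := by
  change Diag.mk (x = z) (if _ then NilAff.mul _ (tr NilAff y x (0 : NilAff y)) else 0) = 0
  simp [NilAff.mul_def]

theorem eq_or (x y : ℕ) (f : catH.mor x y) : f = 0 ∨ x = y := Diag.cases f

theorem val_elH {n : ℕ} (a : NilAff n) : valH (elH a) = a := Diag.mk_val rfl _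

theorem elH_val {n : ℕ} (a : catH.mor n n) : elH (valH a) = a := Diag.mk_eta _

@[simp] theorem elH_zero {n : ℕ} : elH (0 : NilAff n) = 0 := Diag.mk_zero

theorem elH_comp {n : ℕ} (a b : NilAff n) : catH.comp (elH a) (elH b) = elH (a * b) := by
  change Diag.mk (n = n) (if n = n ∧ n = n then NilAff.mul (elH a).val (tr NilAff n n (elH b).val) else 0) = _
  rw [if_pos ⟨rfl, rfl⟩, tr_self]
  change Diag.mk _ (valH (elH a) * valH (elH b)) = _
  rw [val_elH, val_elH]
  rfl

theorem one_eq (n : ℕ) : catH.one n = elH 1 := rfl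

theorem ind {n : ℕ} {P : catH.mor n n → Prop} (h : ∀ a, P (elH a)) (f : catH.mor n n) : P f := by
  rw [← elH_val f]; exact h _

theorem elH_gr {n : ℕ} {g : ℤ} {a : NilAff n} : elH a ∈ gr (S := catH.mor n n) g ↔ a ∈ gr (S := NilAff n) g := by
  change valH (elH a) ∈ gr (S := NilAff n) g ↔ _
  rw [val_elH]

theorem d_elH {n : ℕ} (a : NilAff n) : d (of (elH a)) = map elH (d (of a)) :=
  (Diag.d_of _).trans (by
    change map (Diag.mk (n = n)) (d (of (valH (elH a)))) = _
    rw [val_elH]; rfl)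

instance : catH.Lawful where
  lawful x y := inferInstanceAs (LawfulDGP (Diag (x = y) (NilAff x)))
  zero_comp := zero_comp
  comp_zero := comp_zero
  one_comp := fun {x y} f => by
    rcases eq_or x y f with rfl | rfl
    · exact comp_zero _
    induction f using ind with | h a =>
    rw [one_eq, elH_comp, one_mul]
  comp_one := fun {x y} f => by
    rcases eq_or x y f with rfl | rfl
    · exact zero_comp _
    induction f using ind with | h a =>
    rw [one_eq, elH_comp, mul_one]
  assoc := fun {x y z w} f g h => by
    rcases eq_or _ _ f with rfl | rfl
    · simp only [zero_comp]
    rcases eq_or _ _ g with rfl | rfl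
    · simp only [zero_comp, comp_zero]
    rcases eq_or _ _ h with rfl | rfl
    · simp only [comp_zero]
    induction f using ind with | h a =>
    induction g using ind with | h b =>
    induction h using ind with | h c =>
    simp only [elH_comp, mul_assoc]
  one_gr x := elH_gr.2 NilAff.one_gr
  comp_gr := fun {x y z p q f g} hf hg => by
    rcases eq_or _ _ f with rfl | rfl
    · rw [zero_comp]; exact Or.inl rfl
    rcases eq_or _ _ g with rfl | rfl
    · rw [comp_zero]; exact Or.inl rfl
    induction f using ind with | h a =>
    induction g using ind with | h b =>
    rw [elH_comp]
    exact elH_gr.2 (NilAff.mul_gr (elH_gr.1 hf) (elH_gr.1 hg))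
  leibniz := fun {x y z} f g => by
    rcases eq_or _ _ f with rfl | rfl
    · simp [zero_comp, map_zero_fun]
    rcases eq_or _ _ g with rfl | rfl
    · simp [comp_zero, map_zero_fun]
    induction f using ind with | h a =>
    induction g using ind with | h b =>
    rw [elH_comp, d_elH, d_elH, d_elH, NilAff.leibniz, map_add,
      map_map elH (fun f' => catH.comp f' (elH b)) elH_zero (zero_comp _),
      map_map elH (fun g' => catH.comp (elH a) g') elH_zero (comp_zero _),
      map_map (fun a' => a' * b) elH (zero_mul b) elH_zero, map_map (fun b' => a * b') elH (mul_zero a) elH_zero]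
    simp only [elH_comp]

end catH

/-- Basis elements may merge or cancel under `map f`, but none outside the image of the support
appears. -/
theorem card_support_map_le {S T : Type} [Zero S] [Zero T] (f : S → T) (x : F2 S) :
    (map f x).support.card ≤ x.support.card := by
  have h : map f x ∈ on (((x.support.image fun s => f s.1) : Finset T) : Set T) := by
    rw [map, F2.lift, Finsupp.linearCombination_apply]
    refine Submodule.sum_mem _ fun s hs => Submodule.smul_mem _ _ (of_mem_on ?_)
    exact Finset.mem_coe.2 (Finset.mem_image_of_mem _ hs)
  exact (card_support_le _ h).trans Finset.card_image_le

theorem catH.isDGPointedCategory : catH.IsDGPointedCategory := by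
  refine ⟨inferInstance, fun x y => ?_⟩
  obtain ⟨N, hN⟩ := NilAff.bounded x
  refine ⟨N, fun f => ?_⟩
  have h : d (of f) = map (Diag.mk (x = y)) (d (of (Diag.val f : NilAff x))) := Diag.d_of f
  rw [h]
  exact (card_support_map_le _ _).trans_lt (hN _)

/-- A category isomorphic to a differential graded pointed category is one. -/
theorem DPCat.Iso.isDGPointedCategory {O : Type} {C D : DPCat O} (Φ : DPCat.Iso C D) (hD : D.IsDGPointedCategory) :
    C.IsDGPointedCategory := by
  obtain ⟨hD, hb⟩ := hD
  -- Each axiom for `C` can be checked after applying the bijections of `Φ`. For the diagonal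
  -- category, boundedness in particular is inherited from `ℋ^+`.
  have hinj : ∀ {x y : O} {f g : C.mor x y}, Φ.toEquiv x y f = Φ.toEquiv x y g → f = g :=
    fun h => (Φ.toEquiv _ _).injective h
  have hmap : ∀ {x y : O} {a b : F2 (C.mor x y)}, map (Φ.toEquiv x y) a = map (Φ.toEquiv x y) b → a = b := by
    intro x y a b h
    have h0 : (Φ.toEquiv x y).symm 0 = 0 := by rw [Equiv.symm_apply_eq, Φ.map_zero]
    have := congrArg (map (Φ.toEquiv x y).symm) h
    rw [map_map _ _ (Φ.map_zero x y) h0, map_map _ _ (Φ.map_zero x y) h0] at this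
    simpa only [Equiv.symm_apply_apply, map_id] using this
  have hd : ∀ {x y : O} (a : F2 (C.mor x y)), d (map (Φ.toEquiv x y) a) = map (Φ.toEquiv x y) (d a) := by
    intro x y a
    refine hom_ext_apply (φ := (d (S := D.mor x y)).comp (map (Φ.toEquiv x y)))
      (ψ := (map (Φ.toEquiv x y)).comp d) (fun f => ?_) a
    simp only [LinearMap.comp_apply]
    rw [map_of _ (Φ.map_zero x y), Φ.map_d]
  have hzc : ∀ {x y z : O} (g : C.mor y z), C.comp (0 : C.mor x y) g = 0 := fun g => hinj (by
    rw [Φ.map_comp, Φ.map_zero, Φ.map_zero, hD.zero_comp])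
  have hcz : ∀ {x y z : O} (f : C.mor x y), C.comp f (0 : C.mor y z) = 0 := fun g => hinj (by
    rw [Φ.map_comp, Φ.map_zero, Φ.map_zero, hD.comp_zero])
  have hsymm : ∀ {x y : O} {g : ℤ} {a : F2 (C.mor x y)}, map (Φ.toEquiv x y) a ∈ on (gr (S := D.mor x y) g) →
      a ∈ on (gr (S := C.mor x y) g) := by
    intro x y g a h
    have h0 : (Φ.toEquiv x y).symm 0 = 0 := by rw [Equiv.symm_apply_eq, Φ.map_zero]
    have := map_mem_on (B := gr (S := C.mor x y) g) (Φ.toEquiv x y).symm h0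
      (fun s hs => by rw [← Φ.map_gr, Equiv.apply_symm_apply]; exact hs) h
    rw [map_map _ _ (Φ.map_zero x y) h0] at this
    simpa only [Equiv.symm_apply_apply, map_id] using this
  refine ⟨?_, fun x y => ?_⟩
  · refine
      { lawful := fun x y => ?_
        zero_comp := hzc
        comp_zero := hcz
        one_comp := fun f => hinj (by rw [Φ.map_comp, Φ.map_one, hD.one_comp])
        comp_one := fun f => hinj (by rw [Φ.map_comp, Φ.map_one, hD.comp_one])
        assoc := fun f g h => hinj (by simp only [Φ.map_comp, hD.assoc])
        one_gr := fun x => by rw [← Φ.map_gr, Φ.map_one]; exact hD.one_gr x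
        comp_gr := fun hf hg => by
          rw [← Φ.map_gr] at hf hg ⊢
          rw [Φ.map_comp]
          exact hD.comp_gr hf hg
        leibniz := fun {x y z} f g => hmap (by
          rw [← Φ.map_d, Φ.map_comp, hD.leibniz, Φ.map_d, Φ.map_d, map_add,
            map_map _ (fun f' => D.comp f' _) (Φ.map_zero x y) (hD.zero_comp _),
            map_map _ (fun g' => D.comp _ g') (Φ.map_zero y z) (hD.comp_zero _),
            map_map (fun f' => C.comp f' g) _ (hzc g) (Φ.map_zero x z),
            map_map (fun g' => C.comp f g') _ (hcz f) (Φ.map_zero x z)]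
          simp only [Φ.map_comp]) }
    have hL := hD.lawful x y
    exact
      { zero_mem := fun g => by rw [← Φ.map_gr, Φ.map_zero]; exact hL.zero_mem g
        exhaust := fun s => by
          obtain ⟨g, hg⟩ := hL.exhaust (Φ.toEquiv x y s)
          exact ⟨g, (Φ.map_gr g s).1 hg⟩
        separated := fun {g h s} hg hh hgh => hinj (by
          rw [Φ.map_zero]
          exact hL.separated ((Φ.map_gr g s).2 hg) ((Φ.map_gr h s).2 hh) hgh)
        d_sq := fun a => hmap (by rw [← hd, ← hd, hL.d_sq, _root_.map_zero])
        d_gr := fun {g s} hs => hsymm (by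
          rw [← Φ.map_d]
          exact hL.d_gr ((Φ.map_gr g s).2 hs)) }
  · obtain ⟨N, hN⟩ := hb x y
    refine ⟨N, fun s => ?_⟩
    have h0 : (Φ.toEquiv x y).symm 0 = 0 := by rw [Equiv.symm_apply_eq, Φ.map_zero]
    have : d (of s) = map (Φ.toEquiv x y).symm (d (of (Φ.toEquiv x y s))) := by
      rw [Φ.map_d, map_map _ _ (Φ.map_zero x y) h0]
      simp only [Equiv.symm_apply_apply, map_id]
    rw [this]
    exact (card_support_map_le _ _).trans_lt (hN _)

/-! ## The nil Hecke monoid inside the positive affine nil Hecke monoid -/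

/-- The morphism of pointed monoids `H_n^• → A` determined by the `t_i`. -/
def NilRel.nh {n : ℕ} {A : Type} [MonoidWithZero A] {t : ℕ → A} {c : A} (hR : NilRel n t c) : NH n →* A :=
  -- `NH.lift` takes a value at every natural number, while the relations of `NilRel` hold only for
  -- letters below `n`; the others are sent to `0`.
  NH.lift (fun i => if i + 1 < n then t i else 0)
    (fun i => by
      by_cases h : i + 1 < n
      · rw [if_pos h, hR.sq i h]
      · rw [if_neg h, mul_zero])
    (fun i j hij => by
      by_cases h : j + 1 < n
      · rw [if_pos h, if_pos (by omega), hR.comm i j hij h]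
      · rw [if_neg h, mul_zero, zero_mul])
    (fun i => by
      by_cases h : i + 1 + 1 < n
      · rw [if_pos h, if_pos (by omega), hR.braid i h]
      · rw [if_neg h, mul_zero, zero_mul, zero_mul])

theorem NilRel.nh_T {n : ℕ} {A : Type} [MonoidWithZero A] {t : ℕ → A} {c : A} (hR : NilRel n t c) {i : ℕ}
    (hi : i + 1 < n) : hR.nh (NH.T n i) = t i :=
  (NH.lift_T ⟨i, hi⟩).trans (if_pos hi)

theorem NilRel.nh_zero {n : ℕ} {A : Type} [MonoidWithZero A] {t : ℕ → A} {c : A} (hR : NilRel n t c) :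
    hR.nh 0 = 0 := NH.lift_zero

/-- A pointed morphism of monoids on `H_n^•` is determined by the images of the generators. -/
theorem NH.hom_ext {n : ℕ} {A : Type} [MonoidWithZero A] {f g : NH n → A} (f0 : f 0 = 0) (g0 : g 0 = 0) (f1 : f 1 = 1)
    (g1 : g 1 = 1) (fm : ∀ a b, f (a * b) = f a * f b) (gm : ∀ a b, g (a * b) = g a * g b)
    (h : ∀ i, i + 1 < n → f (NH.T n i) = g (NH.T n i)) (a : NH n) : f a = g a := by
  induction a using NH.ind with
  | h0 => rw [f0, g0]
  | h1 => rw [f1, g1]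
  | h i a ih => rw [fm, gm, ih, h i.1 i.2]

/-- The morphism `H_n^• → Ŝ_n^{+,nil}`, `T_i ↦ T_{s_i}`. -/
def incH (n : ℕ) : NH n →* NilAff n := (NilAff.nilRel n).nh

theorem incH_zero (n : ℕ) : incH n 0 = 0 := (NilAff.nilRel n).nh_zero

theorem incH_T {n i : ℕ} (hi : i + 1 < n) : incH n (NH.T n i) = NilAff.t n i := (NilAff.nilRel n).nh_T hi

/-- Both differentials obey the Leibniz rule and equal `1` on each generator. -/
theorem d_incH {n : ℕ} (a : NH n) : d (of (incH n a)) = map (incH n) (d (of a)) := by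
  induction a using NH.ind with
  | h0 => rw [incH_zero]; simp
  | h1 => rw [map_one, NilAff.d_one, NH.d_one, map_zero]
  | h i a ih =>
    rw [map_mul, incH_T i.2, NilAff.leibniz, NilAff.d_t i.2, NilAff.map_mulR_of, one_mul, NH.d_T_mul, map_add,
      map_of _ (incH_zero n), ih, map_map _ _ (incH_zero n) (mul_zero _), map_map _ _ (mul_zero _) (incH_zero n)]
    simp only [map_mul, incH_T i.2]

theorem incH_gr {n : ℕ} {g : ℤ} {a : NH n} (h : a ∈ gr g) : incH n a ∈ gr (S := NilAff n) g := by
  rcases h with rfl | ⟨w, rfl, rfl⟩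
  · rw [incH_zero]; exact NilAff.zero_gr _
  · induction w using FreeMonoid.inductionOn' with
    | one => rw [NH.word_one, map_one]; exact NilAff.one_gr
    | of_mul i w ih =>
      rw [NH.word_mul, map_mul, ← NH.T_idx, incH_T i.2]
      have := NilAff.mul_gr (NilAff.t_gr i.2) ih
      convert this using 1
      simp [FreeMonoid.length_mul, add_comm]

/-- `f_1(h) c = c h` for `h ∈ H_{n-1}^•`. -/
theorem NilRel.nh_shift {n : ℕ} {A : Type} [MonoidWithZero A] {t : ℕ → A} {c : A} (hR : NilRel (n + 1) t c)
    (h : NH n) : hR.nh (NH.sh 1 n (n + 1) h) * c = c * hR.nh (NH.sh 0 n (n + 1) h) := by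
  induction h using NH.ind with
  | h0 => rw [NH.sh_zero, NH.sh_zero, hR.nh_zero, zero_mul, mul_zero]
  | h1 => rw [map_one, map_one, map_one, map_one, one_mul, mul_one]
  | h i a ih =>
    have := i.2
    rw [map_mul, map_mul, map_mul, map_mul, NH.sh_T, NH.sh_T, hR.nh_T (by omega), hR.nh_T (by omega), mul_assoc, ih,
      ← mul_assoc, hR.shift i.1 (by omega), add_zero, mul_assoc]

/-! ## The composition of the tensor category -/

section Tensor

variable {O : Type} {V : DPCat O} [V.Lawful] (M : Bimod V)

theorem tmul_act {x x' y z : O} (f : V.mor x' x) (s : (tensL M y).car x) (t : (tensL M z).car y) :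
    tmul M ((tensL M y).act f s) t = (tensL M z).act f (tmul M s t) := by
  induction s using tens_ind with
  | h i w => rw [tens_act_incl, tmul_incl, tmul_incl, (rmul M t i).map_act]

theorem tmul_cons {x x' y z : O} (m : M.car x' x) (s : (tensL M y).car x) (t : (tensL M z).car y) :
    tmul M (cons M m s) t = cons M m (tmul M s t) := by
  induction s using tens_ind with
  | h i w => rw [cons_incl, tmul_incl, tmul_incl, rmul_powCons]

/-- The map given by `f` in the tensor category. -/
def incl0 {x y : O} (f : V.mor x y) : (tensL M y).car x := incl M 0 f

theorem tmul_incl0 {x y z : O} (f : V.mor x y) (t : (tensL M z).car y) :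
    tmul M (incl0 M f) t = (tensL M z).act f t := tmul_incl M 0 _ t

theorem act_incl0 {x y z : O} (f : V.mor x y) (g : V.mor y z) :
    (tensL M z).act f (incl0 M g) = incl0 M (V.comp f g) := tens_act_incl M f 0 g

theorem incl0_zero {x y : O} : incl0 M (0 : V.mor x y) = 0 := incl_zero M 0

theorem d_incl0 {x y : O} (f : V.mor x y) : d (of (incl0 M f)) = map (incl0 M) (d (of f)) := d_incl M 0 f

/-- Every map of the tensor category is obtained from a map of `V` by composing successively with
elements of `M`. The predicate depends on the object `x` because each such composition changes it.
-/
theorem tens_cons_ind {z : O} {P : ∀ x, (tensL M z).car x → Prop} (h0 : ∀ x, P x 0)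
    (h1 : ∀ x (f : V.mor x z), P x (incl0 M f))
    (h : ∀ x y (m : M.car x y) (t : (tensL M z).car y), P y t → P x (cons M m t)) {x : O} (t : (tensL M z).car x) :
    P x t := by
  induction t using tens_ind with
  | h i w =>
    induction i generalizing x with
    | zero => exact h1 x w
    | succ i ih =>
      induction w using pow_succ_ind with
      | h0 => rw [incl_zero]; exact h0 x
      | h y m w => rw [← cons_incl]; exact h _ _ _ _ (ih w)

theorem tmul_assoc {x y z u : O} (r : (tensL M y).car x) (s : (tensL M z).car y) (t : (tensL M u).car z) :
    tmul M (tmul M r s) t = tmul M r (tmul M s t) := by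
  induction r using tens_cons_ind with
  | h0 x => rfl
  | h1 x f => rw [tmul_incl0, tmul_incl0, tmul_act]
  | h x y' m r ih => rw [tmul_cons, tmul_cons, tmul_cons, ih]

theorem one_tmul {x z : O} (t : (tensL M z).car x) : tmul M (incl0 M (V.one x)) t = t :=
  (tmul_incl0 M _ t).trans ((tensL M z).one_act t)

theorem tmul_one {x z : O} (t : (tensL M z).car x) : tmul M t (incl0 M (V.one z)) = t := by
  induction t using tens_cons_ind with
  | h0 x => rfl
  | h1 x f => rw [tmul_incl0, act_incl0, DPCat.Lawful.comp_one]
  | h x y m t ih => rw [tmul_cons, ih]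

theorem cons_incl0 {x y z : O} (m : M.car x y) (f : V.mor y z) :
    cons M m (incl0 M f) = cons M (M.ract m f) (incl0 M (V.one z)) := by
  rw [cons_ract, act_incl0, DPCat.Lawful.comp_one]

/-- The gluing relations are written with `GlueDatum.sq`, whereas products are computed with `cons`;
this passes from one to the other. -/
theorem cons_cons_incl0 {x y z : O} (m : M.car x y) (n : M.car y z) :
    cons M m (cons M n (incl0 M (V.one z))) = incl M 2 (GlueDatum.sq M m n) :=
  (congrArg _ (cons_incl M n 0 (powOne M z))).trans (cons_incl M m 1 _)

theorem cons_gr {x y z : O} {p q : ℤ} {m : M.car x y} {t : (tensL M z).car y} (hm : m ∈ gr p) (ht : t ∈ gr q) :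
    cons M m t ∈ gr (S := (tensL M z).car x) (p + q) := by
  obtain ⟨i, w, hw, rfl⟩ := ht
  exact ⟨i + 1, powCons M m i w, Or.inr ⟨p, q, y, m, w, rfl, hm, hw, rfl⟩, cons_incl M m i w⟩

theorem tmul_gr {x y z : O} {p q : ℤ} {s : (tensL M y).car x} {t : (tensL M z).car y} (hs : s ∈ gr p) (ht : t ∈ gr q) :
    tmul M s t ∈ gr (S := (tensL M z).car x) (p + q) := by
  obtain ⟨i, w, hw, rfl⟩ := hs
  change tmul M (incl M i w) t ∈ _
  induction i generalizing x p with
  | zero => rw [tmul_incl]; exact (tensL M z).act_gr hw ht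
  | succ i ih =>
    rcases hw with rfl | ⟨p', q', y', m, w, rfl, hm, hw, rfl⟩
    · change tmul M (incl M (i + 1) 0) t ∈ _
      rw [incl_zero]
      exact LawfulDGP.zero_mem _
    · change tmul M (incl M (i + 1) (powCons M m i w)) t ∈ _
      rw [← cons_incl, tmul_cons, add_assoc]
      exact cons_gr M hm (ih w hw)

end Tensor

/-! ### The differential of a quotient category -/

section Quotient

variable {O : Type} (C : DPCat O) (R : ∀ x y, C.mor x y → C.mor x y → Prop)
  (h : ∀ x y (a b : C.mor x y), Cong C R x y a b → map (qmk C R) (d (of a)) = map (qmk C R) (d (of b)))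

theorem d_qmk {x y : O} (a : C.mor x y) :
    d (S := (quotCat C R (h _ _ _ _)).mor x y) (of (S := (quotCat C R (h _ _ _ _)).mor x y) (qmk C R a)) = map (T := (quotCat C R (h _ _ _ _)).mor x y) (qmk C R) (d (of a)) :=
  F2.lift_of (S := QMor C R x y) (Quot.lift (fun a => map (qmk C R) (d (of a))) fun _ _ r => h _ _ _ _ r) (by
    change map (qmk C R) (d (of (0 : C.mor x y))) = 0
    rw [of_zero, map_zero, map_zero]) (qmk _ _ a)

theorem quotCat_leibniz (hz : ∀ {x y z} (g : C.mor y z), C.comp (0 : C.mor x y) g = 0)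
    (hz' : ∀ {x y z} (f : C.mor x y), C.comp f (0 : C.mor y z) = 0)
    (hl : ∀ {x y z} (f : C.mor x y) (g : C.mor y z), d (of (C.comp f g)) =
      map (fun f' => C.comp f' g) (d (of f)) + map (fun g' => C.comp f g') (d (of g)))
    {x y z : O} (f : (quotCat C R (h _ _ _ _)).mor x y) (g : (quotCat C R (h _ _ _ _)).mor y z) :
    d (of ((quotCat C R (h _ _ _ _)).comp f g)) =
      map (fun f' => (quotCat C R (h _ _ _ _)).comp f' g) (d (of f)) + map (fun g' => (quotCat C R (h _ _ _ _)).comp f g') (d (of g)) := by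
  induction f using Quot.ind with | mk f =>
  induction g using Quot.ind with | mk g =>
  have key : map (qmk C R) (d (of (C.comp f g))) = map (fun f' => qcomp C R f' (qmk C R g)) (map (qmk C R) (d (of f))) +
      map (fun g' => qcomp C R (qmk C R f) g') (map (qmk C R) (d (of g))) := by
    rw [hl, map_add, map_map _ _ (hz g) rfl, map_map _ _ (hz' f) rfl,
      map_map (qmk C R) _ rfl (congrArg (qmk C R) (hz g)),
      map_map (qmk C R) _ rfl (congrArg (qmk C R) (hz' f))]
    rfl
  refine (d_qmk C R h (C.comp f g)).trans (key.trans ?_)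
  exact congrArg₂ (fun a b => map (fun f' => (quotCat C R (h _ _ _ _)).comp f' (qmk C R g)) a +
    map (fun g' => (quotCat C R (h _ _ _ _)).comp (qmk C R f) g') b) (d_qmk C R h f).symm (d_qmk C R h g).symm

end Quotient

/-! ## Endomorphism monoids of the diagonal category -/

/-- The bimodule `F_1 E_2`. -/
abbrev bimodRL : Bimod catU := wedge bimodR bimodL

/-- The quotient map from the tensor category of `F_1 E_2` to the diagonal category. -/
def toDiag {x y : ℕ} (t : (tensL bimodRL y).car x) : diagU.mor x y := qmk (tensCat bimodRL) glueU.Rel t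

theorem toDiag_ind {x y : ℕ} {P : diagU.mor x y → Prop} (h : ∀ t, P (toDiag t)) (f : diagU.mor x y) : P f :=
  Quot.ind h f

theorem diagU_cong_d (x y : ℕ) (a b : (tensCat (wedge glueU.F glueU.E)).mor x y) (h : Cong (tensCat (wedge glueU.F glueU.E)) glueU.Rel x y a b) :
    map (qmk (tensCat (wedge glueU.F glueU.E)) glueU.Rel) (d (of a)) = map (qmk (tensCat (wedge glueU.F glueU.E)) glueU.Rel) (d (of b)) :=
  cong_d _ _ (fun _ => rfl) (tmul_zero _) (d_tmul _) (fun _ _ h => glueU.rel_d h) h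

theorem d_toDiag {x y : ℕ} (t : (tensL bimodRL y).car x) : d (of (toDiag t)) = map toDiag (d (of t)) :=
  d_qmk _ _ diagU_cong_d t

theorem toDiag_gr {x y : ℕ} {g : ℤ} {t : (tensL bimodRL y).car x} (h : t ∈ gr g) :
    toDiag t ∈ gr (S := diagU.mor x y) g := ⟨t, h, rfl⟩

theorem diagU_comp_gr {x y z : ℕ} {p q : ℤ} {f : diagU.mor x y} {g : diagU.mor y z} (hf : f ∈ gr p) (hg : g ∈ gr q) :
    diagU.comp f g ∈ gr (S := diagU.mor x z) (p + q) := by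
  obtain ⟨s, hs, rfl⟩ := hf
  obtain ⟨t, ht, rfl⟩ := hg
  exact toDiag_gr (tmul_gr _ hs ht)

theorem diagU_zero_comp {x y z : ℕ} (f : diagU.mor y z) : diagU.comp (0 : diagU.mor x y) f = 0 := by
  induction f using toDiag_ind with
  | h t => rfl

theorem diagU_comp_zero {x y z : ℕ} (f : diagU.mor x y) : diagU.comp f (0 : diagU.mor y z) = 0 := by
  induction f using toDiag_ind with
  | h t => exact congrArg toDiag (tmul_zero bimodRL t)

theorem diagU_leibniz {x y z : ℕ} (f : diagU.mor x y) (g : diagU.mor y z) : d (of (diagU.comp f g)) =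
    map (fun f' => diagU.comp f' g) (d (of f)) + map (fun g' => diagU.comp f g') (d (of g)) :=
  quotCat_leibniz _ _ diagU_cong_d (fun _ => rfl) (tmul_zero bimodRL) (d_tmul bimodRL) f g

/-- The monoid of endomorphisms of `e^s` in the diagonal category. -/
def EndU (s : ℕ) : Type := diagU.mor s s

instance (s : ℕ) : DGP (EndU s) := inferInstanceAs (DGP (diagU.mor s s))

instance (s : ℕ) : MonoidWithZero (EndU s) where
  mul f g := diagU.comp f g
  one := diagU.one s
  zero_mul f := diagU_zero_comp f
  mul_zero f := diagU_comp_zero f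
  one_mul f := by
    refine toDiag_ind (P := fun f => diagU.comp (diagU.one s) f = f) (fun t => ?_) f
    exact congrArg toDiag (one_tmul bimodRL t)
  mul_one f := by
    refine toDiag_ind (P := fun f => diagU.comp f (diagU.one s) = f) (fun t => ?_) f
    exact congrArg toDiag (tmul_one bimodRL t)
  mul_assoc f g h := by
    refine toDiag_ind (P := fun f => diagU.comp (diagU.comp f g) h = diagU.comp f (diagU.comp g h)) (fun r => ?_) f
    refine toDiag_ind (P := fun g => diagU.comp (diagU.comp _ g) h = diagU.comp _ (diagU.comp g h)) (fun s => ?_) g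
    refine toDiag_ind (P := fun h => diagU.comp (diagU.comp _ _) h = diagU.comp _ (diagU.comp _ h)) (fun t => ?_) h
    exact congrArg toDiag (tmul_assoc bimodRL r s t)

namespace EndU

variable {s : ℕ}

/-- The quotient map from the endomorphisms of `e^s` in the tensor category. -/
def mk (t : (tensL bimodRL s).car s) : EndU s := toDiag t

theorem mk_mul (t u : (tensL bimodRL s).car s) : mk t * mk u = mk (tmul bimodRL t u) := rfl

theorem mk_zero : mk (0 : (tensL bimodRL s).car s) = 0 := rfl

theorem d_mk (t : (tensL bimodRL s).car s) : d (of (mk t)) = map mk (d (of t)) := d_toDiag t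

theorem mk_gr {g : ℤ} {t : (tensL bimodRL s).car s} (h : t ∈ gr g) : mk t ∈ gr (S := EndU s) g := toDiag_gr h

/-- The endomorphism given by `a ∈ H_s^•`. -/
def ofH (a : NH s) : EndU s := inH s a

/-- The endomorphism given by `a ∧ b ∈ F_1 E_2`. -/
def ofM (a b : NH s) : EndU s := inM s a b

theorem elU_mul (a b : NH s) : (elU (a * b) : catU.mor s s) = catU.comp (elU a) (elU b) :=
  catU.ext (by rw [catU.comp_val, val_elU, val_elU, val_elU])

theorem ofH_eq (a : NH s) : ofH a = mk (incl0 bimodRL (elU a)) := rfl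

theorem ofM_eq (a b : NH s) : ofM a b = mk (cons bimodRL
    (wmk (elR a : bimodR.car s (s - 1)) (elL b : bimodL.car (s - 1) s)) (incl0 bimodRL (catU.one s))) :=
  (congrArg mk (cons_incl bimodRL _ 0 (powOne bimodRL s))).symm

theorem ofH_zero : ofH (0 : NH s) = 0 := by
  have : (elU 0 : catU.mor s s) = 0 := Diag.mk_zero
  rw [ofH_eq, this, incl0_zero, mk_zero]

theorem ofH_one : ofH (1 : NH s) = 1 := rfl

theorem ofH_mul (a b : NH s) : ofH (a * b) = ofH a * ofH b := by
  rw [ofH_eq, ofH_eq, ofH_eq, mk_mul, tmul_incl0, act_incl0, elU_mul]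

theorem ofH_mul_ofM (a b b' : NH s) : ofH a * ofM b b' = ofM (a * b) b' := by
  rw [ofH_eq, ofM_eq, ofM_eq, mk_mul, tmul_incl0, ← cons_lact, lact_wmk, lactR, val_elU]

theorem ofM_mul_ofH (a b b' : NH s) : ofM a b * ofH b' = ofM a (b * b') := by
  rw [ofH_eq, ofM_eq, ofM_eq, mk_mul, tmul_cons, one_tmul, cons_incl0, wmk_ract, ractL, val_elU]

/-- This is the tensor product over `𝒰^•`: a scalar of `H_n^•` passes from the right of `F_1` to the
left of `E_2`. For a generator it becomes `t_{i+1} c = c t_i`. -/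
theorem ofM_balanced {n : ℕ} (a b : NH (n + 1)) (h : NH n) :
    ofM (a * NH.sh 1 n (n + 1) h) b = ofM a (NH.sh 0 n (n + 1) h * b) := by
  have h1 := ractR (s := n + 1) (elU h) a
  have h2 := lactL (s := n + 1) (elU h) b
  rw [val_elU] at h1 h2
  rw [ofM_eq, ofM_eq]
  change mk (cons bimodRL (wmk (elR _ : bimodR.car (n + 1) n) (elL _ : bimodL.car n (n + 1))) _) =
    mk (cons bimodRL (wmk (elR _ : bimodR.car (n + 1) n) (elL _ : bimodL.car n (n + 1))) _)
  rw [← h1, ← h2, wmk_move]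

theorem ofM_eq_mul (a b : NH s) : ofM a b = ofH a * ofM 1 1 * ofH b := by
  rw [ofH_mul_ofM, ofM_mul_ofH, mul_one, one_mul]

/-- The defining relations of `Ŝ_s^{+,nil}` hold in `End(e^s)`. -/
theorem nilRel (s : ℕ) : NilRel s (fun i => ofH (NH.T s i)) (ofM (1 : NH s) 1) where
  sq i _ := by rw [← ofH_mul, NH.T_sq, ofH_zero]
  comm i j hij _ := by rw [← ofH_mul, ← ofH_mul, NH.T_comm hij]
  braid i _ := by rw [← ofH_mul, ← ofH_mul, ← ofH_mul, ← ofH_mul, NH.T_braid]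
  shift i hi := by
    obtain ⟨n, rfl⟩ : ∃ n, s = n + 1 := ⟨s - 1, by omega⟩
    have h := ofM_balanced (1 : NH (n + 1)) 1 (NH.T n i)
    rw [NH.sh_T _ _ _ ⟨i, by omega⟩, NH.sh_T _ _ _ ⟨i, by omega⟩, one_mul, mul_one, add_zero] at h
    rw [ofH_mul_ofM, ofM_mul_ofH, mul_one, one_mul, h]
  kappa i hi := by
    subst hi
    -- Since `λ(1 ∧ 1) = 1 ∧ 1`, the map `F λ E` sends `(a ∧ 1) ∧ (1 ∧ b)` to `(a ∧ 1) ∧ (1 ∧ b)`,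
    -- now read in `(F E)²`.
    have e : ∀ a b : NH (i + 2), mk (incl bimodRL 2
        (glueU.psi (wmk (elR a : bimodR.car (i + 2) (i + 1)) (elR 1 : bimodR.car (i + 1) i) : (wedge bimodR bimodR).car _ _)
          (wmk (elL 1 : bimodL.car i (i + 1)) (elL b : bimodL.car (i + 1) (i + 2)) : (wedge bimodL bimodL).car _ _))) =
          ofM a 1 * ofM 1 b := by
      intro a b
      have hlam := lamRL_wmk (elR 1 : bimodR.car (i + 1) i) (elL 1 : bimodL.car i (i + 1))
      rw [valR_elR, valL_elL, map_one, map_one] at hlam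
      have hpsi := GlueDatum.psi_wmk glueU (elR a : bimodR.car (i + 2) (i + 1)) (elR 1 : bimodR.car (i + 1) i)
        (elL 1 : bimodL.car i (i + 1)) (elL b : bimodL.car (i + 1) (i + 2))
      refine (congrArg (fun w => mk (incl bimodRL 2 w)) (hpsi.trans (congrArg
        (fun w => glueU.regroup (elR a : bimodR.car (i + 2) (i + 1)) w (elL b : bimodL.car (i + 1) (i + 2))) hlam))).trans ?_
      rw [ofM_eq, ofM_eq, mk_mul, tmul_cons, one_tmul]
      exact (congrArg mk (cons_cons_incl0 bimodRL _ _)).symm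
    have hR := tauR_wmk (elR 1 : bimodR.car (i + 2) (i + 1)) (elR 1 : bimodR.car (i + 1) i)
    have hL := tauL_wmk (elL 1 : bimodL.car i (i + 1)) (elL 1 : bimodL.car (i + 1) (i + 2))
    rw [valR_elR, valR_elR, map_one, mul_one, one_mul] at hR
    rw [valL_elL, valL_elL, map_one, mul_one, mul_one] at hL
    -- The gluing relation at `1 ∧ 1 ∧ 1 ∧ 1`: `τ₁` produces `T_1` on the left and `τ₂` produces
    -- `T_{s-1}` on the right.
    have h : mk (incl bimodRL 2 (glueU.psi (tauR.toFun _) _)) = mk (incl bimodRL 2 (glueU.psi _ (tauL.toFun _))) :=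
      Quot.sound (Cong.rel (GlueDatum.Rel.intro (G := glueU)
        (wmk (elR 1 : bimodR.car (i + 2) (i + 1)) (elR 1 : bimodR.car (i + 1) i))
        (wmk (elL 1 : bimodL.car i (i + 1)) (elL 1 : bimodL.car (i + 1) (i + 2)))))
    rw [← mul_assoc, ofH_mul_ofM, mul_assoc, ofM_mul_ofH, mul_one, one_mul]
    exact (e _ _).symm.trans ((congrArg (fun p => mk (incl bimodRL 2 (glueU.psi p _))) hR).symm.trans
      (h.trans ((congrArg (fun w => mk (incl bimodRL 2 (glueU.psi _ w))) hL).trans (e _ _))))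
  zero hs := by
    subst hs
    -- In `ℕ`, `0 - 1` is `0`, so the bimodule is taken at `(0, 0)`, where it vanishes because `0 ≠
    -- 0 + 1`.
    have : (elR 1 : bimodR.car 0 (0 - 1)) = 0 := Diag.mk_neg (by omega) _
    rw [ofM_eq, this, zero_wmk, zero_cons]
    rfl

/-- The morphism from `Ŝ_s^{+,nil}` to the endomorphisms of `e^s`. -/
def ofNil (s : ℕ) : NilAff s →*₀ EndU s := NilAff.lift _ _ (nilRel s)

theorem ofNil_t {i : ℕ} (hi : i + 1 < s) : ofNil s (NilAff.t s i) = ofH (NH.T s i) := NilAff.lift_t _ hi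

theorem ofNil_c : ofNil s (NilAff.c s) = ofM 1 1 := NilAff.lift_c _

theorem ofNil_incH (a : NH s) : ofNil s (incH s a) = ofH a := by
  refine NH.hom_ext (f := fun a => ofNil s (incH s a)) ?_ ofH_zero ?_ ofH_one (fun a b => ?_) ofH_mul (fun i hi => ?_) a
  · rw [incH_zero, map_zero]
  · rw [map_one, map_one]
  · rw [map_mul, map_mul]
  · rw [incH_T hi, ofNil_t hi]

theorem ofNil_ofM (a b : NH s) : ofNil s (incH s a * NilAff.c s * incH s b) = ofM a b := by
  rw [map_mul, map_mul, ofNil_incH, ofNil_incH, ofNil_c, ← ofM_eq_mul]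

theorem leibniz (f g : EndU s) : d (of (f * g)) =
    map (fun f' => f' * g) (d (of f)) + map (fun g' => f * g') (d (of g)) := diagU_leibniz f g

theorem mul_gr {p q : ℤ} {f g : EndU s} (hf : f ∈ gr p) (hg : g ∈ gr q) : f * g ∈ gr (S := EndU s) (p + q) :=
  diagU_comp_gr hf hg

theorem d_one : d (of (1 : EndU s)) = 0 := by
  have h := leibniz (1 : EndU s) 1
  simp only [one_mul, mul_one, map_id] at h
  simpa using h

theorem d_ofH_T {i : ℕ} (hi : i + 1 < s) : d (of (ofH (NH.T s i))) = of (1 : EndU s) := by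
  have e : d (of (elU (NH.T s i) : catU.mor s s)) = of (elU 1) := by
    refine (Diag.d_of _).trans ?_
    change map (Diag.mk (s = s)) (d (of (catU.val (elU (NH.T s i))))) = _
    rw [val_elU, NH.d_T _ hi, map_of _ Diag.mk_zero]
    rfl
  rw [ofH_eq, d_mk, d_incl0, e, map_of _ (incl0_zero _), map_of _ mk_zero]
  rfl

theorem d_ofM_one : d (of (ofM (1 : NH s) 1)) = 0 := by
  rcases s with _ | n
  · rw [(nilRel 0).zero rfl, of_zero, map_zero]
  have e : d (of (wmk (elR 1 : bimodR.car (n + 1) n) (elL 1 : bimodL.car n (n + 1)))) = 0 := by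
    rw [d_wmk, elR_one_d, elL_one_d, map_zero, map_zero, add_zero]
  rw [ofM_eq, d_mk, d_cons, d_incl0, NilGlue.d_one]
  change map mk (map _ (d (of (wmk (elR 1 : bimodR.car (n + 1) n) (elL 1 : bimodL.car n (n + 1))))) + _) = 0
  rw [e]
  simp

/-- The Leibniz rule holds on both sides, and on both sides the differential is `1` on the `t_i` and
`0` on `c`. -/
theorem d_ofNil (a : NilAff s) : d (of (ofNil s a)) = map (ofNil s) (d (of a)) := by
  have hz := map_zero (ofNil s)
  have hr : ∀ x : EndU s, (fun f : EndU s => f * x) 0 = 0 := fun x => zero_mul x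
  have hl : ∀ x : EndU s, (fun f : EndU s => x * f) 0 = 0 := fun x => mul_zero x
  induction a using NilAff.ind with
  | h0 => rw [map_zero]; simp
  | h1 => rw [map_one, d_one, NilAff.d_one, map_zero]
  | ht a i hi ih =>
    rw [map_mul, leibniz, ih, ofNil_t hi, d_ofH_T hi, map_of _ (hl _), mul_one, map_map (ofNil s) (fun f => f * ofH (NH.T s i)) hz (hr _),
      NilAff.d_mul_t hi, map_add, map_of _ hz, map_map (fun b => b * NilAff.t s i) (ofNil s) (zero_mul _) hz]
    simp only [map_mul, ofNil_t hi]
  | hc a _ ih =>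
    rw [map_mul, leibniz, ih, ofNil_c, d_ofM_one, map_zero, add_zero, map_map (ofNil s) (fun f => f * ofM 1 1) hz (hr _),
      NilAff.d_mul_c, map_map (fun b => b * NilAff.c s) (ofNil s) (zero_mul _) hz]
    simp only [map_mul, ofNil_c]

theorem ofH_gr {g : ℤ} {a : NH s} (h : a ∈ gr g) : ofH a ∈ gr (S := EndU s) g :=
  mk_gr ⟨0, elU a, Diag.mk_gr h, rfl⟩

theorem one_gr : (1 : EndU s) ∈ gr (S := EndU s) 0 := ofH_gr NH.one_gr

theorem ofM_one_gr : ofM (1 : NH s) 1 ∈ gr (S := EndU s) 0 := by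
  rw [ofM_eq]
  refine mk_gr ?_
  have h := cons_gr bimodRL (wmk_gr (elR_gr (r := s - 1) (NH.one_gr (n := s))) (elL_gr (r := s - 1) (NH.one_gr (n := s))) rfl)
    (t := incl0 bimodRL (catU.one s)) (q := 0) ⟨0, powOne bimodRL s, Diag.mk_gr NH.one_gr, rfl⟩
  simpa using h

/-- The degree is minus the number of simple reflections in the word, since `c` has degree `0`; it
is followed letter by letter. -/
theorem ofNil_gr {g : ℤ} {a : NilAff s} (h : a ∈ gr (S := NilAff s) g) : ofNil s a ∈ gr (S := EndU s) g := by
  rcases h with rfl | ⟨⟨σ, h⟩, rfl, rfl⟩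
  · rw [map_zero]
    exact mk_gr (LawfulDGP.zero_mem g)
  · change ofNil s (NilAff.T s σ) ∈ gr (S := EndU s) (-(ell s σ : ℤ))
    refine h.induction (P := fun σ => ofNil s (NilAff.T s σ) ∈ gr (S := EndU s) (-(ell s σ : ℤ))) ?_
      (fun i σ hi h hlt ih => ?_) (fun σ hn h ih => ?_)
    · rw [NilAff.T_one, map_one, ell_one]; exact one_gr
    · rw [← NilAff.T_mul_t_of_lt hi h hlt, map_mul, ofNil_t hi, h.isExpr.ell_mul_simpleRefl_of_lt (by omega) hlt]
      have := mul_gr ih (ofH_gr (NH.T_gr i))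
      rwa [← neg_add, ← Nat.cast_one, ← Nat.cast_add] at this
    · rw [← NilAff.T_mul_c hn h, map_mul, ofNil_c, h.isExpr.ell_mul_shiftPerm]
      have := mul_gr ih ofM_one_gr
      rwa [add_zero] at this

end EndU

/-! ## Functors on a tensor category -/

section Tensor

variable {O : Type} {V : DPCat O} [V.Lawful] (M : Bimod V)

/-- A functor from `V` to `D` and a compatible morphism of bimodules from `M` to the morphisms of `D`. -/
structure TensRep (D : DPCat O) where
  onMor : ∀ {x y}, V.mor x y → D.mor x y
  map_zero : ∀ {x y}, onMor (0 : V.mor x y) = 0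
  map_one : ∀ x, onMor (V.one x) = D.one x
  map_comp : ∀ {x y z} (f : V.mor x y) (g : V.mor y z), onMor (V.comp f g) = D.comp (onMor f) (onMor g)
  onBimod : ∀ {x y}, M.car x y → D.mor x y
  bimod_zero : ∀ {x y}, onBimod (0 : M.car x y) = 0
  map_lact : ∀ {x y z} (f : V.mor x y) (m : M.car y z), onBimod (M.lact f m) = D.comp (onMor f) (onBimod m)
  map_ract : ∀ {x y z} (m : M.car x y) (f : V.mor y z), onBimod (M.ract m f) = D.comp (onBimod m) (onMor f)
  map_gr : ∀ {x y} {g : ℤ} {f : V.mor x y}, f ∈ gr g → onMor f ∈ gr (S := D.mor x y) g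
  bimod_gr : ∀ {x y} {g : ℤ} {m : M.car x y}, m ∈ gr g → onBimod m ∈ gr (S := D.mor x y) g

namespace TensRep

variable {M} {D : DPCat O} [hD : D.Lawful] (ρ : TensRep M D)

/-- A map from a left module to the morphisms of `D` with source `z` that is compatible with the action of `V`. -/
structure Hom (N : LMod V) (z : O) where
  toFun : ∀ {x}, N.car x → D.mor x z
  map_zero : ∀ {x}, toFun (0 : N.car x) = 0
  map_act : ∀ {x y} (f : V.mor x y) (n : N.car y), toFun (N.act f n) = D.comp (ρ.onMor f) (toFun n)

/-- The map `M^i(-, z) → Hom_D(z, -)`. -/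
def onPow (z : O) : ∀ i, ρ.Hom (pow M z i) z
  | 0 =>
    { toFun := fun f => ρ.onMor f
      map_zero := ρ.map_zero
      map_act := ρ.map_comp }
  | i + 1 =>
    { toFun := fun {x} w => Wedge.lift (N := pow M z i) 0 (fun _ m n => D.comp (ρ.onBimod m) ((onPow z i).toFun n))
        (fun y n => by rw [ρ.bimod_zero, hD.zero_comp]) (fun y m => by rw [(onPow z i).map_zero, hD.comp_zero])
        (fun m f n => by rw [ρ.map_ract, (onPow z i).map_act, hD.assoc]) w
      map_zero := rfl
      map_act := fun {x y} f w => by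
        induction w using Wedge.ind with
        | h0 => exact (hD.comp_zero _).symm
        | h y' m n =>
          change D.comp (ρ.onBimod (M.lact f m)) _ = D.comp _ (D.comp _ _)
          rw [ρ.map_lact, hD.assoc] }

/-- The functor from the tensor category of `M` to `D`. -/
def onTens {x z : O} (t : (tensL M z).car x) : D.mor x z := Vee.lift 0 (fun i w => (ρ.onPow z i).toFun w) t

theorem onTens_incl {x z : O} (i : ℕ) (w : (pow M z i).car x) : ρ.onTens (incl M i w) = (ρ.onPow z i).toFun w :=
  Vee.lift_inj _ _ (fun i => (ρ.onPow z i).map_zero) i w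

theorem onTens_incl0 {x z : O} (f : V.mor x z) : ρ.onTens (incl0 M f) = ρ.onMor f := ρ.onTens_incl 0 _

theorem onTens_cons {x y z : O} (m : M.car x y) (t : (tensL M z).car y) :
    ρ.onTens (cons M m t) = D.comp (ρ.onBimod m) (ρ.onTens t) := by
  induction t using tens_ind with
  | h i w => rw [cons_incl, onTens_incl, onTens_incl]; rfl

theorem onTens_act {x y z : O} (f : V.mor x y) (t : (tensL M z).car y) :
    ρ.onTens ((tensL M z).act f t) = D.comp (ρ.onMor f) (ρ.onTens t) := by
  induction t using tens_ind with
  | h i w => rw [tens_act_incl, onTens_incl, onTens_incl, Hom.map_act]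

theorem onTens_tmul {x y z : O} (s : (tensL M y).car x) (t : (tensL M z).car y) :
    ρ.onTens (tmul M s t) = D.comp (ρ.onTens s) (ρ.onTens t) := by
  induction s using tens_cons_ind with
  | h0 x => exact (hD.zero_comp _).symm
  | h1 x f => rw [tmul_incl0, onTens_act, onTens_incl0]
  | h x y m s ih => rw [tmul_cons, onTens_cons, onTens_cons, ih, hD.assoc]

theorem onTens_gr {x z : O} {g : ℤ} {t : (tensL M z).car x} (h : t ∈ gr g) : ρ.onTens t ∈ gr (S := D.mor x z) g := by
  obtain ⟨i, w, hw, rfl⟩ := h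
  change ρ.onTens (incl M i w) ∈ _
  induction i generalizing x g with
  | zero => rw [onTens_incl]; exact ρ.map_gr hw
  | succ i ih =>
    rcases hw with rfl | ⟨p, q, y, m, w, rfl, hm, hw, rfl⟩
    · change ρ.onTens (incl M (i + 1) 0) ∈ _
      rw [incl_zero]
      exact (hD.lawful x z).zero_mem _
    · change ρ.onTens (incl M (i + 1) (powCons M m i w)) ∈ _
      rw [← cons_incl, onTens_cons]
      exact hD.comp_gr (ρ.bimod_gr hm) (ih w hw)

end TensRep

end Tensor

/-! ## The isomorphism from the diagonal category to `ℋ^+` -/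

namespace NilAff

/-- The map `H_x^• → Hom_{ℋ^+}(y, x)`. -/
def ofMor {x y : ℕ} (f : catU.mor x y) : catH.mor x y := Diag.mk (x = y) (incH x (catU.val f))

theorem ofMor_zero {x y : ℕ} : ofMor (0 : catU.mor x y) = 0 := by
  rw [ofMor, catU.val_zero, incH_zero]; exact Diag.mk_zero

theorem ofMor_self {x : ℕ} (f : catU.mor x x) : ofMor f = elH (incH x (catU.val f)) := rfl

/-- The map `(a, b) ↦ a c b`. -/
def ofPair {x y : ℕ} (a : NH x) (b : NH y) : catH.mor x y := Diag.mk (x = y) (incH x a * c x * incH x (tr NH y x b))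

theorem zero_ofPair {x y : ℕ} (b : NH y) : ofPair (0 : NH x) b = 0 := by
  rw [ofPair, incH_zero, zero_mul, zero_mul]; exact Diag.mk_zero

theorem ofPair_zero {x y : ℕ} (a : NH x) : ofPair a (0 : NH y) = 0 := by
  rw [ofPair, tr_zero, incH_zero, mul_zero]; exact Diag.mk_zero

theorem ofPair_self {x : ℕ} (a b : NH x) : ofPair a b = elH (incH x a * c x * incH x b) := by
  rw [ofPair, tr_self]; rfl

theorem incH_shift {n : ℕ} (h : NH n) :
    incH (n + 1) (NH.sh 1 n (n + 1) h) * c (n + 1) = c (n + 1) * incH (n + 1) (NH.sh 0 n (n + 1) h) :=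
  (nilRel (n + 1)).nh_shift h

/-- The map `a ∧ b ↦ a c b`. -/
def ofBimod {x y : ℕ} (w : bimodRL.car x y) : catH.mor x y :=
  wlift (M := bimodR) (N := bimodL) (fun _ a b => ofPair (valR a) (valL b)) (fun _ _ => zero_ofPair _) (fun _ _ => ofPair_zero _)
    (fun {t t'} m f n => by
      rcases catU.eq_or _ _ f with rfl | rfl
      · rw [bimodR.ract_zero, bimodL.zero_lact]
        exact (zero_ofPair _).trans (ofPair_zero _).symm
      rcases R_cases m with rfl | rfl
      · rw [bimodR.zero_ract]
        exact (zero_ofPair _).trans (zero_ofPair _).symm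
      rcases L_cases n with rfl | rfl
      · rw [bimodL.lact_zero]
        exact (ofPair_zero _).trans (ofPair_zero _).symm
      induction m using R_ind with | h a =>
      induction n using L_ind with | h b =>
      -- The balance condition is `f_1(h) c = c h`.
      rw [ractR, lactL, valR_elR, valL_elL, valR_elR, valL_elL, ofPair_self, ofPair_self, map_mul, map_mul,
        mul_assoc (incH _ a), incH_shift]
      simp only [mul_assoc]) w

theorem ofBimod_wmk {x : ℕ} (a b : NH (x + 1)) :
    ofBimod (wmk (elR a : bimodR.car (x + 1) x) (elL b : bimodL.car x (x + 1))) = elH (incH _ a * c _ * incH _ b) := by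
  change ofPair (valR (elR a : bimodR.car (x + 1) x)) (valL (elL b : bimodL.car x (x + 1))) = _
  rw [valR_elR, valL_elL, ofPair_self]

theorem ofBimod_zero {x y : ℕ} : ofBimod (0 : bimodRL.car x y) = 0 := rfl

/-- An element of `F_1 E_2` is `0`, or is `a ∧ b` for some `a, b ∈ H_s^•`. -/
theorem bimodRL_ind {P : ∀ x y, bimodRL.car x y → Prop} (h0 : ∀ x y, P x y 0)
    (h : ∀ (x : ℕ) (a b : NH (x + 1)), P _ _ (wmk (elR a : bimodR.car (x + 1) x) (elL b : bimodL.car x (x + 1))))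
    {x y : ℕ} (w : bimodRL.car x y) : P x y w := by
  induction w using wedge_ind' with
  | h0 => exact h0 x y
  | h t m n hm hn =>
    obtain rfl := R_eq hm
    obtain rfl := L_eq hn
    induction m using R_ind with | h a =>
    induction n using L_ind with | h b =>
    exact h t a b

/-- The functor from the tensor category of `F_1 E_2` to `ℋ^+`. -/
def tensRep : TensRep bimodRL catH where
  onMor := ofMor
  map_zero := ofMor_zero
  map_one x := by
    rw [ofMor_self, catU.one_val, map_one]; rfl
  map_comp := fun {x y z} f g => by
    rcases catU.eq_or _ _ f with rfl | rfl
    · rw [catU.zero_comp, ofMor_zero, ofMor_zero, catH.zero_comp]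
    rcases catU.eq_or _ _ g with rfl | rfl
    · rw [catU.comp_zero, ofMor_zero, catH.comp_zero]
    rw [ofMor_self, ofMor_self, ofMor_self, catU.comp_val, catH.elH_comp, map_mul]
  onBimod := ofBimod
  bimod_zero := rfl
  map_lact := fun {x y z} f m => by
    rcases catU.eq_or _ _ f with rfl | rfl
    · rw [bimodRL.zero_lact, ofMor_zero, catH.zero_comp, ofBimod_zero]
    refine bimodRL_ind (P := fun x y m => ∀ f : catU.mor x x, ofBimod (bimodRL.lact f m) = catH.comp (ofMor f) (ofBimod m))
      (fun x y f => ?_) (fun x a b f => ?_) m f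
    · rw [bimodRL.lact_zero, ofBimod_zero, catH.comp_zero]
    · rw [lact_wmk, lactR, ofBimod_wmk, ofBimod_wmk, ofMor_self, catH.elH_comp, map_mul]
      simp only [mul_assoc]
  map_ract := fun {x y z} m f => by
    rcases catU.eq_or _ _ f with rfl | rfl
    · rw [bimodRL.ract_zero, ofMor_zero, catH.comp_zero, ofBimod_zero]
    refine bimodRL_ind (P := fun x y m => ∀ f : catU.mor y y, ofBimod (bimodRL.ract m f) = catH.comp (ofBimod m) (ofMor f))
      (fun x y f => ?_) (fun x a b f => ?_) m f
    · rw [bimodRL.zero_ract, ofBimod_zero, catH.zero_comp]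
    · rw [wmk_ract, ractL, ofBimod_wmk, ofBimod_wmk, ofMor_self, catH.elH_comp, map_mul]
      simp only [mul_assoc]
  map_gr h := Diag.mk_gr (incH_gr (catU.val_gr h))
  bimod_gr := fun {x y g m} h => by
    rcases wedge_gr.1 h with rfl | ⟨p, q, t, m, n, rfl, hm, hn, rfl⟩
    · exact (NilGlue.DPCat.Lawful.lawful (C := catH) x y).zero_mem g
    by_cases hm0 : m = 0
    · subst hm0
      rw [zero_wmk]
      exact (NilGlue.DPCat.Lawful.lawful (C := catH) x y).zero_mem _
    by_cases hn0 : n = 0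
    · subst hn0
      rw [wmk_zero]
      exact (NilGlue.DPCat.Lawful.lawful (C := catH) x y).zero_mem _
    obtain rfl := R_eq hm0
    obtain rfl := L_eq hn0
    rw [← elR_valR m, ← elL_valL n, ofBimod_wmk]
    have := mul_gr (mul_gr (incH_gr (valR_gr hm)) c_gr) (incH_gr (valL_gr hn))
    rw [add_zero] at this
    exact catH.elH_gr.2 this

/-- As `λ(b ∧ u) = b ∧ f_1(u)`, the map `F λ E` produces the pairs `a ∧ b` and `f_1(u) ∧ v`, whose
images are multiplied. -/
theorem onTens_psi {x : ℕ} (a v : NH (x + 2)) (b u : NH (x + 1)) :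
    tensRep.onTens (incl bimodRL 2 (glueU.psi
      (wmk (elR a : bimodR.car (x + 2) (x + 1)) (elR b : bimodR.car (x + 1) x) : (wedge bimodR bimodR).car _ _)
      (wmk (elL u : bimodL.car x (x + 1)) (elL v : bimodL.car (x + 1) (x + 2)) : (wedge bimodL bimodL).car _ _))) =
      elH (incH _ a * c _ * incH _ (NH.sh 0 (x + 1) (x + 2) b) * (incH _ (NH.sh 1 (x + 1) (x + 2) u) * c _ * incH _ v)) := by
  have hlam := lamRL_wmk (elR b : bimodR.car (x + 1) x) (elL u : bimodL.car x (x + 1))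
  rw [valR_elR, valL_elL] at hlam
  have hpsi := GlueDatum.psi_wmk glueU (elR a : bimodR.car (x + 2) (x + 1)) (elR b : bimodR.car (x + 1) x)
    (elL u : bimodL.car x (x + 1)) (elL v : bimodL.car (x + 1) (x + 2))
  refine (congrArg (fun w => tensRep.onTens (incl bimodRL 2 w)) (hpsi.trans (congrArg
    (fun w => glueU.regroup (elR a : bimodR.car (x + 2) (x + 1)) w (elL v : bimodL.car (x + 1) (x + 2))) hlam))).trans ?_
  refine (congrArg tensRep.onTens (cons_cons_incl0 bimodRL
    (wmk (elR a : bimodR.car (x + 2) (x + 1)) (elL (NH.sh 0 (x + 1) (x + 2) b) : bimodL.car (x + 1) (x + 2)))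
    (wmk (elR (NH.sh 1 (x + 1) (x + 2) u) : bimodR.car (x + 2) (x + 1)) (elL v : bimodL.car (x + 1) (x + 2))))).symm.trans ?_
  rw [tensRep.onTens_cons, tensRep.onTens_cons, tensRep.onTens_incl0]
  change catH.comp (ofBimod _) (catH.comp (ofBimod _) (ofMor _)) = _
  rw [ofBimod_wmk, ofBimod_wmk, ofMor_self, catU.one_val, map_one, catH.elH_comp, catH.elH_comp, mul_one]

/-- This is the image of the gluing relation. Through `f_1(h) c = c h`, `b` moves to the left of
both letters `c` and `u` to their right; there remains `t_0 c² = c² t_{s-2}` with `s = x + 2`. -/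
theorem swap {x : ℕ} (a v : NH (x + 2)) (b u : NH (x + 1)) :
    incH (x + 2) (a * NH.sh 1 (x + 1) (x + 2) b * NH.T (x + 2) 0) * c _ * incH _ (NH.sh 0 (x + 1) (x + 2) 1) *
      (incH _ (NH.sh 1 (x + 1) (x + 2) u) * c _ * incH _ v) =
    incH (x + 2) a * c _ * incH _ (NH.sh 0 (x + 1) (x + 2) b) * (incH _ (NH.sh 1 (x + 1) (x + 2) 1) * c _ *
      incH _ (NH.T (x + 2) x * (NH.sh 0 (x + 1) (x + 2) u * v))) := by
  have k := (nilRel (x + 2)).kappa x rfl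
  have hb : incH (x + 2) (NH.sh 1 (x + 1) (x + 2) b) * c _ = c _ * incH (x + 2) (NH.sh 0 (x + 1) (x + 2) b) := incH_shift b
  have hu : incH (x + 2) (NH.sh 1 (x + 1) (x + 2) u) * c _ = c _ * incH (x + 2) (NH.sh 0 (x + 1) (x + 2) u) := incH_shift u
  simp only [map_mul, map_one, mul_one, one_mul]
  rw [incH_T (by omega), incH_T (by omega), hu, mul_assoc (incH _ a) (c _), ← hb]
  calc _ = incH (x + 2) a * incH (x + 2) (NH.sh 1 (x + 1) (x + 2) b) * (t (x + 2) 0 * (c _ * c _)) *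
        (incH _ (NH.sh 0 (x + 1) (x + 2) u) * incH _ v) := by simp only [mul_assoc]
    _ = _ := by rw [k]; simp only [mul_assoc]

/-- Both tensors may be taken as `a ∧ b` and `u ∧ v` between consecutive objects; the claim is then
`swap`. -/
theorem onTens_rel {x z : ℕ} {a b : (tensL bimodRL z).car x} (h : glueU.Rel x z a b) :
    tensRep.onTens a = tensRep.onTens b := by
  obtain ⟨p, w⟩ := h
  rename_i y
  change tensRep.onTens (incl bimodRL 2 (glueU.psi (tauR.toFun p) w)) =
    tensRep.onTens (incl bimodRL 2 (glueU.psi p (tauL.toFun w)))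
  have zl : ∀ w : (wedge bimodL bimodL).car y z,
      tensRep.onTens (incl bimodRL 2 (glueU.psi (0 : (wedge bimodR bimodR).car x y) w)) = 0 := fun w =>
    (congrArg (fun w => tensRep.onTens (incl bimodRL 2 w)) (glueU.zero_psi w)).trans
      (congrArg tensRep.onTens (incl_zero bimodRL 2))
  have zr : ∀ p : (wedge bimodR bimodR).car x y,
      tensRep.onTens (incl bimodRL 2 (glueU.psi p (0 : (wedge bimodL bimodL).car y z))) = 0 := fun p =>
    (congrArg (fun w => tensRep.onTens (incl bimodRL 2 w)) (glueU.psi_zero p)).trans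
      (congrArg tensRep.onTens (incl_zero bimodRL 2))
  have key : ∀ (p : (wedge bimodR bimodR).car x y) (w : (wedge bimodL bimodL).car y z),
      tensRep.onTens (incl bimodRL 2 (glueU.psi (tauR.toFun p) w)) =
        tensRep.onTens (incl bimodRL 2 (glueU.psi p (tauL.toFun w))) := by
    intro p w
    induction p using wedge_ind' with
    | h0 => exact (zl w).trans (zl _).symm
    | h t m n hm hn =>
      induction w using wedge_ind' with
      | h0 => exact (zr _).trans (zr _).symm
      | h t' m' n' hm' hn' =>
        obtain rfl := R_eq hm
        obtain rfl := R_eq hn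
        obtain rfl := L_eq hm'
        obtain rfl := L_eq hn'
        rw [← elR_valR m, ← elR_valR n, ← elL_valL m', ← elL_valL n']
        generalize valR m = a
        generalize valR n = b
        generalize valL m' = u
        generalize valL n' = v
        have hR := tauR_wmk (elR a : bimodR.car (y + 2) (y + 1)) (elR b : bimodR.car (y + 1) y)
        have hL := tauL_wmk (elL u : bimodL.car y (y + 1)) (elL v : bimodL.car (y + 1) (y + 2))
        rw [valR_elR, valR_elR] at hR
        rw [valL_elL, valL_elL] at hL
        refine (congrArg (fun p => tensRep.onTens (incl bimodRL 2 (glueU.psi p _))) hR).trans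
          (.trans ?_ (congrArg (fun w => tensRep.onTens (incl bimodRL 2 (glueU.psi _ w))) hL).symm)
        refine (onTens_psi _ _ _ _).trans (.trans ?_ (onTens_psi _ _ _ _).symm)
        exact congrArg elH (swap a v b u)
  exact key p w

theorem onTens_cong {x y : ℕ} {a b : (tensCat (wedge glueU.F glueU.E)).mor x y} (h : Cong _ glueU.Rel x y a b) :
    (tensRep.onTens (z := y) a : catH.mor x y) = tensRep.onTens (z := y) b := by
  induction h with
  | rel h => exact onTens_rel h
  | left f h ih => exact (tensRep.onTens_tmul _ _).trans ((congrArg _ ih).trans (tensRep.onTens_tmul _ _).symm)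
  | right g h ih =>
    exact (tensRep.onTens_tmul _ _).trans ((congrArg (fun f => catH.comp f _) ih).trans (tensRep.onTens_tmul _ _).symm)

/-- The functor from the diagonal category to `ℋ^+`. -/
def ofDiag {x y : ℕ} (f : diagU.mor x y) : catH.mor x y :=
  Quot.lift (fun t : (tensL bimodRL y).car x => tensRep.onTens t) (fun _ _ h => onTens_cong h) f

theorem ofDiag_zero {x y : ℕ} : ofDiag (0 : diagU.mor x y) = 0 := rfl

theorem ofDiag_one (x : ℕ) : ofDiag (diagU.one x) = catH.one x :=
  (tensRep.onTens_incl0 _).trans (tensRep.map_one x)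

theorem ofDiag_comp {x y z : ℕ} (f : diagU.mor x y) (g : diagU.mor y z) :
    ofDiag (diagU.comp f g) = catH.comp (ofDiag f) (ofDiag g) := by
  induction f using toDiag_ind with | h s =>
  induction g using toDiag_ind with | h t =>
  exact tensRep.onTens_tmul s t

theorem ofDiag_gr {x y : ℕ} {g : ℤ} {f : diagU.mor x y} (h : f ∈ gr g) : ofDiag f ∈ gr (S := catH.mor x y) g := by
  obtain ⟨t, ht, rfl⟩ := h
  exact tensRep.onTens_gr ht

theorem ofDiag_ofH {s : ℕ} (a : NH s) : ofDiag (EndU.ofH a : diagU.mor s s) = elH (incH s a) := by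
  refine (tensRep.onTens_incl0 (elU a)).trans ((ofMor_self _).trans ?_)
  rw [val_elU]

theorem ofDiag_ofM {s : ℕ} (a b : NH s) : ofDiag (EndU.ofM a b : diagU.mor s s) = elH (incH s a * c s * incH s b) := by
  rw [EndU.ofM_eq]
  refine (tensRep.onTens_cons _ _).trans ?_
  rw [tensRep.onTens_incl0, tensRep.map_one, DPCat.Lawful.comp_one]
  rcases s with _ | n
  · have : (elR a : bimodR.car 0 (0 - 1)) = 0 := Diag.mk_neg (by omega) _
    rw [this, zero_wmk, (nilRel 0).zero rfl, mul_zero, zero_mul, catH.elH_zero]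
    rfl
  · exact ofBimod_wmk a b

/-- The morphism of monoids `End(e^s) → Ŝ_s^{+,nil}`. -/
def ofEnd (s : ℕ) : EndU s →*₀ NilAff s where
  toFun f := valH (ofDiag (f : diagU.mor s s))
  map_zero' := rfl
  map_one' := (congrArg valH (ofDiag_one s)).trans (catH.val_elH _)
  map_mul' f g := by
    refine (congrArg valH (ofDiag_comp f g)).trans ?_
    rw [← catH.elH_val (ofDiag f), ← catH.elH_val (ofDiag g), catH.elH_comp, catH.val_elH, catH.val_elH, catH.val_elH]

/-- A composite of morphisms of monoids with zero, so it suffices to look at the `t_i` and at `c`.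
-/
theorem ofEnd_ofNil {s : ℕ} (a : NilAff s) : ofEnd s (EndU.ofNil s a) = a := by
  refine hom_ext (f := (ofEnd s).comp (EndU.ofNil s)) (g := MonoidWithZeroHom.id _) (fun i hi => ?_) ?_ a
  · change valH (ofDiag (EndU.ofNil s (t s i))) = t s i
    rw [EndU.ofNil_t hi, ofDiag_ofH, catH.val_elH, incH_T hi]
  · change valH (ofDiag (EndU.ofNil s (c s))) = c s
    rw [EndU.ofNil_c, ofDiag_ofM, catH.val_elH, map_one, one_mul, mul_one]

theorem ofDiag_ofNil {s : ℕ} (a : NilAff s) : ofDiag (EndU.ofNil s a : diagU.mor s s) = elH a :=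
  (catH.elH_val _).symm.trans (congrArg elH (ofEnd_ofNil a))

/-! ### Bijectivity of the functor on morphisms -/

/-- `𝒰^•` and `F_1 E_2` both vanish off the diagonal, hence so do all tensor powers. -/
theorem tens_eq_zero {x z : ℕ} (t : (tensL bimodRL z).car x) : x ≠ z → t = 0 := by
  induction t using tens_cons_ind with
  | h0 x => exact fun _ => rfl
  | h1 x f =>
    intro h
    rw [(catU.eq_or _ _ f).resolve_right h, incl0_zero]
  | h x y m t ih =>
    refine bimodRL_ind (P := fun x y m => ∀ t : (tensL bimodRL z).car y, (y ≠ z → t = 0) → x ≠ z → cons bimodRL m t = 0)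
      (fun x y t _ _ => zero_cons _ _) (fun x a b t ih h => ?_) m t ih
    rw [ih h, cons_zero]

theorem diagU_eq_zero {x y : ℕ} (h : x ≠ y) (f : diagU.mor x y) : f = 0 := by
  induction f using toDiag_ind with | h t =>
  rw [tens_eq_zero t h]; rfl

/-- Each step of the construction by `cons` multiplies by some `a ∧ b`, which is the image of `a c
b`. The equality is heterogeneous because the induction varies the object `x`, while `ofNil z` takes
values in `End(e^z)`. -/
theorem exists_ofNil {x z : ℕ} (t : (tensL bimodRL z).car x) :
    x = z → ∃ a : NilAff z, HEq (toDiag t) (EndU.ofNil z a) := by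
  induction t using tens_cons_ind with
  | h0 x =>
    rintro rfl
    exact ⟨0, heq_of_eq (map_zero (EndU.ofNil x)).symm⟩
  | h1 x f =>
    rintro rfl
    refine ⟨incH x (catU.val f), heq_of_eq ?_⟩
    rw [EndU.ofNil_incH, EndU.ofH_eq, elU_val]
    rfl
  | h x y m t ih =>
    refine bimodRL_ind (P := fun x y m => ∀ t : (tensL bimodRL z).car y,
      (y = z → ∃ a : NilAff z, HEq (toDiag t) (EndU.ofNil z a)) → x = z →
        ∃ a : NilAff z, HEq (toDiag (cons bimodRL m t)) (EndU.ofNil z a))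
      (fun x y t _ h => ?_) (fun x a b t ih h => ?_) m t ih
    · subst h
      refine ⟨0, heq_of_eq ?_⟩
      rw [zero_cons, map_zero]
      rfl
    · subst h
      obtain ⟨u, hu⟩ := ih rfl
      refine ⟨incH _ a * c _ * incH _ b * u, heq_of_eq ?_⟩
      rw [map_mul, EndU.ofNil_ofM, ← eq_of_heq hu, EndU.ofM_eq]
      refine congrArg toDiag (.symm ?_ : _ = tmul bimodRL _ t)
      rw [tmul_cons, one_tmul]

theorem ofNil_surjective (s : ℕ) (f : diagU.mor s s) : ∃ a : NilAff s, f = EndU.ofNil s a := by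
  induction f using toDiag_ind with | h t =>
  obtain ⟨a, h⟩ := exists_ofNil t rfl
  exact ⟨a, eq_of_heq h⟩

/-- On the diagonal `ofNil` is surjective and is a right inverse of `ofDiag`, up to `elH`, so both
are bijective. Off the diagonal both sides are `0`. -/
theorem ofDiag_bijective (x y : ℕ) : Function.Bijective (ofDiag (x := x) (y := y)) := by
  by_cases h : x = y
  · subst h
    refine ⟨fun f g h => ?_, fun f => ⟨EndU.ofNil x (valH f), (ofDiag_ofNil _).trans (catH.elH_val f)⟩⟩
    obtain ⟨a, rfl⟩ := ofNil_surjective x f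
    obtain ⟨b, rfl⟩ := ofNil_surjective x g
    rw [ofDiag_ofNil, ofDiag_ofNil] at h
    rw [← catH.val_elH a, h, catH.val_elH]
  · refine ⟨fun f g _ => (diagU_eq_zero h f).trans (diagU_eq_zero h g).symm, fun f => ⟨0, ?_⟩⟩
    rw [(catH.eq_or x y f).resolve_right h, ofDiag_zero]

/-- The isomorphism from the diagonal category to `ℋ^+`. -/
def diagIso : DPCat.Iso diagU catH where
  toEquiv x y := Equiv.ofBijective ofDiag (ofDiag_bijective x y)
  map_zero _ _ := ofDiag_zero
  map_one := ofDiag_one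
  map_comp := ofDiag_comp
  map_gr := fun {x y} g f => by
    -- Degrees are also preserved by the inverse `ofNil`, which gives the remaining implication.
    refine ⟨fun h => ?_, ofDiag_gr⟩
    by_cases hxy : x = y
    · subst hxy
      obtain ⟨a, rfl⟩ := ofNil_surjective x f
      change ofDiag _ ∈ _ at h
      rw [ofDiag_ofNil] at h
      exact EndU.ofNil_gr (catH.elH_gr.1 h)
    · rw [diagU_eq_zero hxy f]
      exact toDiag_gr (LawfulDGP.zero_mem g)
  map_d := fun {x y} f => by
    change d (of (ofDiag f)) = map ofDiag (d (of f))
    by_cases hxy : x = y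
    · subst hxy
      obtain ⟨a, rfl⟩ := ofNil_surjective x f
      rw [ofDiag_ofNil, catH.d_elH]
      -- Compatibility with `d` is known for `ofNil`, and it passes to its inverse.
      refine .trans ?_ (congrArg (map (ofDiag (x := x) (y := x))) (EndU.d_ofNil a)).symm
      refine .trans ?_ (map_map (EndU.ofNil x) (ofDiag (x := x) (y := x)) (map_zero (EndU.ofNil x)) ofDiag_zero _).symm
      simp only [ofDiag_ofNil]
    · rw [diagU_eq_zero hxy f, ofDiag_zero]
      simp

end NilAff

/-! ## Bilinear extensions of products -/

namespace F2

section

variable {S T U : Type} [Zero S] [Zero T] [Zero U]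

theorem bil_of {m : S → T → U} (h : ∀ t, m 0 t = 0) (s : S) (x : F2 T) : bil m (of s) x = map (m s) x := by
  rw [bil, lift_of]
  exact LinearMap.ext fun x => map_zero_fun _ h x

theorem bilin_ext {N : Type} [AddCommGroup N] [Module (ZMod 2) N] {f g : F2 S →ₗ[ZMod 2] F2 T →ₗ[ZMod 2] N}
    (h : ∀ s t, f (of s) (of t) = g (of s) (of t)) (x : F2 S) (y : F2 T) : f x y = g x y :=
  LinearMap.congr_fun (hom_ext_apply (fun s => hom_ext (h s)) x) y

end

section

variable {S : Type} [MonoidWithZero S]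

theorem bil_mul_of (a b : S) : bil (fun a b : S => a * b) (of a) (of b) = of (a * b) := by
  rw [bil_of zero_mul, map_of _ (mul_zero a)]

theorem bil_mul_assoc (x y z : F2 S) : bil (fun a b : S => a * b) (bil (fun a b : S => a * b) x y) z =
    bil (fun a b : S => a * b) x (bil (fun a b : S => a * b) y z) := by
  have h : ∀ a b : S, bil (fun a b : S => a * b) (of (a * b)) z = bil (fun a b : S => a * b) (of a) (bil (fun a b : S => a * b) (of b) z) := by
    intro a b
    refine hom_ext_apply (φ := bil (fun a b : S => a * b) (of (a * b)))
      (ψ := (bil (fun a b : S => a * b) (of a)).comp (bil (fun a b : S => a * b) (of b))) (fun c => ?_) z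
    rw [LinearMap.comp_apply, bil_mul_of, bil_mul_of, bil_mul_of, mul_assoc]
  refine bilin_ext (f := (bil fun a b : S => a * b).compr₂ ((bil fun a b : S => a * b).flip z))
    (g := (bil fun a b : S => a * b).compl₂ ((bil fun a b : S => a * b).flip z)) (fun a b => ?_) x y
  change bil (fun a b : S => a * b) (bil (fun a b : S => a * b) (of a) (of b)) z =
    bil (fun a b : S => a * b) (of a) (bil (fun a b : S => a * b) (of b) z)
  rw [bil_mul_of, h]

theorem one_bil_mul (x : F2 S) : bil (fun a b : S => a * b) (of 1) x = x := by
  rw [bil_of zero_mul]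
  exact (congrArg (fun f => map f x) (funext one_mul)).trans (map_id x)

theorem bil_mul_one (x : F2 S) : bil (fun a b : S => a * b) x (of 1) = x := by
  refine hom_ext_apply (φ := (bil fun a b : S => a * b).flip (of 1)) (ψ := LinearMap.id) (fun a => ?_) x
  rw [LinearMap.flip_apply, bil_mul_of, mul_one, LinearMap.id_apply]

end

end F2

theorem mulH_of {s : ℕ} (a b : NH s) : mulH (of a) (of b) = of (a * b) := bil_mul_of a b

section NilAff

variable {s : ℕ}

theorem mulA_of (a b : NilAff s) : mulA (of a) (of b) = of (a * b) := bil_mul_of a b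

theorem mulA_assoc (x y z : F2 (NilAff s)) : mulA (mulA x y) z = mulA x (mulA y z) := bil_mul_assoc x y z

theorem one_mulA (x : F2 (NilAff s)) : mulA (of 1) x = x := one_bil_mul x

theorem mulA_one (x : F2 (NilAff s)) : mulA x (of 1) = x := bil_mul_one x

theorem d_mulA (x y : F2 (NilAff s)) : d (mulA x y) = mulA (d x) y + mulA x (d y) := by
  refine bilin_ext (f := (mulA (n := s)).compr₂ d) (g := (mulA (n := s)).comp d + (mulA (n := s)).compl₂ d) (fun a b => ?_) x y
  simp only [LinearMap.compr₂_apply, LinearMap.add_apply, LinearMap.compl₂_apply, LinearMap.comp_apply]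
  rw [mulA_of, NilAff.leibniz]
  congr 1
  · refine hom_ext_apply (φ := map fun a' => a' * b) (ψ := (mulA (n := s)).flip (of b)) (fun a' => ?_) (d (of a))
    rw [LinearMap.flip_apply, mulA_of, map_of (fun a' => a' * b) (zero_mul b)]
  · exact (bil_of (m := fun a b : NilAff s => a * b) zero_mul a (d (of b))).symm

theorem mulA_mem_on {p q : ℤ} {x y : F2 (NilAff s)} (hx : x ∈ on (gr (S := NilAff s) p)) (hy : y ∈ on (gr (S := NilAff s) q)) :
    mulA x y ∈ on (gr (S := NilAff s) (p + q)) := by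
  refine on_induction ((mulA (n := s)).flip y) _ (fun a ha => ?_) hx
  refine on_induction (mulA (of a)) _ (fun b hb => ?_) hy
  rw [mulA_of]
  exact of_mem_on (NilAff.mul_gr ha hb)

/-- The morphism of algebras `H_s → Ĥ_s^+`. -/
def incHA (s : ℕ) : HA s →ₗ[ZMod 2] F2 (NilAff s) := map (incH s)

theorem incHA_of (a : NH s) : incHA s (of a) = of (incH s a) := map_of _ (incH_zero s) a

theorem incHA_mul (x y : HA s) : incHA s (mulH x y) = mulA (incHA s x) (incHA s y) := by
  refine bilin_ext (f := (mulH (n := s)).compr₂ (incHA s)) (g := (mulA (n := s)).compl₁₂ (incHA s) (incHA s)) (fun a b => ?_) x y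
  simp only [LinearMap.compr₂_apply, LinearMap.compl₁₂_apply]
  rw [mulH_of, incHA_of, incHA_of, incHA_of, mulA_of, map_mul]

theorem d_incHA (x : HA s) : d (incHA s x) = incHA s (d x) := by
  refine hom_ext_apply (φ := (d (S := NilAff s)).comp (incHA s)) (ψ := (incHA s).comp d) (fun a => ?_) x
  rw [LinearMap.comp_apply, LinearMap.comp_apply, incHA_of, d_incH]
  rfl

theorem incHA_mem_on {g : ℤ} {x : HA s} (hx : x ∈ on (gr (S := NH s) g)) : incHA s x ∈ on (gr (S := NilAff s) g) :=
  map_mem_on _ (incH_zero s) (fun _ h => incH_gr h) hx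

theorem incHA_shift {n : ℕ} (h : HA n) : mulA (incHA (n + 1) (map (NH.sh 1 n (n + 1)) h)) (of (NilAff.c (n + 1))) =
    mulA (of (NilAff.c (n + 1))) (incHA (n + 1) (map (NH.sh 0 n (n + 1)) h)) := by
  refine hom_ext_apply (φ := ((mulA (n := n + 1)).flip (of (NilAff.c (n + 1)))).comp ((incHA (n + 1)).comp (map (NH.sh 1 n (n + 1)))))
    (ψ := (mulA (of (NilAff.c (n + 1)))).comp ((incHA (n + 1)).comp (map (NH.sh 0 n (n + 1))))) (fun a => ?_) h
  simp only [LinearMap.comp_apply, LinearMap.flip_apply]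
  rw [map_of _ (NH.sh_zero _ _ _), map_of _ (NH.sh_zero _ _ _), incHA_of, incHA_of, mulA_of, mulA_of, NilAff.incH_shift]

/-- The bilinear map `(a, b) ↦ a c b`. -/
def incPair (s : ℕ) : HA s →ₗ[ZMod 2] HA s →ₗ[ZMod 2] F2 (NilAff s) :=
  (mulA (n := s)).compl₁₂ (((mulA (n := s)).flip (of (NilAff.c s))).comp (incHA s)) (incHA s)

theorem incPair_apply (a b : HA s) : incPair s a b = mulA (mulA (incHA s a) (of (NilAff.c s))) (incHA s b) := rfl

theorem incPair_of (a b : NH s) : incPair s (of a) (of b) = of (incH s a * NilAff.c s * incH s b) := by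
  rw [incPair_apply, incHA_of, incHA_of, mulA_of, mulA_of]

theorem incPair_zero : incPair 0 = 0 := LinearMap.ext₂ fun a b => by
  rw [incPair_apply, (NilAff.nilRel 0).zero rfl, of_zero, map_zero, map_zero]; rfl

theorem incPair_balanced {n : ℕ} (a b : HA (n + 1)) (h : HA n) :
    incPair (n + 1) (mulH a (map (NH.sh 1 n (n + 1)) h)) b = incPair (n + 1) a (mulH (map (NH.sh 0 n (n + 1)) h) b) := by
  rw [incPair_apply, incPair_apply, incHA_mul, incHA_mul, mulA_assoc (incHA _ a), incHA_shift, mulA_assoc, mulA_assoc, mulA_assoc]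

/-- For `s ≥ 1` this is the balance `f_1(h) c = c h`. For `s = 0` the subspace is everything by
convention, and the pairing vanishes because `c = 0`. -/
theorem balSub_le_ker (s : ℕ) : balSub (A := HA s) (B := HA s) (K := HA (s - 1)) (s ≠ 0)
    (fun a h => mulH a (F2.map (NH.sh 1 (s - 1) s) h)) (fun h b => mulH (F2.map (NH.sh 0 (s - 1) s) h) b) ≤
    LinearMap.ker (TensorProduct.lift (incPair s)) := by
  rw [balSub, Submodule.span_le]
  intro t ht
  rw [SetLike.mem_coe, LinearMap.mem_ker]
  rcases s with _ | n
  · rw [incPair_zero]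
    exact LinearMap.congr_fun (TensorProduct.ext' (g := TensorProduct.lift 0) (h := 0) fun a b => rfl) t
  · rcases ht with hs | ⟨a, h, b, rfl⟩
    · exact absurd (Nat.succ_ne_zero n) hs
    · rw [map_sub, TensorProduct.lift.tmul, TensorProduct.lift.tmul]
      exact sub_eq_zero.2 (incPair_balanced a b h)

/-- The map `M_s → Ĥ_s^+`, `a ⊗ b ↦ a c b`. -/
def incMM (s : ℕ) : MM s →ₗ[ZMod 2] F2 (NilAff s) :=
  Submodule.liftQ _ (TensorProduct.lift (incPair s)) (balSub_le_ker s)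

theorem incMM_tens (a b : HA s) : incMM s (tens a b) = mulA (mulA (incHA s a) (of (NilAff.c s))) (incHA s b) := rfl

theorem incMM_tens_of (a b : NH s) : incMM s (tens (of a) (of b)) = of (incH s a * NilAff.c s * incH s b) := incPair_of a b

end NilAff

/-! ## The bimodule `M_s` and the algebra `T_{H_s}(M_s)/(κ)` -/

section TA

variable {s : ℕ}

/-- `a ⊗ b` as a bilinear map. -/
def tensL₂ (s : ℕ) : HA s →ₗ[ZMod 2] HA s →ₗ[ZMod 2] MM s :=
  (TensorProduct.mk (ZMod 2) (HA s) (HA s)).compr₂ (balSub _ _ _).mkQ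

theorem tens_hom_ext {N : Type} [AddCommGroup N] [Module (ZMod 2) N] {f g : MM s →ₗ[ZMod 2] N}
    (h : ∀ a b : NH s, f (tens (of a) (of b)) = g (tens (of a) (of b))) (m : MM s) : f m = g m := by
  have : f.comp (balSub _ _ _).mkQ = g.comp (balSub _ _ _).mkQ :=
    TensorProduct.ext' fun a b => bilin_ext (f := (tensL₂ s).compr₂ f) (g := (tensL₂ s).compr₂ g) h a b
  obtain ⟨t, rfl⟩ := Submodule.mkQ_surjective _ m
  exact LinearMap.congr_fun this t

theorem tens_balanced {n : ℕ} (a b : HA (n + 1)) (h : HA n) :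
    (tens (mulH a (map (NH.sh 1 n (n + 1)) h)) b : MM (n + 1)) = tens a (mulH (map (NH.sh 0 n (n + 1)) h) b) := by
  refine (Submodule.Quotient.eq _).2 (Submodule.subset_span (Or.inr ⟨a, h, b, rfl⟩))

theorem tens_zero (m : MM 0) : m = 0 := by
  obtain ⟨t, rfl⟩ := Submodule.mkQ_surjective _ m
  exact (Submodule.Quotient.mk_eq_zero _).2 (Submodule.subset_span (Or.inl fun h => h rfl))

theorem mk_rel {x y : FreeAlgebra (ZMod 2) (HA s ⊕ MM s)} (h : TRel s x y) :
    RingQuot.mkAlgHom (ZMod 2) (TRel s) x = RingQuot.mkAlgHom (ZMod 2) (TRel s) y := RingQuot.mkAlgHom_rel _ h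

theorem iH_add (h h' : HA s) : iH (h + h') = iH h + iH h' := (mk_rel (.addH h h')).trans (map_add _ _ _)

theorem iH_one : iH (of (1 : NH s)) = 1 := (mk_rel .oneH).trans (map_one _)

theorem iH_mul (h h' : HA s) : iH (mulH h h') = iH h * iH h' := (mk_rel (.mulH h h')).trans (map_mul _ _ _)

theorem iM_add (m m' : MM s) : iM (m + m') = iM m + iM m' := (mk_rel (.addM m m')).trans (map_add _ _ _)

theorem iM_left (h a b : HA s) : iM (tens (mulH h a) b) = iH h * iM (tens a b) := (mk_rel (.left h a b)).trans (map_mul _ _ _)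

theorem iM_right (a b h : HA s) : iM (tens a (mulH b h)) = iM (tens a b) * iH h := (mk_rel (.right a b h)).trans (map_mul _ _ _)

theorem iM_kappa (hs : 2 ≤ s) : iM (tens (of (1 : NH s)) (of 1)) * iM (tens (of 1) (of (NH.T s (s - 2)))) =
    iM (tens (of (NH.T s 0)) (of 1)) * iM (tens (of 1) (of 1)) :=
  (map_mul _ _ _).symm.trans ((mk_rel (.kappa hs)).trans (map_mul _ _ _))

/-- The structure map `H_s → T_{H_s}(M_s)/(κ)`, as a linear map. -/
def iHL (s : ℕ) : HA s →ₗ[ZMod 2] TA s := AddMonoidHom.toZModLinearMap 2 (AddMonoidHom.mk' iH iH_add)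

/-- The structure map `M_s → T_{H_s}(M_s)/(κ)`, as a linear map. -/
def iML (s : ℕ) : MM s →ₗ[ZMod 2] TA s := AddMonoidHom.toZModLinearMap 2 (AddMonoidHom.mk' iM iM_add)

theorem iH_zero : iH (0 : HA s) = 0 := map_zero (iHL s)

theorem iM_zero : iM (0 : MM s) = 0 := map_zero (iML s)

theorem iM_tens_of (a b : NH s) : iM (tens (of a) (of b)) = iH (of a) * iM (tens (of 1) (of 1)) * iH (of b) := by
  rw [← iM_left, ← iM_right, mulH_of, mulH_of, mul_one, one_mul]

theorem TA.ind {P : TA s → Prop} (hr : ∀ r : ZMod 2, P (algebraMap _ _ r)) (hH : ∀ h, P (iH h)) (hM : ∀ m, P (iM m))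
    (hadd : ∀ x y, P x → P y → P (x + y)) (hmul : ∀ x y, P x → P y → P (x * y)) (x : TA s) : P x := by
  obtain ⟨x, rfl⟩ := RingQuot.mkAlgHom_surjective (ZMod 2) (TRel s) x
  induction x using FreeAlgebra.induction with
  | grade0 r => rw [AlgHom.commutes]; exact hr r
  | grade1 a => exact match a with
    | .inl h => hH h
    | .inr m => hM m
  | mul x y hx hy => rw [map_mul]; exact hmul _ _ hx hy
  | add x y hx hy => rw [map_add]; exact hadd _ _ hx hy

/-- The defining relations of `Ŝ_s^{+,nil}` hold in `T_{H_s}(M_s)/(κ)`. -/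
theorem TA.nilRel (s : ℕ) : NilRel s (fun i => iH (of (NH.T s i))) (iM (tens (of (1 : NH s)) (of 1))) where
  sq i _ := by rw [← iH_mul, mulH_of, NH.T_sq, of_zero, iH_zero]
  comm i j hij _ := by rw [← iH_mul, ← iH_mul, mulH_of, mulH_of, NH.T_comm hij]
  braid i _ := by simp only [← iH_mul, mulH_of, NH.T_braid]
  shift i hi := by
    obtain ⟨n, rfl⟩ : ∃ n, s = n + 1 := ⟨s - 1, by omega⟩
    have h := tens_balanced (of (1 : NH (n + 1))) (of 1) (of (NH.T n i))
    rw [map_of _ (NH.sh_zero _ _ _), map_of _ (NH.sh_zero _ _ _), NH.sh_T _ _ _ ⟨i, by omega⟩, NH.sh_T _ _ _ ⟨i, by omega⟩,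
      mulH_of, mulH_of, one_mul, mul_one, add_zero] at h
    rw [← iM_left, ← iM_right, mulH_of, mulH_of, mul_one, one_mul, h]
  kappa i hi := by
    -- With the scalars taken out of `M_s`, the vanishing of `κ` reads `c c T_{s-1} = T_1 c c`.
    have h := iM_kappa (s := s) (by omega)
    obtain rfl : i = s - 2 := by omega
    rw [iM_tens_of 1 (NH.T s (s - 2)), iM_tens_of (NH.T s 0) 1, iH_one, one_mul, mul_one] at h
    rw [← mul_assoc, ← h, mul_assoc]
  zero hs := by
    subst hs
    rw [tens_zero (tens _ _), iM_zero]

/-! ### The isomorphism of algebras with `Ĥ_s^+` -/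

/-- The algebra morphism `T_{H_s}(M_s)/(κ) → End(Ĥ_s^+)`. -/
def TA.toEnd (s : ℕ) : TA s →ₐ[ZMod 2] Module.End (ZMod 2) (F2 (NilAff s)) :=
  -- The product of `Ĥ_s^+` is given as a bilinear map, so the morphism is built through the left
  -- regular representation and recovered by evaluation at `1`.
  RingQuot.liftAlgHom (ZMod 2) ⟨FreeAlgebra.lift (ZMod 2) (Sum.elim (fun h => mulA (incHA s h)) fun m => mulA (incMM s m)), by
    intro x y h
    have hmul : ∀ x y : F2 (NilAff s), (mulA (mulA x y) : Module.End (ZMod 2) (F2 (NilAff s))) = mulA x * mulA y :=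
      fun x y => LinearMap.ext fun z => mulA_assoc x y z
    induction h with
    | addH h h' => simp only [map_add, FreeAlgebra.lift_ι_apply, Sum.elim_inl]
    | oneH =>
      rw [map_one, FreeAlgebra.lift_ι_apply, Sum.elim_inl, incHA_of, map_one]
      exact LinearMap.ext one_mulA
    | mulH h h' => simp only [map_mul, FreeAlgebra.lift_ι_apply, Sum.elim_inl, incHA_mul, hmul]
    | addM m m' => simp only [map_add, FreeAlgebra.lift_ι_apply, Sum.elim_inr]
    | left h a b => 
      rw [map_mul, FreeAlgebra.lift_ι_apply, FreeAlgebra.lift_ι_apply, FreeAlgebra.lift_ι_apply]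
      simp only [Sum.elim_inl, Sum.elim_inr]
      rw [← hmul, incMM_tens, incMM_tens, incHA_mul]
      simp only [mulA_assoc]
    | right a b h => 
      rw [map_mul, FreeAlgebra.lift_ι_apply, FreeAlgebra.lift_ι_apply, FreeAlgebra.lift_ι_apply]
      simp only [Sum.elim_inl, Sum.elim_inr]
      rw [← hmul, incMM_tens, incMM_tens, incHA_mul]
      simp only [mulA_assoc]
    | kappa hs =>
      simp only [map_mul, FreeAlgebra.lift_ι_apply, Sum.elim_inr, incMM_tens_of]
      rw [← hmul, ← hmul, mulA_of, mulA_of, incH_T (by omega), incH_T (by omega)]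
      have k := (NilAff.nilRel s).kappa (s - 2) (by omega)
      simp only [map_one, one_mul, mul_one, mul_assoc] at k ⊢
      rw [k]⟩

theorem TA.toEnd_iH (h : HA s) : TA.toEnd s (iH h) = mulA (incHA s h) := by
  rw [TA.toEnd, iH, RingQuot.liftAlgHom_mkAlgHom_apply, FreeAlgebra.lift_ι_apply, Sum.elim_inl]

theorem TA.toEnd_iM (m : MM s) : TA.toEnd s (iM m) = mulA (incMM s m) := by
  rw [TA.toEnd, iM, RingQuot.liftAlgHom_mkAlgHom_apply, FreeAlgebra.lift_ι_apply, Sum.elim_inr]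

/-- The linear map `T_{H_s}(M_s)/(κ) → Ĥ_s^+`. -/
def TA.toAff (s : ℕ) : TA s →ₗ[ZMod 2] F2 (NilAff s) := (LinearMap.applyₗ (of 1)).comp (TA.toEnd s).toLinearMap

theorem TA.toAff_apply (x : TA s) : TA.toAff s x = TA.toEnd s x (of 1) := rfl

theorem TA.toAff_one : TA.toAff s 1 = of 1 := by
  rw [TA.toAff_apply, map_one]; rfl

theorem TA.toAff_iH (h : HA s) : TA.toAff s (iH h) = incHA s h := by
  rw [TA.toAff_apply, TA.toEnd_iH, mulA_one]

theorem TA.toAff_iM (m : MM s) : TA.toAff s (iM m) = incMM s m := by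
  rw [TA.toAff_apply, TA.toEnd_iM, mulA_one]

/-- The image consists of left multiplications, each determined by its value at `1`. This makes the
evaluation `TA.toAff` multiplicative. -/
theorem TA.toEnd_eq (x : TA s) : TA.toEnd s x = mulA (TA.toAff s x) := by
  induction x using TA.ind with
  | hr r =>
    rw [TA.toAff_apply, AlgHom.commutes, Algebra.algebraMap_eq_smul_one, LinearMap.smul_apply, map_smul, Module.End.one_apply]
    congr 1
    exact (LinearMap.ext one_mulA).symm
  | hH h => rw [TA.toAff_iH, TA.toEnd_iH]
  | hM m => rw [TA.toAff_iM, TA.toEnd_iM]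
  | hadd x y hx hy => rw [map_add, map_add, map_add, hx, hy]
  | hmul x y hx hy =>
    refine LinearMap.ext fun z => ?_
    rw [TA.toAff_apply, map_mul, Module.End.mul_apply, Module.End.mul_apply, ← TA.toAff_apply y, hx, hy, mulA_assoc]

theorem TA.toAff_mul (x y : TA s) : TA.toAff s (x * y) = mulA (TA.toAff s x) (TA.toAff s y) := by
  rw [TA.toAff_apply, map_mul, Module.End.mul_apply, ← TA.toAff_apply y, TA.toEnd_eq x]

/-- The algebra morphism `Ĥ_s^+ → T_{H_s}(M_s)/(κ)`. -/
def TA.ofAff (s : ℕ) : F2 (NilAff s) →ₗ[ZMod 2] TA s := F2.lift (NilAff.lift _ _ (TA.nilRel s))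

theorem TA.ofAff_of (a : NilAff s) : TA.ofAff s (of a) = NilAff.lift _ _ (TA.nilRel s) a := lift_of _ (map_zero _) a

theorem TA.ofAff_one : TA.ofAff s (of 1) = 1 := by rw [TA.ofAff_of, map_one]

theorem TA.ofAff_t {i : ℕ} (hi : i + 1 < s) : TA.ofAff s (of (NilAff.t s i)) = iH (of (NH.T s i)) := by
  rw [TA.ofAff_of, NilAff.lift_t _ hi]

theorem TA.ofAff_c : TA.ofAff s (of (NilAff.c s)) = iM (tens (of 1) (of 1)) := by
  rw [TA.ofAff_of, NilAff.lift_c]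

theorem TA.ofAff_of_mul (a b : NilAff s) : TA.ofAff s (of (a * b)) = TA.ofAff s (of a) * TA.ofAff s (of b) := by
  rw [TA.ofAff_of, TA.ofAff_of, TA.ofAff_of, map_mul]

theorem TA.ofAff_mul (x y : F2 (NilAff s)) : TA.ofAff s (mulA x y) = TA.ofAff s x * TA.ofAff s y := by
  refine bilin_ext (f := (mulA (n := s)).compr₂ (TA.ofAff s))
    (g := (LinearMap.mul (ZMod 2) (TA s)).compl₁₂ (TA.ofAff s) (TA.ofAff s)) (fun a b => ?_) x y
  simp only [LinearMap.compr₂_apply, LinearMap.compl₁₂_apply, LinearMap.mul_apply']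
  rw [mulA_of, TA.ofAff_of_mul]

theorem TA.ofAff_incHA (h : HA s) : TA.ofAff s (incHA s h) = iH h := by
  refine hom_ext_apply (φ := (TA.ofAff s).comp (incHA s)) (ψ := iHL s) (fun a => ?_) h
  change TA.ofAff s (incHA s (of a)) = iH (of a)
  rw [incHA_of]
  refine NH.hom_ext (f := fun a => TA.ofAff s (of (incH s a))) (g := fun a => iH (of a)) ?_ ?_ ?_ iH_one (fun a b => ?_)
    (fun a b => ?_) (fun i hi => ?_) a
  · simp only [incH_zero, of_zero, map_zero]
  · simp only [of_zero, iH_zero]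
  · simp only [map_one, TA.ofAff_one]
  · simp only [map_mul, TA.ofAff_of_mul]
  · simp only [← iH_mul, mulH_of]
  · simp only [incH_T hi, TA.ofAff_t hi]

theorem TA.ofAff_incMM (m : MM s) : TA.ofAff s (incMM s m) = iM m := by
  refine tens_hom_ext (f := (TA.ofAff s).comp (incMM s)) (g := iML s) (fun a b => ?_) m
  change TA.ofAff s (incMM s (tens (of a) (of b))) = iM (tens (of a) (of b))
  rw [incMM_tens_of, TA.ofAff_of_mul, TA.ofAff_of_mul, ← incHA_of, ← incHA_of, TA.ofAff_incHA, TA.ofAff_incHA, TA.ofAff_c,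
    ← iM_tens_of]

theorem TA.ofAff_toAff (x : TA s) : TA.ofAff s (TA.toAff s x) = x := by
  induction x using TA.ind with
  | hr r => rw [Algebra.algebraMap_eq_smul_one, map_smul, map_smul, TA.toAff_one, TA.ofAff_one]
  | hH h => rw [TA.toAff_iH, TA.ofAff_incHA]
  | hM m => rw [TA.toAff_iM, TA.ofAff_incMM]
  | hadd x y hx hy => rw [map_add, map_add, hx, hy]
  | hmul x y hx hy => rw [TA.toAff_mul, TA.ofAff_mul, hx, hy]

theorem TA.toAff_ofAff (x : F2 (NilAff s)) : TA.toAff s (TA.ofAff s x) = x := by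
  refine hom_ext_apply (φ := (TA.toAff s).comp (TA.ofAff s)) (ψ := LinearMap.id) (fun a => ?_) x
  rw [LinearMap.comp_apply, LinearMap.id_apply]
  induction a using NilAff.ind with
  | h0 => simp
  | h1 => rw [TA.ofAff_one, TA.toAff_one]
  | ht a i hi ih => rw [TA.ofAff_of_mul, TA.toAff_mul, ih, TA.ofAff_t hi, TA.toAff_iH, incHA_of, incH_T hi, mulA_of]
  | hc a _ ih => rw [TA.ofAff_of_mul, TA.toAff_mul, ih, TA.ofAff_c, TA.toAff_iM, incMM_tens_of, map_one, one_mul, mul_one, mulA_of]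

/-- The isomorphism `T_{H_s}(M_s)/(κ) ≃ Ĥ_s^+`. -/
def TA.equiv (s : ℕ) : TA s ≃ₗ[ZMod 2] F2 (NilAff s) :=
  LinearEquiv.ofLinearMap (TA.toAff s) (TA.ofAff s) (LinearMap.ext TA.toAff_ofAff) (LinearMap.ext TA.ofAff_toAff)

/-! ### The transported differential and the grading -/

/-- The differential of `T_{H_s}(M_s)/(κ)`. -/
def TA.diff (s : ℕ) : TA s →ₗ[ZMod 2] TA s := (TA.ofAff s).comp ((d (S := NilAff s)).comp (TA.toAff s))

theorem TA.diff_apply (x : TA s) : TA.diff s x = TA.ofAff s (d (TA.toAff s x)) := rfl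

/-- The Leibniz rule is transported from `Ĥ_s^+`, so the compatibility of the differential with `κ`
needs no verification in `T_{H_s}(M_s)`. -/
theorem TA.diff_mul (x y : TA s) : TA.diff s (x * y) = TA.diff s x * y + x * TA.diff s y := by
  rw [TA.diff_apply, TA.toAff_mul, d_mulA, map_add, TA.ofAff_mul, TA.ofAff_mul, TA.ofAff_toAff, TA.ofAff_toAff]
  rfl

theorem TA.diff_iH (h : HA s) : TA.diff s (iH h) = iH (d h) := by
  rw [TA.diff_apply, TA.toAff_iH, d_incHA, TA.ofAff_incHA]

/-- The image of `a ⊗ b` is `a c b`, and the middle term of the Leibniz rule is absent because `d(c)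
= 0`. -/
theorem TA.diff_iM (a b : HA s) : TA.diff s (iM (tens a b)) = iM (tens (d a) b) + iM (tens a (d b)) := by
  rw [TA.diff_apply, TA.toAff_iM, incMM_tens, d_mulA, d_mulA, NilAff.d_c, map_zero, add_zero, d_incHA, d_incHA, ← incMM_tens,
    ← incMM_tens, map_add, TA.ofAff_incMM, TA.ofAff_incMM]

theorem Homog.mul {p q : ℤ} {x y : TA s} (hx : Homog s p x) (hy : Homog s q y) : Homog s (p + q) (x * y) := by
  induction hx with
  | one => rwa [one_mul, zero_add]
  | mulH hh _ ih => rw [mul_assoc, add_assoc]; exact .mulH hh ih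
  | mulM ha hb _ ih => rw [mul_assoc, add_assoc]; exact .mulM ha hb ih

theorem Homog.iH {p : ℤ} {h : HA s} (hh : h ∈ on (gr (S := NH s) p)) : Homog s p (iH h) := by
  have := Homog.mulH hh .one
  rwa [mul_one, add_zero] at this

theorem Homog.iM {p q : ℤ} {a b : HA s} (ha : a ∈ on (gr (S := NH s) p)) (hb : b ∈ on (gr (S := NH s) q)) :
    Homog s (p + q) (iM (tens a b)) := by
  have := Homog.mulM ha hb .one
  rwa [mul_one, add_zero] at this

theorem Homog.toAff_mem {g : ℤ} {x : TA s} (h : Homog s g x) : TA.toAff s x ∈ on (gr (S := NilAff s) g) := by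
  induction h with
  | one => rw [TA.toAff_one]; exact of_mem_on NilAff.one_gr
  | mulH hh _ ih => rw [TA.toAff_mul, TA.toAff_iH]; exact mulA_mem_on (incHA_mem_on hh) ih
  | mulM ha hb _ ih =>
    rw [TA.toAff_mul, TA.toAff_iM, incMM_tens]
    have := mulA_mem_on (incHA_mem_on ha) (of_mem_on (NilAff.c_gr (n := s)))
    rw [add_zero] at this
    exact mulA_mem_on (mulA_mem_on this (incHA_mem_on hb)) ih

theorem TA.homog_ofAff {σ : Equiv.Perm ℤ} (h : IsAffPos s σ) : Homog s (-(ell s σ : ℤ)) (TA.ofAff s (of (NilAff.T s σ))) := by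
  refine h.induction (P := fun σ => Homog s (-(ell s σ : ℤ)) (TA.ofAff s (of (NilAff.T s σ)))) ?_
    (fun i σ hi h hlt ih => ?_) (fun σ hn h ih => ?_)
  · rw [NilAff.T_one, TA.ofAff_one, ell_one]; exact .one
  · rw [← NilAff.T_mul_t_of_lt hi h hlt, TA.ofAff_of_mul, TA.ofAff_t hi, h.isExpr.ell_mul_simpleRefl_of_lt (by omega) hlt]
    have := ih.mul (.iH (of_mem_on (NH.T_gr i)))
    rwa [← neg_add, ← Nat.cast_one, ← Nat.cast_add] at this
  · rw [← NilAff.T_mul_c hn h, TA.ofAff_of_mul, TA.ofAff_c, h.isExpr.ell_mul_shiftPerm]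
    have := ih.mul (.iM (of_mem_on NH.one_gr) (of_mem_on NH.one_gr))
    rwa [add_zero, add_zero] at this

/-- The forward map takes products of homogeneous elements to homogeneous ones. Conversely, a basis
element `T_σ` comes from a product of homogeneous generators, read off from a reduced word. -/
theorem TA.mem_grT {g : ℤ} {x : TA s} : x ∈ grT s g ↔ TA.toAff s x ∈ on (gr (S := NilAff s) g) := by
  refine ⟨fun h => ?_, fun h => ?_⟩
  · have : grT s g ≤ (on (gr (S := NilAff s) g)).comap (TA.toAff s) := Submodule.span_le.2 fun x hx => hx.toAff_mem
    exact this h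
  · rw [← TA.ofAff_toAff x]
    refine on_induction (TA.ofAff s) _ (fun a ha => ?_) h
    rcases ha with rfl | ⟨σ, rfl, rfl⟩
    · rw [of_zero, map_zero]; exact zero_mem _
    · exact Submodule.subset_span (TA.homog_ofAff σ.2)

end TA

end NilGlue
end
end

theorem mainTheorem6 :
    -- both categories are differential graded pointed categories
    NilGlue.diagU.IsDGPointedCategory ∧ NilGlue.catH.IsDGPointedCategory ∧
    -- the isomorphism of categories, the isomorphisms of algebras, and the differentials of `T_{H_s}(M_s)/(κ)`
    ∃ (Θ : NilGlue.DPCat.Iso NilGlue.diagU NilGlue.catH)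
      (φ : ∀ s : ℕ, NilGlue.TA s ≃ₗ[ZMod 2] NilGlue.F2 (NilGlue.NilAff s))
      (dT : ∀ s : ℕ, NilGlue.TA s →ₗ[ZMod 2] NilGlue.TA s),
      (∀ s : ℕ,
        -- `dT` is the derivation that extends the differentials of `H_s` and of `M_s`
        (∀ x y, dT s (x * y) = dT s x * y + x * dT s y) ∧
        (∀ h : NilGlue.HA s, dT s (NilGlue.iH h) = NilGlue.iH (NilGlue.DGP.d h)) ∧
        (∀ a b : NilGlue.HA s, dT s (NilGlue.iM (NilGlue.tens a b)) =
          NilGlue.iM (NilGlue.tens (NilGlue.DGP.d a) b) + NilGlue.iM (NilGlue.tens a (NilGlue.DGP.d b))) ∧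
        -- `φ` is an isomorphism of differential graded algebras
        φ s 1 = NilGlue.F2.of (NilGlue.NilAff.one s) ∧
        (∀ x y, φ s (x * y) = NilGlue.mulA (φ s x) (φ s y)) ∧
        (∀ x, φ s (dT s x) = NilGlue.DGP.d (φ s x)) ∧
        (∀ (g : ℤ) (x : NilGlue.TA s), x ∈ NilGlue.grT s g ↔
          φ s x ∈ NilGlue.F2.on (NilGlue.DGP.gr (S := NilGlue.NilAff s) g)) ∧
        -- `T_i ↦ T_{s_i}` and `a ⊗ b ↦ a c b`
        (∀ i : ℕ, i + 1 < s → φ s (NilGlue.iH (NilGlue.F2.of (NilGlue.NH.T s i))) =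
          NilGlue.F2.of (NilGlue.NilAff.T s (NilGlue.simpleRefl s ((i : ℤ) + 1)))) ∧
        (∀ a b : NilGlue.HA s, φ s (NilGlue.iM (NilGlue.tens a b)) =
          NilGlue.mulA (NilGlue.mulA (φ s (NilGlue.iH a)) (NilGlue.F2.of (NilGlue.NilAff.T s NilGlue.shiftPerm)))
            (φ s (NilGlue.iH b)))) ∧
      -- `Θ` is induced by the isomorphisms `φ s`
      (∀ (s : ℕ) (a : NilGlue.NH s), NilGlue.F2.of (NilGlue.valH (Θ.toEquiv s s (NilGlue.inH s a))) =
        φ s (NilGlue.iH (NilGlue.F2.of a))) ∧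
      (∀ (s : ℕ) (a b : NilGlue.NH s), NilGlue.F2.of (NilGlue.valH (Θ.toEquiv s s (NilGlue.inM s a b))) =
        φ s (NilGlue.iM (NilGlue.tens (NilGlue.F2.of a) (NilGlue.F2.of b)))) := by
  refine ⟨NilGlue.NilAff.diagIso.isDGPointedCategory NilGlue.catH.isDGPointedCategory, NilGlue.catH.isDGPointedCategory,
    NilGlue.NilAff.diagIso, NilGlue.TA.equiv, NilGlue.TA.diff, fun s => ⟨NilGlue.TA.diff_mul, NilGlue.TA.diff_iH,
      -- Compatibility of `φ s` with the differentials is only the cancellation of `TA.toAff`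
      -- against its inverse, the differential being defined by transport.
      NilGlue.TA.diff_iM, NilGlue.TA.toAff_one, NilGlue.TA.toAff_mul, fun x => NilGlue.TA.toAff_ofAff _,
      fun g x => NilGlue.TA.mem_grT, fun i hi => ?_, fun a b => ?_⟩, fun s a => ?_, fun s a b => ?_⟩
  · refine (NilGlue.TA.toAff_iH _).trans ?_
    rw [NilGlue.incHA_of, NilGlue.incH_T hi]
    rfl
  · refine (NilGlue.TA.toAff_iM _).trans ?_
    rw [NilGlue.incMM_tens, ← NilGlue.TA.toAff_iH, ← NilGlue.TA.toAff_iH]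
    rfl
  · refine .trans ?_ (NilGlue.TA.toAff_iH _).symm
    rw [NilGlue.incHA_of]
    exact congrArg NilGlue.F2.of ((congrArg NilGlue.valH (NilGlue.NilAff.ofDiag_ofH a)).trans (NilGlue.catH.val_elH _))
  · refine .trans ?_ (NilGlue.TA.toAff_iM _).symm
    rw [NilGlue.incMM_tens_of]
    exact congrArg NilGlue.F2.of ((congrArg NilGlue.valH (NilGlue.NilAff.ofDiag_ofM a b)).trans (NilGlue.catH.val_elH _))
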